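/- Let $d\ge 1$, $k\ge 0$ be integers, let $K\subset\mathbb R^d$ be compact and let $\sigma<\tau$ be real numbers. Write $\mathbf t(t,x)=t$ and $\mathbf p(t,x)=x$ for $(t,x)\in\mathbb R^{1+d}=\mathbb R\times\mathbb R^d$. **Notions.** $\mathrm N_{1+k}([\sigma,\tau]\times K)$ is the set of $(1+k)$-currents $S$ on $\mathbb R^{1+d}$ with $\mathbf M(S)+\mathbf M(\partial S)<\infty$ and $\operatorname{supp}S\subset[\sigma,\tau]\times K$. A current $T$ of finite mass is written $T=\vec T\,\|T\|$ (polar decomposition), and $\|\cdot\|$ also denotes the comass norm on covectors and the mass norm on multivectors. For such $S$ and $t\in\mathbb R$, the slice $S|_t$ is the $k$-current $S|_t(\omega)=\lim_{r\downarrow0}\frac1{2r}\int_{[t-r,t+r]\times\mathbb R^d}\langle\vec S,\mathrm dt\wedge\omega\rangle\,\mathrm d\|S\|$ (the limit exists for every $t$), and $S(t):=\mathbf p_*(S|_t)$, a $k$-current on $\mathbb R^d$. Similarly $\partial S(t):=\mathbf p_*((\partial S)|_t)$, which is $0$ by convention if $k=0$. For $I\subset\mathbb R$ an interval and $T\in\{S,\partial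 S\}$, $$\mathrm{Var}(T;I):=\int_{I\times\mathbb R^d}\|\mathbf p\vec T\|\,\mathrm d\|T\|,\qquad \|T\|_{\mathrm L^\infty(I)}:=\operatorname*{ess\,sup}_{t\in I}\mathbf M(T(t)),$$ and $\mathrm{Var}(T)$, $\|T\|_{\mathrm L^\infty}$ are these quantities for $I=[\sigma,\tau]$. The set $\mathrm N^{\mathrm{Lip}}_{1+k}([\sigma,\tau]\times K)$ consists of those $S\in\mathrm N_{1+k}([\sigma,\tau]\times K)$ for which $\|S\|_{\mathrm L^\infty}+\|\partial S\|_{\mathrm L^\infty}<\infty$, $\|S\|(\{\sigma,\tau\}\times\mathbb R^d)=0$, and both $t\mapsto\mathrm{Var}(S;(\sigma,t))$ and $t\mapsto\mathrm{Var}(\partial S;(\sigma,t))$ are Lipschitz on $(\sigma,\tau)$; for such $S$, $\mathrm{Lip}(S)$ is the Lipschitz constant of $t\mapsto\mathrm{Var}(S;(\sigma,t))+\mathrm{Var}(\partial S;(\sigma,t))$ on $(\sigma,\tau)$. Weak* convergence of currents is convergence on every smooth compactly supported test form. **Proposition.** Let $(S_j)_{j}\subset\mathrm N_{1+k}([\sigma,\tau]\times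 K)$ and suppose that there is $M>0$ with $$\|S_j\|_{\mathrm L^\infty}+\|\partial S_j\|_{\mathrm L^\infty}+\mathrm{Var}(S_j)+\mathrm{Var}(\partial S_j)\le M\qquad\text{for all }j.$$ Then there are $S\in\mathrm N_{1+k}([\sigma,\tau]\times K)$ and a subsequence of $(S_j)_j$ (not relabelled) such that $$S_j\overset{*}{\rightharpoonup}S\qquad\text{and}\qquad S_j(t)\overset{*}{\rightharpoonup}S(t)\quad\text{for almost every }t\in[\sigma,\tau],$$ and, along this subsequence, $$\mathrm{Var}(S)\le\liminf_{j\to\infty}\mathrm{Var}(S_j),\qquad \|S\|_{\mathrm L^\infty}\le\liminf_{j\to\infty}\|S_j\|_{\mathrm L^\infty},$$ $$\mathrm{Var}(\partial S)\le\liminf_{j\to\infty}\mathrm{Var}(\partial S_j),\qquad \|\partial S\|_{\mathrm L^\infty}\le\liminf_{j\to\infty}\|\partial S_j\|_{\mathrm L^\infty}.$$ If in addition $S_j\in\mathrm N^{\mathrm{Lip}}_{1+k}([\sigma,\tau]\times K)$ for all $j$ and $\sup_j\mathrm{Lip}(S_j)<\infty$, then for this same $S$ and subsequence $$S\in\mathrm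 N^{\mathrm{Lip}}_{1+k}([\sigma,\tau]\times K),\qquad S_j(t)\overset{*}{\rightharpoonup}S(t)\quad\text{for every }t\in[\sigma,\tau],\qquad \mathrm{Lip}(S)\le\liminf_{j\to\infty}\mathrm{Lip}(S_j).$$ -/

import Mathlib

open Set Filter Topology MeasureTheory
open scoped ENNReal NNReal Distributions

noncomputable section

namespace NormalCurrents

/-! ### Currents in a normed space -/

section General

variable {E : Type*} [NormedAddCommGroup E] [NormedSpace ℝ E]

/-- `k`-covectors of `E`. The operator norm of alternating maps,
`sup {|α (v₁, …, vₖ)| : |vᵢ| ≤ 1}`, is the comass norm when `E` is Euclidean. -/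
abbrev Covector (k : ℕ) (E : Type*) [NormedAddCommGroup E] [NormedSpace ℝ E] : Type _ :=
  E [⋀^Fin k]→L[ℝ] ℝ

/-- `k`-vectors of a finite-dimensional `E`, as the dual of the space of `k`-covectors. The dual
norm of the comass norm is the mass norm. -/
abbrev MultiVector (k : ℕ) (E : Type*) [NormedAddCommGroup E] [NormedSpace ℝ E] : Type _ :=
  StrongDual ℝ (Covector k E)

/-- The space `𝓓ᵏ(E)` of smooth compactly supported `k`-forms, with its usual LF topology. -/
abbrev TestForm (k : ℕ) (E : Type*) [NormedAddCommGroup E] [NormedSpace ℝ E] : Type _ :=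
  𝓓((⊤ : TopologicalSpace.Opens E), Covector k E)

/-- The space `𝓓ₖ(E)` of `k`-currents. -/
abbrev Current (k : ℕ) (E : Type*) [NormedAddCommGroup E] [NormedSpace ℝ E] : Type _ :=
  TestForm k E →L[ℝ] ℝ

/-- The exterior derivative on smooth compactly supported forms. -/
def extDerivForm (k : ℕ) (E : Type*) [NormedAddCommGroup E] [NormedSpace ℝ E] :
    TestForm k E →L[ℝ] TestForm (k + 1) E :=
  (TestFunction.postcompCLM (ContinuousAlternatingMap.alternatizeUncurryFinCLM ℝ E ℝ)).comp
    (TestFunction.fderivCLM ℝ ⊤ ⊤)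

theorem extDerivForm_apply (k : ℕ) (ω : TestForm k E) (x : E) :
    extDerivForm k E ω x = extDeriv (ω : E → Covector k E) x := by
  simp [extDerivForm, extDeriv]

/-- The boundary `∂T(ω) = T(dω)`. -/
def boundary {k : ℕ} (T : Current (k + 1) E) : Current k E :=
  T.comp (extDerivForm k E)

/-- The mass `𝐌(T) = sup {T(ω) : ‖ω(x)‖ ≤ 1 for all x}`. -/
def mass {k : ℕ} (T : Current k E) : ℝ≥0∞ :=
  ⨆ (ω : TestForm k E) (_ : ∀ x, ‖ω x‖ ≤ 1), ENNReal.ofReal (T ω)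

/-- The support of a current. -/
def support {k : ℕ} (T : Current k E) : Set E :=
  Distribution.dsupport (T : TestForm k E → ℝ)

/-- Normal currents (of positive degree): finite mass, finite boundary mass, compact support. -/
def IsNormal {k : ℕ} (T : Current (k + 1) E) : Prop :=
  mass T + mass (boundary T) < ∞ ∧ IsCompact (support T)

/-- Weak* convergence of a sequence of currents. -/
def WeakStarTendsto {k : ℕ} (T : ℕ → Current k E) (T' : Current k E) : Prop :=
  ∀ ω : TestForm k E, Tendsto (fun j => T j ω) atTop (𝓝 (T' ω))

/-- `T = ξ μ` is the polar (Radon–Nikodym) decomposition of the finite mass current `T`: `μ` is a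
finite Borel measure, `ξ` has unit mass norm `μ`-a.e., and `T(ω) = ∫ ⟨ξ, ω⟩ dμ`. -/
structure IsPolarDecomposition {k : ℕ} [MeasurableSpace E] (T : Current k E) (μ : Measure E)
    (ξ : E → MultiVector k E) : Prop where
  finite : IsFiniteMeasure μ
  measurable : StronglyMeasurable ξ
  unit : ∀ᵐ x ∂μ, ‖ξ x‖ = 1
  repr : ∀ ω : TestForm k E, T ω = ∫ x, ξ x (ω x) ∂μ

open Classical in
/-- The polar decomposition of a current. For a finite mass current on a Euclidean space it exists,
and it is unique up to changing the vector field on a null set. -/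
def polarDecomposition {k : ℕ} [MeasurableSpace E] (T : Current k E) :
    Measure E × (E → MultiVector k E) :=
  if h : ∃ p : Measure E × (E → MultiVector k E), IsPolarDecomposition T p.1 p.2 then h.choose
  else 0

/-- The mass measure `‖T‖`. -/
def massMeasure {k : ℕ} [MeasurableSpace E] (T : Current k E) : Measure E :=
  (polarDecomposition T).1

/-- The orienting field of `k`-vectors of `T`. -/
def orientation {k : ℕ} [MeasurableSpace E] (T : Current k E) : E → MultiVector k E :=
  (polarDecomposition T).2

end General

/-! ### Space-time -/

/-- Space-time `ℝ^{1+d} = ℝ × ℝ^d` with its Euclidean norm. -/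
abbrev SpaceTime (d : ℕ) : Type := WithLp 2 (ℝ × EuclideanSpace ℝ (Fin d))

/-- The temporal projection `𝐭(t,x) = t`, which as a covector is `dt`. -/
def tproj (d : ℕ) : SpaceTime d →L[ℝ] ℝ :=
  WithLp.fstL 2 ℝ ℝ (EuclideanSpace ℝ (Fin d))

/-- The spatial projection `𝐩(t,x) = x`. -/
def pproj (d : ℕ) : SpaceTime d →L[ℝ] EuclideanSpace ℝ (Fin d) :=
  WithLp.sndL 2 ℝ ℝ (EuclideanSpace ℝ (Fin d))

variable {d k : ℕ}

/-- The space-time cylinder `[σ,τ] × K`. -/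
def cylinder (σ τ : ℝ) (K : Set (EuclideanSpace ℝ (Fin d))) : Set (SpaceTime d) :=
  {z | tproj d z ∈ Icc σ τ ∧ pproj d z ∈ K}

/-- `S ∈ N_{1+k}([σ,τ] × K)`. -/
def IsNormalIn (S : Current (k + 1) (SpaceTime d)) (σ τ : ℝ)
    (K : Set (EuclideanSpace ℝ (Fin d))) : Prop :=
  IsNormal S ∧ support S ⊆ cylinder σ τ K

/-- The action of the spatial projection on `k`-vectors. -/
def spatialPart (ξ : MultiVector k (SpaceTime d)) : MultiVector k (EuclideanSpace ℝ (Fin d)) :=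
  ξ.comp (ContinuousAlternatingMap.compContinuousLinearMapCLM (pproj d))

/-- The covector `dt ∧ α`, that is,
`(v₀, …, vₖ) ↦ ∑ᵢ (-1)ⁱ dt(vᵢ) α(v₀, …, v̂ᵢ, …, vₖ)`. -/
def dtWedge (α : Covector k (SpaceTime d)) : Covector (k + 1) (SpaceTime d) :=
  ContinuousAlternatingMap.alternatizeUncurryFin ((tproj d).smulRight α)

/-- `R` is the slice `S|ₜ`: for every test form `ω`,
`R(ω) = lim_{r ↓ 0} (2r)⁻¹ ∫_{[t-r,t+r] × ℝ^d} ⟨S⃗, dt ∧ ω⟩ d‖S‖`. -/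
def IsSlice (S : Current (k + 1) (SpaceTime d)) (t : ℝ) (R : Current k (SpaceTime d)) : Prop :=
  ∀ ω : TestForm k (SpaceTime d),
    Tendsto (fun r : ℝ => (2 * r)⁻¹ *
      ∫ z in tproj d ⁻¹' Icc (t - r) (t + r), orientation S z (dtWedge (ω z)) ∂massMeasure S)
      (𝓝[>] 0) (𝓝 (R ω))

open Classical in
/-- The slice `S|ₜ`. For a normal current it exists at every `t`. -/
def slice (S : Current (k + 1) (SpaceTime d)) (t : ℝ) : Current k (SpaceTime d) :=
  if h : ∃ R, IsSlice S t R then h.choose else 0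

/-- `R` is the pushforward `𝐩_* T` of a current with compact support: `R(η)` is the value of `T` at
any test form agreeing with the pullback `𝐩^* η` near `supp T`, such as `θ · 𝐩^* η` with a cut-off
function `θ` equal to `1` near `supp T ∩ 𝐩⁻¹(supp η)`. -/
def IsSpatialPushforward (T : Current k (SpaceTime d))
    (R : Current k (EuclideanSpace ℝ (Fin d))) : Prop :=
  ∀ (η : TestForm k (EuclideanSpace ℝ (Fin d))) (ω : TestForm k (SpaceTime d)),
    (∀ᶠ z in 𝓝ˢ (support T),
      ω z = (η (pproj d z)).compContinuousLinearMap (pproj d)) → R η = T ω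

open Classical in
/-- The pushforward `𝐩_* T`. It exists and is unique if `T` has compact support. -/
def spatialPushforward (T : Current k (SpaceTime d)) : Current k (EuclideanSpace ℝ (Fin d)) :=
  if h : ∃ R, IsSpatialPushforward T R then h.choose else 0

/-- `S(t) = 𝐩_*(S|ₜ)`. -/
def sliceAt (S : Current (k + 1) (SpaceTime d)) (t : ℝ) : Current k (EuclideanSpace ℝ (Fin d)) :=
  spatialPushforward (slice S t)

/-- The variation `Var(T; I) = ∫_{I × ℝ^d} ‖𝐩 T⃗‖ d‖T‖`, used for `T = S` and for `T = ∂S`. -/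
def variation (T : Current k (SpaceTime d)) (I : Set ℝ) : ℝ≥0∞ :=
  ∫⁻ z in tproj d ⁻¹' I, ‖spatialPart (orientation T z)‖ₑ ∂massMeasure T

/-- `‖S‖_{L^∞(I)} = ess sup_{t ∈ I} 𝐌(S(t))`. -/
def linftyNorm (S : Current (k + 1) (SpaceTime d)) (I : Set ℝ) : ℝ≥0∞ :=
  essSup (fun t => mass (sliceAt S t)) (volume.restrict I)

/-- `‖∂S‖_{L^∞(I)} = ess sup_{t ∈ I} 𝐌(∂S(t))`. If `S` is a `1`-current, then `∂S` is a
`0`-current, and its slices are zero, being currents of degree `-1`. -/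
def linftyNormBoundary : {k : ℕ} → Current (k + 1) (SpaceTime d) → Set ℝ → ℝ≥0∞
  | 0, _, _ => 0
  | _ + 1, S, I => linftyNorm (boundary S) I

/-- `S ∈ N^{Lip}_{1+k}([σ,τ] × K)`. -/
structure IsLipNormalIn (S : Current (k + 1) (SpaceTime d)) (σ τ : ℝ)
    (K : Set (EuclideanSpace ℝ (Fin d))) : Prop where
  normal : IsNormalIn S σ τ K
  bounded : linftyNorm S (Icc σ τ) + linftyNormBoundary S (Icc σ τ) < ∞
  endpoints : massMeasure S (tproj d ⁻¹' {σ, τ}) = 0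
  lipschitz_var : ∃ L : ℝ≥0,
    LipschitzOnWith L (fun t => (variation S (Ioo σ t)).toReal) (Ioo σ τ)
  lipschitz_var_boundary : ∃ L : ℝ≥0,
    LipschitzOnWith L (fun t => (variation (boundary S) (Ioo σ t)).toReal) (Ioo σ τ)

/-- `Lip(S)`, the Lipschitz constant of `t ↦ Var(S;(σ,t)) + Var(∂S;(σ,t))` on `(σ,τ)`. -/
def lipConst (S : Current (k + 1) (SpaceTime d)) (σ τ : ℝ) : ℝ≥0∞ :=
  ⨅ (L : ℝ≥0) (_ : LipschitzOnWith L
    (fun t => (variation S (Ioo σ t) + variation (boundary S) (Ioo σ t)).toReal) (Ioo σ τ)),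
    (L : ℝ≥0∞)

end NormalCurrents

end

open NormalCurrents

/-!
# Compactness for normal space-time currents

Stokes' formula with a weight depending on time gives
`∫_{t ∈ [a, b]} ⟨S⃗, dt ∧ ω⟩ d‖S‖ = ∂S(ρ ω) - (S ⌞ dω)(ρ)` with `ρ` the primitive of the indicator
function of `[a, b]` (`timeIntegral_indicator_dtWedge`). Dividing by the length of a shrinking
interval, `ρ` becomes the step function `halfStep t`, with the value `1/2` at `t`; hence every slice
exists and `S(t)` is an explicit expression in `S` and `∂S` (`slice_apply`, `sliceAt_apply`).

*Bounds on the mass.* Every covector splits as `α = 𝐩^* ι^* α + dt ∧ (e₀ ⌟ α)`, so that `‖S⃗‖` is at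
most `‖𝐩 S⃗‖ + ‖S⃗ ∘ (dt ∧ ·)‖`. Over a time interval, the first summand yields the variation; by
Fubini the second one is at most the length of the interval times the supremum of the masses of
the slices (`massMeasure_le_variation_add`). The same holds for `∂S`, whose boundary is zero. The
masses of `S_j` and `∂S_j` are therefore bounded and Banach–Alaoglu provides a weak* limit
(`exists_subseq_weakStarTendsto`).

*Convergence of slices.* In the formula for `S(t)` only the spatial parts of `S⃗` and of the
orientation of `∂S` enter. Replacing `halfStep t` by a smooth step which agrees with it at `t` and
outside `(t - r, t + r)` costs at most the variation over the punctured interval, and with the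
smooth step the expression is weak* continuous. Thus `S_j(t)` converges as soon as the variations do
not concentrate near `t` (`weakStarTendsto_sliceAt`). By Helly's selection theorem this is the case
off a countable set of times (`exists_subseq_no_concentration`), and under a uniform Lipschitz bound
it is the case at every time, including the endpoints (`exists_measure_punctured_le`).

*Lower semicontinuity.* For an open set `U` of times, `∫_U ‖T⃗ ∘ A‖ d‖T‖` is a supremum of values of
`T` on test forms (`IsDualField.setLIntegral_comp_le`), hence lower semicontinuous; the supports lie
in the cylinder, so the closed interval may be replaced by the whole line. Lipschitz bounds on the
variation pass to the limit since they are bounds on its measure of intervals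
(`measureLipschitz_of_frequently`).

The polar decomposition itself comes from the Riesz–Markov–Kakutani theorem applied to the total
variation of a functional on vector-valued functions (`exists_dual_representation`).
-/

open Set Filter Topology MeasureTheory
open scoped ENNReal NNReal Distributions

noncomputable section

namespace NormalCurrents

/-! ### Covectors in space-time -/

section Covectors

theorem finiteDimensional_covector (k : ℕ) (E : Type*) [NormedAddCommGroup E] [NormedSpace ℝ E]
    [FiniteDimensional ℝ E] : FiniteDimensional ℝ (Covector k E) := by
  let f : Covector k E →ₗ[ℝ] MultilinearMap ℝ (fun _ : Fin k => E) ℝ :=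
    { toFun := fun α => α.toMultilinearMap
      map_add' := fun _ _ => rfl
      map_smul' := fun _ _ => rfl }
  refine FiniteDimensional.of_injective f fun α β h => ?_
  ext v
  exact congrArg (fun g : MultilinearMap ℝ (fun _ : Fin k => E) ℝ => g v) h

instance instFiniteDimensionalCovector (k : ℕ) (E : Type*) [NormedAddCommGroup E] [NormedSpace ℝ E]
    [FiniteDimensional ℝ E] : FiniteDimensional ℝ (Covector k E) :=
  finiteDimensional_covector k E

instance instSecondCountableCovector (k : ℕ) (E : Type*) [NormedAddCommGroup E] [NormedSpace ℝ E]
    [FiniteDimensional ℝ E] : SecondCountableTopology (Covector k E) :=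
  have := FiniteDimensional.proper ℝ (Covector k E)
  secondCountable_of_proper

variable {d k : ℕ}

/-- The unit vector in the time direction. -/
def timeVec (d : ℕ) : SpaceTime d := WithLp.toLp 2 ((1 : ℝ), (0 : EuclideanSpace ℝ (Fin d)))

/-- The inclusion `x ↦ (0, x)` of space into space-time. -/
def spaceIncl (d : ℕ) : EuclideanSpace ℝ (Fin d) →L[ℝ] SpaceTime d :=
  ((WithLp.prodContinuousLinearEquiv 2 ℝ ℝ (EuclideanSpace ℝ (Fin d))).symm :
    ℝ × EuclideanSpace ℝ (Fin d) →L[ℝ] SpaceTime d).comp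
    (ContinuousLinearMap.inr ℝ ℝ (EuclideanSpace ℝ (Fin d)))

@[simp] theorem tproj_timeVec : tproj d (timeVec d) = 1 := rfl
@[simp] theorem pproj_timeVec : pproj d (timeVec d) = 0 := rfl
@[simp] theorem tproj_spaceIncl (x : EuclideanSpace ℝ (Fin d)) : tproj d (spaceIncl d x) = 0 := rfl
@[simp] theorem pproj_spaceIncl (x : EuclideanSpace ℝ (Fin d)) : pproj d (spaceIncl d x) = x := rfl

theorem norm_sq_eq_tproj_pproj (z : SpaceTime d) : ‖z‖ ^ 2 = ‖tproj d z‖ ^ 2 + ‖pproj d z‖ ^ 2 :=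
  WithLp.prod_norm_sq_eq_of_L2 z

theorem norm_tproj_le : ‖tproj d‖ ≤ 1 := by
  refine ContinuousLinearMap.opNorm_le_bound _ zero_le_one fun z => ?_
  have h := norm_sq_eq_tproj_pproj z
  rw [one_mul]
  exact abs_le_of_sq_le_sq' (by nlinarith [sq_nonneg ‖pproj d z‖]) (norm_nonneg _) |>.2

theorem norm_pproj_le : ‖pproj d‖ ≤ 1 := by
  refine ContinuousLinearMap.opNorm_le_bound _ zero_le_one fun z => ?_
  have h := norm_sq_eq_tproj_pproj z
  rw [one_mul]
  exact abs_le_of_sq_le_sq' (by nlinarith [sq_nonneg ‖tproj d z‖]) (norm_nonneg _) |>.2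

theorem norm_spaceIncl_le : ‖spaceIncl d‖ ≤ 1 := by
  refine ContinuousLinearMap.opNorm_le_bound _ zero_le_one fun x => ?_
  have h := norm_sq_eq_tproj_pproj (spaceIncl d x)
  rw [one_mul]
  simp at h
  exact h.le

theorem norm_timeVec : ‖timeVec d‖ = 1 := by
  have h := norm_sq_eq_tproj_pproj (timeVec d)
  rw [tproj_timeVec, pproj_timeVec, norm_one, norm_zero] at h
  nlinarith [norm_nonneg (timeVec d)]

/-- Pullback `𝐩^*` of covectors along the spatial projection. -/
def pStar (k d : ℕ) : Covector k (EuclideanSpace ℝ (Fin d)) →L[ℝ] Covector k (SpaceTime d) :=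
  ContinuousAlternatingMap.compContinuousLinearMapCLM (pproj d)

/-- Restriction of covectors to spatial vectors. -/
def iStar (k d : ℕ) : Covector k (SpaceTime d) →L[ℝ] Covector k (EuclideanSpace ℝ (Fin d)) :=
  ContinuousAlternatingMap.compContinuousLinearMapCLM (spaceIncl d)

/-- `α ↦ dt ∧ α` as a continuous linear map. -/
def dtWedgeCLM (k d : ℕ) : Covector k (SpaceTime d) →L[ℝ] Covector (k + 1) (SpaceTime d) :=
  (ContinuousAlternatingMap.alternatizeUncurryFinCLM ℝ (SpaceTime d) ℝ).comp
    (ContinuousLinearMap.smulRightL ℝ (SpaceTime d) (Covector k (SpaceTime d)) (tproj d))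

/-- Contraction `α ↦ e₀ ⌟ α` with the time direction. -/
def contractTime (k d : ℕ) : Covector (k + 1) (SpaceTime d) →ₗ[ℝ] Covector k (SpaceTime d) where
  toFun α := ContinuousAlternatingMap.curryLeft α (timeVec d)
  map_add' _ _ := rfl
  map_smul' _ _ := rfl

theorem pStar_apply (η : Covector k (EuclideanSpace ℝ (Fin d))) :
    pStar k d η = η.compContinuousLinearMap (pproj d) := rfl

theorem dtWedgeCLM_apply (α : Covector k (SpaceTime d)) : dtWedgeCLM k d α = dtWedge α := rfl

theorem spatialPart_apply (ξ : MultiVector k (SpaceTime d))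
    (η : Covector k (EuclideanSpace ℝ (Fin d))) : spatialPart ξ η = ξ (pStar k d η) := rfl

theorem dtWedge_apply (α : Covector k (SpaceTime d)) (v : Fin (k + 1) → SpaceTime d) :
    dtWedge α v = ∑ i : Fin (k + 1), (-1) ^ (i : ℕ) • (tproj d (v i) * α (i.removeNth v)) := by
  simp [dtWedge, ContinuousAlternatingMap.alternatizeUncurryFin_apply]

theorem norm_compContinuousLinearMap_le_of_norm_le_one {E F : Type*} [NormedAddCommGroup E]
    [NormedSpace ℝ E] [NormedAddCommGroup F] [NormedSpace ℝ F] (η : Covector k F) {g : E →L[ℝ] F}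
    (hg : ‖g‖ ≤ 1) : ‖η.compContinuousLinearMap g‖ ≤ ‖η‖ := by
  refine (η.norm_compContinuousLinearMap_le g).trans ?_
  exact mul_le_of_le_one_right (norm_nonneg _) (pow_le_one₀ (norm_nonneg _) hg)

theorem norm_pStar_le (η : Covector k (EuclideanSpace ℝ (Fin d))) : ‖pStar k d η‖ ≤ ‖η‖ :=
  norm_compContinuousLinearMap_le_of_norm_le_one η norm_pproj_le

theorem norm_iStar_le (α : Covector k (SpaceTime d)) : ‖iStar k d α‖ ≤ ‖α‖ :=
  norm_compContinuousLinearMap_le_of_norm_le_one α norm_spaceIncl_le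

theorem norm_dtWedgeCLM_le : ‖dtWedgeCLM k d‖ ≤ k + 1 := by
  refine ContinuousLinearMap.opNorm_le_bound _ (by positivity) fun α => ?_
  refine (ContinuousAlternatingMap.norm_alternatizeUncurryFin_le _).trans ?_
  gcongr
  change ‖(tproj d).smulRight α‖ ≤ ‖α‖
  rw [ContinuousLinearMap.norm_smulRight_apply]
  exact mul_le_of_le_one_left (norm_nonneg _) norm_tproj_le

theorem norm_contractTime_le (α : Covector (k + 1) (SpaceTime d)) : ‖contractTime k d α‖ ≤ ‖α‖ := by
  refine ContinuousAlternatingMap.opNorm_le_bound _ (norm_nonneg _) fun v => ?_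
  have := α.le_opNorm (Matrix.vecCons (timeVec d) v)
  rwa [Fin.prod_univ_succ, Matrix.cons_val_zero, norm_timeVec, one_mul] at this

theorem norm_spatialPart_le (ξ : MultiVector k (SpaceTime d)) : ‖spatialPart ξ‖ ≤ ‖ξ‖ := by
  refine ContinuousLinearMap.opNorm_le_bound _ (norm_nonneg ξ) fun η => ?_
  rw [spatialPart_apply]
  exact (ξ.le_opNorm _).trans (by gcongr; exact norm_pStar_le η)

/-- A basis of space-time consisting of the time direction and of spatial vectors. -/
def spaceTimeBasis (d : ℕ) : Module.Basis (Unit ⊕ Fin d) ℝ (SpaceTime d) :=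
  ((Module.Basis.singleton Unit ℝ).prod (EuclideanSpace.basisFun (Fin d) ℝ).toBasis).map
    (WithLp.linearEquiv 2 ℝ (ℝ × EuclideanSpace ℝ (Fin d))).symm

theorem spaceTimeBasis_inl : spaceTimeBasis d (Sum.inl ()) = timeVec d := by
  simp [spaceTimeBasis, timeVec]

theorem spaceTimeBasis_inr (i : Fin d) :
    spaceTimeBasis d (Sum.inr i) = spaceIncl d (EuclideanSpace.basisFun (Fin d) ℝ i) := by
  simp [spaceTimeBasis, spaceIncl]

/-- The splitting `α = 𝐩^* ι^* α + dt ∧ (e₀ ⌟ α)` into a spatial and a temporal part. -/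
theorem pStar_iStar_add_dtWedge (α : Covector (k + 1) (SpaceTime d)) :
    pStar (k + 1) d (iStar (k + 1) d α) + dtWedge (contractTime k d α) = α := by
  apply ContinuousAlternatingMap.toAlternatingMap_injective
  refine Module.Basis.ext_alternating (spaceTimeBasis d) fun u hu => ?_
  have h1 : ∀ v, (pStar (k + 1) d (iStar (k + 1) d α)) v =
    α fun i => spaceIncl d (pproj d (v i)) := fun v => rfl
  have h2 : ∀ v, contractTime k d α v = α (Matrix.vecCons (timeVec d) v) := fun v => rfl
  change (pStar (k + 1) d (iStar (k + 1) d α)) _ + dtWedge (contractTime k d α) _ = α _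
  rw [h1, dtWedge_apply]
  by_cases h : ∃ i, u i = Sum.inl ()
  · obtain ⟨i, hi⟩ := h
    have hz : (spaceTimeBasis d) (u i) = timeVec d := by rw [hi, spaceTimeBasis_inl]
    rw [α.map_coord_zero i (by simp [hz]), zero_add, Finset.sum_eq_single i]
    · rw [hz, tproj_timeVec, one_mul, h2, ← ContinuousAlternatingMap.map_insertNth, ← hz]
      congr 1
      exact Fin.insertNth_self_removeNth i fun i => (spaceTimeBasis d) (u i)
    · intro j _ hj
      obtain ⟨l, hl⟩ : ∃ l, u j = Sum.inr l := by
        rcases huj : u j with a | l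
        · exact absurd (hu (huj.trans hi.symm)) hj
        · exact ⟨l, rfl⟩
      simp [hl, spaceTimeBasis_inr]
    · simp
  · have hr : ∀ i, ∃ l, u i = Sum.inr l := fun i => by
      rcases hui : u i with a | l
      · exact absurd ⟨i, hui⟩ h
      · exact ⟨l, rfl⟩
    choose l hl using hr
    simp [hl, spaceTimeBasis_inr]

theorem dtWedge_dtWedge (α : Covector k (SpaceTime d)) : dtWedge (dtWedge α) = 0 := by
  have h : (tproj d).smulRight (dtWedge α) =
      (ContinuousAlternatingMap.alternatizeUncurryFinCLM ℝ (SpaceTime d) ℝ).comp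
        ((tproj d).smulRight ((tproj d).smulRight α)) := by
    ext1 v
    simp [dtWedge, ← ContinuousAlternatingMap.alternatizeUncurryFinCLM_apply]
  rw [dtWedge, h]
  refine ContinuousAlternatingMap.alternatizeUncurryFin_alternatizeUncurryFinCLM_comp_of_symmetric
    fun x y => ?_
  simp [smul_smul, mul_comm]

theorem pStar_iStar_zero (α : Covector 0 (SpaceTime d)) : pStar 0 d (iStar 0 d α) = α := by
  ext v
  change α _ = α v
  congr 1
  exact Subsingleton.elim _ _

/-- `dt ∧ α` depends on the restriction of `α` to spatial vectors only. -/
theorem dtWedge_pStar_iStar (α : Covector k (SpaceTime d)) :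
    dtWedge (pStar k d (iStar k d α)) = dtWedge α := by
  cases k with
  | zero => rw [pStar_iStar_zero]
  | succ k =>
    conv_rhs => rw [← pStar_iStar_add_dtWedge α, ← dtWedgeCLM_apply, map_add, dtWedgeCLM_apply,
      dtWedgeCLM_apply, dtWedge_dtWedge, add_zero]

/-- A multivector is controlled by its spatial part and its pairing with `dt ∧ ·`. -/
theorem norm_le_spatialPart_add (ξ : MultiVector (k + 1) (SpaceTime d)) :
    ‖ξ‖ ≤ ‖spatialPart ξ‖ + ‖ξ.comp (dtWedgeCLM k d)‖ := by
  refine ContinuousLinearMap.opNorm_le_bound _ (by positivity) fun α => ?_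
  conv_lhs => rw [← pStar_iStar_add_dtWedge α, map_add, ← spatialPart_apply, ← dtWedgeCLM_apply]
  rw [add_mul]
  refine (norm_add_le _ _).trans (add_le_add ?_ ?_)
  · exact ((spatialPart ξ).le_opNorm _).trans (by gcongr; exact norm_iStar_le α)
  · exact ((ξ.comp (dtWedgeCLM k d)).le_opNorm _).trans (by gcongr; exact norm_contractTime_le α)

theorem norm_le_spatialPart_zero (ξ : MultiVector 0 (SpaceTime d)) : ‖ξ‖ ≤ ‖spatialPart ξ‖ := by
  refine ContinuousLinearMap.opNorm_le_bound _ (by positivity) fun α => ?_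
  conv_lhs => rw [← pStar_iStar_zero α, ← spatialPart_apply]
  exact ((spatialPart ξ).le_opNorm _).trans (by gcongr; exact norm_iStar_le α)

end Covectors

/-! ### Approximation by test functions -/

section Approximation

variable {E V : Type*} [NormedAddCommGroup E] [NormedSpace ℝ E] [NormedAddCommGroup V]
  [NormedSpace ℝ V]

/-- Bundle a smooth compactly supported function as a test function on the whole space. -/
def mkTest (f : E → V) (hf : ContDiff ℝ (⊤ : ℕ∞) f) (hc : HasCompactSupport f) :
    𝓓((⊤ : TopologicalSpace.Opens E), V) :=
  ⟨f, hf, hc, fun _ _ => trivial⟩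

@[simp] theorem mkTest_apply (f : E → V) (hf : ContDiff ℝ (⊤ : ℕ∞) f) (hc : HasCompactSupport f)
    (x : E) : mkTest f hf hc x = f x := rfl

variable [FiniteDimensional ℝ E] [MeasurableSpace E] [BorelSpace E]

/-- The radial retraction `w ↦ w / max 1 ‖w‖` onto the unit ball. -/
def unitRetract (w : V) : V := (max 1 ‖w‖)⁻¹ • w

theorem continuous_unitRetract : Continuous (unitRetract : V → V) := by
  unfold unitRetract
  refine Continuous.smul (Continuous.inv₀ (by fun_prop) fun w => ?_) continuous_id
  positivity

theorem norm_unitRetract_le (w : V) : ‖unitRetract w‖ ≤ 1 := by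
  have : 0 < max 1 ‖w‖ := by positivity
  rw [unitRetract, norm_smul, norm_inv, Real.norm_of_nonneg this.le, inv_mul_le_iff₀ this, mul_one]
  exact le_max_right _ _

theorem unitRetract_of_norm_le {w : V} (hw : ‖w‖ ≤ 1) : unitRetract w = w := by
  simp [unitRetract, max_eq_left hw]

/-- A measurable field with values in the unit ball is an a.e. limit of test functions with values
in the unit ball. -/
theorem exists_testFunction_tendsto_ae (μ : Measure E) [IsFiniteMeasure μ] {v : E → V}
    (hv : StronglyMeasurable v) (hv1 : ∀ x, ‖v x‖ ≤ 1) :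
    ∃ α : ℕ → 𝓓((⊤ : TopologicalSpace.Opens E), V), (∀ n x, ‖α n x‖ ≤ 1) ∧
      ∀ᵐ x ∂μ, Tendsto (fun n => α n x) atTop (𝓝 (v x)) := by
  -- Continuous compactly supported `g n` approximate `v` in `L¹`. They are retracted onto the unit
  -- ball, smoothed with error `1 / (n + 1)` and shrunk by `1 + 1 / (n + 1)` to stay in that ball.
  have hmem : MemLp v 1 μ :=
    MemLp.of_bound hv.aestronglyMeasurable 1 (Eventually.of_forall hv1)
  choose g hgc hgs hg using fun n : ℕ =>
    hmem.exist_eLpNorm_sub_le ENNReal.one_ne_top le_rfl (Nat.one_div_pos_of_nat (α := ℝ) (n := n))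
  have hlim : Tendsto (fun n => eLpNorm (g n - v) 1 μ) atTop (𝓝 0) := by
    refine tendsto_of_tendsto_of_tendsto_of_le_of_le tendsto_const_nhds
      (h := fun n : ℕ => ENNReal.ofReal (1 / ((n : ℝ) + 1))) ?_ (fun _ => zero_le) fun n => ?_
    · simpa using ENNReal.tendsto_ofReal (tendsto_one_div_add_atTop_nhds_zero_nat (𝕜 := ℝ))
    · rw [eLpNorm_sub_comm]
      exact hg n
  obtain ⟨ns, hns, hae⟩ := (tendstoInMeasure_of_tendsto_eLpNorm one_ne_zero
    (fun n => (hgs n).continuous.aestronglyMeasurable) hv.aestronglyMeasurable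
    hlim).exists_seq_tendsto_ae
  have hc : ∀ n, Continuous fun x => unitRetract (g (ns n) x) := fun n =>
    continuous_unitRetract.comp (hgs _).continuous
  choose h hhs hh hhsupp using fun n : ℕ =>
    (hc n).exists_contDiff_approx ⊤ (ε := fun _ => 1 / ((n : ℝ) + 1)) continuous_const
      (fun _ => Nat.one_div_pos_of_nat)
  have hpos : ∀ n : ℕ, 0 < 1 + 1 / ((n : ℝ) + 1) := fun n => by positivity
  have hcs : ∀ n, HasCompactSupport (h n) := fun n => by
    refine ((hgc (ns n)).comp_left (g := unitRetract) (by simp [unitRetract])).mono' ?_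
    exact (hhsupp n).trans subset_closure
  refine ⟨fun n => mkTest (fun x => (1 + 1 / ((n : ℝ) + 1))⁻¹ • h n x)
    ((hhs n).const_smul _) ((hcs n).smul_left (f := fun _ => (1 + 1 / ((n : ℝ) + 1))⁻¹)),
    fun n x => ?_, ?_⟩
  · rw [mkTest_apply, norm_smul, norm_inv, Real.norm_of_nonneg (hpos n).le,
      inv_mul_le_iff₀ (hpos n), mul_one]
    calc ‖h n x‖ ≤ ‖unitRetract (g (ns n) x)‖ + dist (h n x) (unitRetract (g (ns n) x)) := by
          rw [dist_eq_norm]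
          exact norm_le_norm_add_norm_sub' _ _
      _ ≤ 1 + 1 / ((n : ℝ) + 1) := add_le_add (norm_unitRetract_le _) (hh n x).le
  · filter_upwards [hae] with x hx
    have h1 : Tendsto (fun n => unitRetract (g (ns n) x)) atTop (𝓝 (v x)) := by
      have := (continuous_unitRetract.tendsto (v x)).comp hx
      rwa [unitRetract_of_norm_le (hv1 x)] at this
    have h2 : Tendsto (fun n => h n x) atTop (𝓝 (v x)) := by
      refine (tendsto_iff_of_dist ?_).2 h1
      exact squeeze_zero (fun _ => dist_nonneg) (fun n => (hh n x).le)
        tendsto_one_div_add_atTop_nhds_zero_nat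
    have h3 : Tendsto (fun n : ℕ => (1 + 1 / ((n : ℝ) + 1))⁻¹) atTop (𝓝 1) := by
      have := (tendsto_const_nhds (x := (1 : ℝ))).add
        (tendsto_one_div_add_atTop_nhds_zero_nat (𝕜 := ℝ))
      simpa using this.inv₀ (by norm_num)
    simpa using h3.smul h2

/-- A measurable field of functionals is almost normed by a measurable field of unit vectors. -/
theorem exists_measurable_norming [SecondCountableTopology V] {X : Type*} [MeasurableSpace X]
    {ζ : X → StrongDual ℝ V} (hζ : StronglyMeasurable ζ) {ε : ℝ} (hε : 0 < ε) :
    ∃ v : X → V, StronglyMeasurable v ∧ (∀ x, ‖v x‖ ≤ 1) ∧ ∀ x, ‖ζ x‖ - ε ≤ ζ x (v x) := by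
  classical
  have : Nonempty (Metric.closedBall (0 : V) 1) := ⟨⟨0, by simp⟩⟩
  let w := TopologicalSpace.denseSeq (Metric.closedBall (0 : V) 1)
  have hex : ∀ x, ∃ n, ‖ζ x‖ - ε < ζ x (w n) := fun x => by
    obtain ⟨y, hy1, hy⟩ : ∃ y : V, ‖y‖ ≤ 1 ∧ ‖ζ x‖ - ε < ζ x y := by
      rcases le_or_gt 0 (‖ζ x‖ - ε) with h | h
      · obtain ⟨y, hy1, hy⟩ := (ζ x).exists_lt_apply_of_lt_opNorm (sub_lt_self ‖ζ x‖ hε)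
        rcases le_total 0 (ζ x y) with h0 | h0
        · exact ⟨y, hy1.le, by rwa [Real.norm_of_nonneg h0] at hy⟩
        · exact ⟨-y, by simpa using hy1.le, by rwa [Real.norm_of_nonpos h0, ← map_neg] at hy⟩
      · exact ⟨0, by simp, by simpa using h⟩
    have hopen : IsOpen {y : Metric.closedBall (0 : V) 1 | ‖ζ x‖ - ε < ζ x y} :=
      isOpen_lt continuous_const (by fun_prop)
    obtain ⟨_, hz, n, rfl⟩ := (TopologicalSpace.denseRange_denseSeq
      (Metric.closedBall (0 : V) 1)).inter_open_nonempty _ hopen ⟨⟨y, by simpa using hy1⟩, hy⟩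
    exact ⟨n, hz⟩
  have hmeas : Measurable fun x => Nat.find (hex x) := by
    refine measurable_find hex fun n => ?_
    exact measurableSet_lt (hζ.norm.measurable.sub_const _)
      ((ContinuousLinearMap.apply ℝ ℝ (w n : V)).continuous.comp_stronglyMeasurable hζ).measurable
  refine ⟨fun x => (w (Nat.find (hex x)) : V), ?_, fun x => ?_, fun x => (Nat.find_spec (hex x)).le⟩
  · exact (StronglyMeasurable.of_discrete (f := fun n : ℕ => (w n : V))).comp_measurable hmeas
  · exact mem_closedBall_zero_iff.1 (w (Nat.find (hex x))).2

theorem integrable_dual_apply {X : Type*} [MeasurableSpace X] {μ : Measure X}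
    {ζ : X → StrongDual ℝ V} (hζ : Integrable ζ μ) {v : X → V} (hv : AEStronglyMeasurable v μ)
    {C : ℝ} (hvC : ∀ x, ‖v x‖ ≤ C) : Integrable (fun x => ζ x (v x)) μ := by
  refine (hζ.norm.mul_const C).mono ?_ (Eventually.of_forall fun x => ?_)
  · exact (ContinuousLinearMap.apply ℝ ℝ (E := V)).flip.aestronglyMeasurable_comp₂ hζ.1 hv
  · rw [norm_mul, norm_norm, Real.norm_of_nonneg ((norm_nonneg _).trans (hvC x))]
    exact ((ζ x).le_opNorm _).trans (by gcongr; exact hvC x)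

theorem tendsto_integral_dual_apply {X : Type*} [MeasurableSpace X] {μ : Measure X}
    {ζ : X → StrongDual ℝ V} (hζ : Integrable ζ μ) {v : ℕ → X → V} {w : X → V}
    (hv : ∀ n, AEStronglyMeasurable (v n) μ) {C : ℝ} (hvC : ∀ n x, ‖v n x‖ ≤ C)
    (hlim : ∀ᵐ x ∂μ, Tendsto (fun n => v n x) atTop (𝓝 (w x))) :
    Tendsto (fun n => ∫ x, ζ x (v n x) ∂μ) atTop (𝓝 (∫ x, ζ x (w x) ∂μ)) := by
  refine tendsto_integral_of_dominated_convergence (fun x => ‖ζ x‖ * C)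
    (fun n => (integrable_dual_apply hζ (hv n) (hvC n)).1) (hζ.norm.mul_const C)
    (fun n => Eventually.of_forall fun x =>
      ((ζ x).le_opNorm _).trans (by gcongr; exact hvC n x)) ?_
  filter_upwards [hlim] with x hx using ((ζ x).continuous.tendsto _).comp hx

/-- The total variation `∫ ‖ζ‖ dμ` is bounded by any bound for the pairings with test functions. -/
theorem integral_norm_le_of_testFunction [SecondCountableTopology V] {μ : Measure E}
    [IsFiniteMeasure μ] {ζ : E → StrongDual ℝ V} (hm : StronglyMeasurable ζ) (hζ : Integrable ζ μ)
    {C : ℝ} (h : ∀ α : 𝓓((⊤ : TopologicalSpace.Opens E), V), (∀ x, ‖α x‖ ≤ 1) →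
      ∫ x, ζ x (α x) ∂μ ≤ C) : ∫ x, ‖ζ x‖ ∂μ ≤ C := by
  refine le_of_forall_pos_le_add fun ε hε => ?_
  set δ := ε / (μ.real univ + 1) with hδ
  have hpos : 0 < μ.real univ + 1 := by positivity
  obtain ⟨v, hv, hv1, hvζ⟩ := exists_measurable_norming hm (show 0 < δ by positivity)
  obtain ⟨α, hα1, hα⟩ := exists_testFunction_tendsto_ae μ hv hv1
  have h1 : ∫ x, ζ x (v x) ∂μ ≤ C :=
    le_of_tendsto' (tendsto_integral_dual_apply hζ
      (fun n => (α n).continuous.aestronglyMeasurable) hα1 hα) fun n => h (α n) (hα1 n)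
  have h2 : ∫ x, (‖ζ x‖ - δ) ∂μ ≤ ∫ x, ζ x (v x) ∂μ :=
    integral_mono (hζ.norm.sub (integrable_const _))
      (integrable_dual_apply hζ hv.aestronglyMeasurable hv1) hvζ
  rw [integral_sub hζ.norm (integrable_const _), integral_const, smul_eq_mul] at h2
  have h3 : μ.real univ * δ ≤ ε := by
    rw [hδ, mul_div_assoc', div_le_iff₀ hpos]
    nlinarith
  linarith

/-- The `ℝ≥0∞`-valued form of `integral_norm_le_of_testFunction`. -/
theorem lintegral_enorm_le_of_testFunction [SecondCountableTopology V] {μ : Measure E}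
    [IsFiniteMeasure μ] {ζ : E → StrongDual ℝ V} (hm : StronglyMeasurable ζ) (hζ : Integrable ζ μ)
    {C : ℝ≥0∞} (h : ∀ α : 𝓓((⊤ : TopologicalSpace.Opens E), V), (∀ x, ‖α x‖ ≤ 1) →
      ENNReal.ofReal (∫ x, ζ x (α x) ∂μ) ≤ C) : ∫⁻ x, ‖ζ x‖ₑ ∂μ ≤ C := by
  rcases eq_or_ne C ∞ with rfl | hC
  · exact le_top
  rw [← ofReal_integral_norm_eq_lintegral_enorm hζ, ← ENNReal.ofReal_toReal hC]
  refine ENNReal.ofReal_le_ofReal (integral_norm_le_of_testFunction hm hζ fun α hα => ?_)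
  exact (ENNReal.ofReal_le_iff_le_toReal hC).1 (h α hα)

/-- If the pairing of `ζ` with every test function `α` is at most `∫ ‖α‖ dμ`, then `‖ζ‖ ≤ 1`. -/
theorem ae_norm_le_one_of_testFunction [SecondCountableTopology V] {μ : Measure E}
    [IsFiniteMeasure μ] {ζ : E → StrongDual ℝ V} (hm : StronglyMeasurable ζ) (hζ : Integrable ζ μ)
    (h : ∀ α : 𝓓((⊤ : TopologicalSpace.Opens E), V), (∀ x, ‖α x‖ ≤ 1) →
      ∫ x, ζ x (α x) ∂μ ≤ ∫ x, ‖α x‖ ∂μ) : ∀ᵐ x ∂μ, ‖ζ x‖ ≤ 1 := by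
  -- Testing with an almost norming field cut off to `A` shows that `∫_A (‖ζ‖ - 1) ≤ 0`.
  have hA : MeasurableSet {x | 1 < ‖ζ x‖} := measurableSet_lt measurable_const hm.norm.measurable
  set A := {x | 1 < ‖ζ x‖} with hAdef
  have hint : IntegrableOn (fun x => ‖ζ x‖ - 1) A μ :=
    (hζ.norm.sub (integrable_const 1)).integrableOn
  have key : ∫ x in A, (‖ζ x‖ - 1) ∂μ ≤ 0 := by
    refine le_of_forall_pos_le_add fun ε hε => ?_
    set δ := ε / (μ.real univ + 1) with hδ
    have hpos : 0 < μ.real univ + 1 := by positivity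
    obtain ⟨v, hv, hv1, hvζ⟩ := exists_measurable_norming hm (show 0 < δ by positivity)
    have hw1 : ∀ x, ‖A.indicator v x‖ ≤ A.indicator 1 x := fun x => by
      by_cases hx : x ∈ A <;> simp [hx, hv1 x]
    have hw1' : ∀ x, ‖A.indicator v x‖ ≤ 1 := fun x =>
      (hw1 x).trans (indicator_le_self' (by simp) x)
    have hw := hv.indicator hA
    obtain ⟨α, hα1, hα⟩ := exists_testFunction_tendsto_ae μ hw hw1'
    have l1 := tendsto_integral_dual_apply hζ
      (fun n => (α n).continuous.aestronglyMeasurable) hα1 hα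
    have l2 : Tendsto (fun n => ∫ x, ‖α n x‖ ∂μ) atTop (𝓝 (∫ x, ‖A.indicator v x‖ ∂μ)) := by
      refine tendsto_integral_of_dominated_convergence (fun _ => 1)
        (fun n => (α n).continuous.norm.aestronglyMeasurable) (integrable_const 1)
        (fun n => Eventually.of_forall fun x => by simpa using hα1 n x) ?_
      filter_upwards [hα] with x hx using hx.norm
    have h1 := le_of_tendsto_of_tendsto' l1 l2 fun n => h (α n) (hα1 n)
    have h2 : ∫ x, ‖A.indicator v x‖ ∂μ ≤ ∫ x in A, 1 ∂μ := by
      rw [← integral_indicator hA]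
      exact integral_mono (Integrable.of_bound (C := 1) hw.norm.aestronglyMeasurable
        (Eventually.of_forall fun x => by simpa using hw1' x))
        ((integrable_const 1).indicator hA) hw1
    have h3 : ∫ x in A, (‖ζ x‖ - δ) ∂μ ≤ ∫ x, ζ x (A.indicator v x) ∂μ := by
      rw [← integral_indicator hA]
      refine integral_mono ((hζ.norm.sub (integrable_const δ)).indicator hA)
        (integrable_dual_apply hζ hw.aestronglyMeasurable hw1') fun x => ?_
      by_cases hx : x ∈ A <;> simp [hx]
      linarith [hvζ x]
    have h4 : ∫ x in A, (‖ζ x‖ - 1) ∂μ = ∫ x in A, (‖ζ x‖ - δ) ∂μ - ∫ x in A, 1 ∂μ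
        + μ.real A * δ := by
      rw [integral_sub hζ.norm.integrableOn (integrable_const _),
        integral_sub hζ.norm.integrableOn (integrable_const _), setIntegral_const,
        setIntegral_const, smul_eq_mul, smul_eq_mul]
      ring
    have h5 : μ.real A * δ ≤ ε := by
      rw [hδ, mul_div_assoc', div_le_iff₀ hpos]
      have : μ.real A ≤ μ.real univ := measureReal_mono (subset_univ _)
      nlinarith
    linarith
  have hnn : 0 ≤ᵐ[μ.restrict A] fun x => ‖ζ x‖ - 1 := by
    filter_upwards [ae_restrict_mem hA] with x hx
    exact sub_nonneg.2 (le_of_lt hx)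
  have hzero := (integral_eq_zero_iff_of_nonneg_ae hnn hint).1
    (le_antisymm key (integral_nonneg_of_ae hnn))
  have : ∀ᵐ x ∂μ, x ∈ A → ‖ζ x‖ - 1 = 0 := (ae_restrict_iff' hA).1 hzero
  filter_upwards [this] with x hx
  by_contra hlt
  have hxA : x ∈ A := not_le.1 hlt
  linarith [hx hxA, show 1 < ‖ζ x‖ from hxA]

end Approximation

/-! ### Existence of polar decompositions -/

section HahnBanach

variable {W X : Type*} [AddCommGroup W] [Module ℝ W] [NormedAddCommGroup X] [NormedSpace ℝ X]

/-- A functional which is bounded with respect to the norm of the image of `L` factors through a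
bounded functional on the whole target of `L`. -/
theorem exists_dual_factor (L : W →ₗ[ℝ] X) (T : W →ₗ[ℝ] ℝ) {m : ℝ} (hm : 0 ≤ m)
    (h : ∀ w, |T w| ≤ m * ‖L w‖) : ∃ F : StrongDual ℝ X, ‖F‖ ≤ m ∧ ∀ w, F (L w) = T w := by
  have hker : LinearMap.ker L ≤ LinearMap.ker T := fun w hw => by
    have := h w
    rw [LinearMap.mem_ker.1 hw, norm_zero, mul_zero] at this
    exact LinearMap.mem_ker.2 (abs_nonpos_iff.1 this)
  let e := L.quotKerEquivRange
  let f : LinearMap.range L →ₗ[ℝ] ℝ := ((LinearMap.ker L).liftQ T hker).comp e.symm.toLinearMap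
  have hf : ∀ w, f ⟨L w, w, rfl⟩ = T w := fun w => by
    have : e.symm ⟨L w, w, rfl⟩ = (LinearMap.ker L).mkQ w := by
      rw [LinearEquiv.symm_apply_eq]
      rfl
    simp [f, this]
  let f' : StrongDual ℝ (LinearMap.range L) := f.mkContinuous m (by
    rintro ⟨_, w, rfl⟩
    rw [hf]
    exact h w)
  obtain ⟨F, hF, hFn⟩ := exists_extension_norm_eq (LinearMap.range L) f'
  refine ⟨F, hFn.trans_le (LinearMap.mkContinuous_norm_le _ hm _), fun w => ?_⟩
  exact (hF ⟨L w, w, rfl⟩).trans (hf w)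

end HahnBanach

section Riesz

open CompactlySupported

variable {E V : Type*} [NormedAddCommGroup E] [NormedAddCommGroup V]

theorem exists_bound_of_compactlySupported (f : C_c(E, ℝ≥0)) : ∃ C : ℝ, ∀ x, (f x : ℝ) ≤ C := by
  have hc : HasCompactSupport fun x => (f x : ℝ) :=
    f.hasCompactSupport'.comp_left (g := ((↑) : ℝ≥0 → ℝ)) rfl
  obtain ⟨C, hC⟩ := hc.exists_bound_of_continuous
    (NNReal.continuous_coe.comp f.toContinuousMap.continuous)
  exact ⟨C, fun x => (le_abs_self _).trans (hC x)⟩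

theorem norm_le_of_forall_le {f : C_c(E, ℝ≥0)} {C : ℝ} (hC : ∀ x, (f x : ℝ) ≤ C)
    {v : BoundedContinuousFunction E V} (hv : ∀ x, ‖v x‖ ≤ f x) : ‖v‖ ≤ C :=
  (BoundedContinuousFunction.norm_le ((f 0).coe_nonneg.trans (hC 0))).2
    fun x => (hv x).trans (hC x)

section RieszMeasure

variable [NormedSpace ℝ E] [FiniteDimensional ℝ E] [MeasurableSpace E] [BorelSpace E]

/-- A form of the Riesz–Markov–Kakutani theorem for bounded positive functionals. -/
theorem exists_finite_rieszMeasure (Λ : C_c(E, ℝ≥0) → ℝ) (h0 : ∀ f, 0 ≤ Λ f)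
    (hadd : ∀ f g, Λ (f + g) = Λ f + Λ g) (hsmul : ∀ (c : ℝ≥0) f, Λ (c • f) = c * Λ f) {C : ℝ}
    (hC : ∀ f : C_c(E, ℝ≥0), (∀ x, f x ≤ 1) → Λ f ≤ C) :
    ∃ μ : Measure E, IsFiniteMeasure μ ∧ μ univ ≤ ENNReal.ofReal C ∧
      ∀ f : C_c(E, ℝ≥0), ∫ x, (f x : ℝ) ∂μ = Λ f := by
  let L : C_c(E, ℝ≥0) →ₗ[ℝ≥0] ℝ≥0 :=
    { toFun := fun f => ⟨Λ f, h0 f⟩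
      map_add' := fun f g => NNReal.eq (hadd f g)
      map_smul' := fun c f => NNReal.eq (hsmul c f) }
  have hL : ∀ f : C_c(E, ℝ≥0), ∫ x, (f x : ℝ) ∂NNRealRMK.rieszMeasure L = Λ f :=
    fun f => NNRealRMK.integral_rieszMeasure L f
  have huniv : NNRealRMK.rieszMeasure L univ ≤ ENNReal.ofReal C := by
    rw [isOpen_univ.measure_eq_iSup_isCompact]
    refine iSup_le fun K => iSup_le fun _ => iSup_le fun hK => ?_
    obtain ⟨g, hg1, hgc, -, hg⟩ :=
      exists_continuousMap_one_of_isCompact_subset_isOpen hK isOpen_univ (subset_univ K)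
    let f : C_c(E, ℝ≥0) :=
      ⟨⟨fun x => (g x).toNNReal, by fun_prop⟩,
        HasCompactSupport.comp_left (f := g) (g := Real.toNNReal) hgc (by simp)⟩
    have hf : ∀ x, f x = (g x).toNNReal := fun x => rfl
    have hfL : ENNReal.ofReal (Λ f) = ∫⁻ x, f x ∂NNRealRMK.rieszMeasure L := by
      rw [NNRealRMK.lintegral_rieszMeasure]
      exact ENNReal.ofReal_eq_coe_nnreal (h0 f)
    calc NNRealRMK.rieszMeasure L K = ∫⁻ x in K, 1 ∂NNRealRMK.rieszMeasure L := by simp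
      _ ≤ ∫⁻ x in K, f x ∂NNRealRMK.rieszMeasure L := by
        refine setLIntegral_mono' hK.measurableSet fun x hx => ?_
        rw [hf, hg1 hx]
        simp
      _ ≤ ∫⁻ x, f x ∂NNRealRMK.rieszMeasure L := setLIntegral_le_lintegral _ _
      _ ≤ ENNReal.ofReal C := by
        rw [← hfL]
        refine ENNReal.ofReal_le_ofReal (hC f fun x => ?_)
        rw [hf]
        exact Real.toNNReal_le_one.2 (hg x).2
  exact ⟨NNRealRMK.rieszMeasure L, ⟨huniv.trans_lt ENNReal.ofReal_lt_top⟩, huniv, hL⟩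

end RieszMeasure

/-- Bundle a continuous compactly supported function as a bounded continuous function. -/
def mkBCF (f : E → V) (hf : Continuous f) (hc : HasCompactSupport f) :
    BoundedContinuousFunction E V :=
  BoundedContinuousFunction.ofNormedAddCommGroup f hf (hc.exists_bound_of_continuous hf).choose
    (hc.exists_bound_of_continuous hf).choose_spec

/-- The function `f • b` for a scalar function `f` and a vector `b`. -/
def smulBCF [NormedSpace ℝ V] (f : C_c(E, ℝ≥0)) (b : V) : BoundedContinuousFunction E V :=
  mkBCF (fun x => (f x : ℝ) • b)
    ((NNReal.continuous_coe.comp f.toContinuousMap.continuous).smul continuous_const)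
    ((f.hasCompactSupport'.comp_left (g := ((↑) : ℝ≥0 → ℝ)) rfl).smul_right)

variable [NormedSpace ℝ V] (F : StrongDual ℝ (BoundedContinuousFunction E V))

/-- The total variation of the functional `F` evaluated on a nonnegative function `f`, that is, the
supremum of `F v` over `‖v‖ ≤ f`. -/
def dualVariation (f : C_c(E, ℝ≥0)) : ℝ :=
  ⨆ v : {v : BoundedContinuousFunction E V // ∀ x, ‖v x‖ ≤ f x}, F v

theorem bddAbove_dualVariation (f : C_c(E, ℝ≥0)) :
    BddAbove (range fun v : {v : BoundedContinuousFunction E V // ∀ x, ‖v x‖ ≤ f x} => F v) := by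
  obtain ⟨C, hC⟩ := exists_bound_of_compactlySupported f
  refine ⟨‖F‖ * C, ?_⟩
  rintro _ ⟨v, rfl⟩
  exact (le_abs_self _).trans ((F.le_opNorm _).trans
    (by gcongr; exact norm_le_of_forall_le hC v.2))

theorem le_dualVariation {f : C_c(E, ℝ≥0)} {v : BoundedContinuousFunction E V}
    (hv : ∀ x, ‖v x‖ ≤ f x) : F v ≤ dualVariation F f :=
  le_ciSup (bddAbove_dualVariation F f) (⟨v, hv⟩ : {v : BoundedContinuousFunction E V //
    ∀ x, ‖v x‖ ≤ f x})

theorem dualVariation_le {f : C_c(E, ℝ≥0)} {C : ℝ}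
    (h : ∀ v : BoundedContinuousFunction E V, (∀ x, ‖v x‖ ≤ f x) → F v ≤ C) :
    dualVariation F f ≤ C := by
  have : Nonempty {v : BoundedContinuousFunction E V // ∀ x, ‖v x‖ ≤ f x} := ⟨⟨0, by simp⟩⟩
  exact ciSup_le fun v => h v v.2

theorem dualVariation_nonneg (f : C_c(E, ℝ≥0)) : 0 ≤ dualVariation F f := by
  simpa using le_dualVariation F (f := f) (v := 0) (by simp)

theorem dualVariation_add (f g : C_c(E, ℝ≥0)) :
    dualVariation F (f + g) = dualVariation F f + dualVariation F g := by
  refine le_antisymm (dualVariation_le F fun v hv => ?_) ?_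
  · refine le_of_forall_pos_le_add fun ε hε => ?_
    -- `v` is split proportionally to `f` and `g`; the summand `δ` keeps the denominator positive.
    set δ := ε / (‖F‖ + 1)
    have hFpos : 0 < ‖F‖ + 1 := by positivity
    have hδ : 0 < δ := by positivity
    have hfc : Continuous fun x => (f x : ℝ) :=
      NNReal.continuous_coe.comp f.toContinuousMap.continuous
    have hgc : Continuous fun x => (g x : ℝ) :=
      NNReal.continuous_coe.comp g.toContinuousMap.continuous
    have hpos : ∀ x, 0 < (f x : ℝ) + g x + δ := fun x => by positivity
    have hv' : ∀ x, ‖v x‖ ≤ (f x : ℝ) + g x := fun x => by simpa using hv x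
    have hbound : ∀ (a : ℝ) x, 0 ≤ a → ‖(a / ((f x : ℝ) + g x + δ)) • v x‖ ≤ a := fun a x ha => by
      rw [norm_smul, Real.norm_of_nonneg (by have := hpos x; positivity), div_mul_eq_mul_div,
        div_le_iff₀ (hpos x)]
      exact mul_le_mul_of_nonneg_left ((hv' x).trans (by linarith)) ha
    obtain ⟨Cf, hCf⟩ := exists_bound_of_compactlySupported f
    obtain ⟨Cg, hCg⟩ := exists_bound_of_compactlySupported g
    let v₁ : BoundedContinuousFunction E V := BoundedContinuousFunction.ofNormedAddCommGroup
      (fun x => ((f x : ℝ) / ((f x : ℝ) + g x + δ)) • v x)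
      ((hfc.div (by fun_prop) fun x => (hpos x).ne').smul v.continuous) Cf
      (fun x => (hbound _ x (f x).coe_nonneg).trans (hCf x))
    let v₂ : BoundedContinuousFunction E V := BoundedContinuousFunction.ofNormedAddCommGroup
      (fun x => ((g x : ℝ) / ((f x : ℝ) + g x + δ)) • v x)
      ((hgc.div (by fun_prop) fun x => (hpos x).ne').smul v.continuous) Cg
      (fun x => (hbound _ x (g x).coe_nonneg).trans (hCg x))
    have h1 := le_dualVariation F (f := f) (v := v₁) fun x => hbound _ x (f x).coe_nonneg
    have h2 := le_dualVariation F (f := g) (v := v₂) fun x => hbound _ x (g x).coe_nonneg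
    have h3 : ‖v - v₁ - v₂‖ ≤ δ := by
      refine (BoundedContinuousFunction.norm_le hδ.le).2 fun x => ?_
      have : (v - v₁ - v₂) x = (δ / ((f x : ℝ) + g x + δ)) • v x := by
        change v x - ((f x : ℝ) / ((f x : ℝ) + g x + δ)) • v x
          - ((g x : ℝ) / ((f x : ℝ) + g x + δ)) • v x = _
        nth_rw 1 [← one_smul ℝ (v x)]
        rw [← sub_smul, ← sub_smul]
        congr 1
        have := (hpos x).ne'
        field_simp
        ring
      rw [this]
      exact hbound δ x hδ.le
    have h4 : F v = F v₁ + F v₂ + F (v - v₁ - v₂) := by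
      rw [map_sub, map_sub]
      ring
    have h5 : F (v - v₁ - v₂) ≤ ε := by
      refine (le_abs_self _).trans ((F.le_opNorm _).trans ?_)
      calc ‖F‖ * ‖v - v₁ - v₂‖ ≤ (‖F‖ + 1) * δ := by gcongr; linarith
        _ = ε := by simp only [δ]; field_simp
    linarith
  · refine le_of_forall_pos_le_add fun ε hε => ?_
    have n1 : Nonempty {v : BoundedContinuousFunction E V // ∀ x, ‖v x‖ ≤ f x} := ⟨⟨0, by simp⟩⟩
    have n2 : Nonempty {v : BoundedContinuousFunction E V // ∀ x, ‖v x‖ ≤ g x} := ⟨⟨0, by simp⟩⟩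
    obtain ⟨v, hv⟩ := exists_lt_of_lt_ciSup (sub_lt_self (dualVariation F f) (half_pos hε))
    obtain ⟨w, hw⟩ := exists_lt_of_lt_ciSup (sub_lt_self (dualVariation F g) (half_pos hε))
    have := le_dualVariation F (f := f + g) (v := v.1 + w.1) fun x => by
      simpa using (norm_add_le _ _).trans (add_le_add (v.2 x) (w.2 x))
    rw [map_add] at this
    linarith

theorem mul_dualVariation_le (c : ℝ≥0) (f : C_c(E, ℝ≥0)) :
    c * dualVariation F f ≤ dualVariation F (c • f) := by
  unfold dualVariation
  rw [Real.mul_iSup_of_nonneg c.coe_nonneg]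
  have : Nonempty {v : BoundedContinuousFunction E V // ∀ x, ‖v x‖ ≤ f x} := ⟨⟨0, by simp⟩⟩
  refine ciSup_le fun v => ?_
  have := le_dualVariation F (f := c • f) (v := (c : ℝ) • v.1) fun x => by
    simpa [norm_smul] using mul_le_mul_of_nonneg_left (v.2 x) c.coe_nonneg
  rwa [map_smul, smul_eq_mul] at this

theorem dualVariation_smul (c : ℝ≥0) (f : C_c(E, ℝ≥0)) :
    dualVariation F (c • f) = c * dualVariation F f := by
  refine le_antisymm ?_ (mul_dualVariation_le F c f)
  rcases eq_or_ne c 0 with rfl | hc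
  · refine dualVariation_le F fun v hv => ?_
    have : v = 0 := by
      ext x
      simpa using hv x
    simp [this]
  · have h := mul_dualVariation_le F c⁻¹ (c • f)
    rw [smul_smul, inv_mul_cancel₀ hc, one_smul] at h
    rwa [NNReal.coe_inv, inv_mul_le_iff₀ (by positivity)] at h

theorem dualVariation_le_norm {f : C_c(E, ℝ≥0)} (hf : ∀ x, f x ≤ 1) : dualVariation F f ≤ ‖F‖ :=
  dualVariation_le F fun _ hv => (le_abs_self _).trans ((F.le_opNorm _).trans
    (mul_le_of_le_one_right (norm_nonneg _) (norm_le_of_forall_le (fun x => hf x) hv)))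

theorem abs_smulBCF_le (f : C_c(E, ℝ≥0)) (b : V) :
    |F (smulBCF f b)| ≤ ‖b‖ * dualVariation F f := by
  have h : ∀ c : V, ‖c‖ = ‖b‖ → F (smulBCF f c) ≤ ‖b‖ * dualVariation F f := fun c hc => by
    have := le_dualVariation F (f := ‖b‖₊ • f) (v := smulBCF f c) fun x => by
      change ‖(f x : ℝ) • c‖ ≤ ((‖b‖₊ * f x : ℝ≥0) : ℝ)
      rw [norm_smul, hc, Real.norm_of_nonneg (f x).coe_nonneg, mul_comm]
      simp
    rwa [dualVariation_smul] at this
  refine abs_le'.2 ⟨h b rfl, ?_⟩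
  have hneg : smulBCF f (-b) = -smulBCF f b := by
    ext x
    exact smul_neg _ _
  rw [← map_neg, ← hneg]
  exact h (-b) (norm_neg b)

variable [NormedSpace ℝ E] [FiniteDimensional ℝ E] [MeasurableSpace E] [BorelSpace E]

/-- Each coefficient of a functional on vector fields has a density with respect to the total
variation measure. -/
theorem exists_density {μ : Measure E} [IsFiniteMeasure μ]
    (hμ : ∀ f : C_c(E, ℝ≥0), ∫ x, (f x : ℝ) ∂μ = dualVariation F f) (b : V) :
    ∃ g : E → ℝ, Measurable g ∧ Integrable g μ ∧
      ∀ f : C_c(E, ℝ≥0), F (smulBCF f b) = ∫ x, (f x : ℝ) * g x ∂μ := by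
  have hadd : ∀ f g : C_c(E, ℝ≥0), smulBCF (f + g) b = smulBCF f b + smulBCF g b := fun f g => by
    ext x
    exact add_smul (f x : ℝ) (g x : ℝ) b
  have hsmul : ∀ (c : ℝ≥0) (f : C_c(E, ℝ≥0)), smulBCF (c • f) b = (c : ℝ) • smulBCF f b :=
    fun c f => by
      ext x
      exact mul_smul (c : ℝ) (f x : ℝ) b
  have hint : ∀ (κ : Measure E) [IsFiniteMeasure κ] (f : C_c(E, ℝ≥0)),
      Integrable (fun x => (f x : ℝ)) κ := fun κ _ f => by
    refine Continuous.integrable_of_hasCompactSupport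
      (NNReal.continuous_coe.comp f.toContinuousMap.continuous)
      (f.hasCompactSupport'.comp_left (g := ((↑) : ℝ≥0 → ℝ)) rfl)
  -- The functionals `‖b‖ λ ± F (· b)` are positive, hence given by measures `ν₁`, `ν₂` whose sum is
  -- `2 ‖b‖ μ`.
  have main : ∀ s : ℝ, |s| = 1 → ∃ ν : Measure E, IsFiniteMeasure ν ∧
      ∀ f : C_c(E, ℝ≥0), ∫ x, (f x : ℝ) ∂ν = ‖b‖ * dualVariation F f + s * F (smulBCF f b) := by
    intro s hs
    have hle : ∀ f : C_c(E, ℝ≥0), |s * F (smulBCF f b)| ≤ ‖b‖ * dualVariation F f := fun f => by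
      rw [abs_mul, hs, one_mul]
      exact abs_smulBCF_le F f b
    obtain ⟨ν, hν, -, h⟩ := exists_finite_rieszMeasure
      (fun f => ‖b‖ * dualVariation F f + s * F (smulBCF f b))
      (fun f => by linarith [neg_le_of_abs_le (hle f)])
      (fun f g => by rw [dualVariation_add, hadd, map_add]; ring)
      (fun c f => by rw [dualVariation_smul, hsmul, map_smul, smul_eq_mul]; ring)
      (C := 2 * (‖b‖ * ‖F‖)) (fun f hf => by
        have := mul_le_mul_of_nonneg_left (dualVariation_le_norm F hf) (norm_nonneg b)
        linarith [le_of_abs_le (hle f)])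
    exact ⟨ν, hν, h⟩
  obtain ⟨ν₁, hν₁, h₁⟩ := main 1 (by simp)
  obtain ⟨ν₂, hν₂, h₂⟩ := main (-1) (by simp)
  have hsum : ν₁ + ν₂ = (2 * ‖b‖₊) • μ := by
    refine Measure.ext_of_integral_eq_on_compactlySupported_nnreal fun f => ?_
    rw [integral_add_measure (hint ν₁ f) (hint ν₂ f), h₁, h₂, integral_smul_nnreal_measure, hμ,
      NNReal.smul_def, smul_eq_mul]
    push_cast
    ring
  have hac : ν₁ ≪ μ := by
    refine Measure.AbsolutelyContinuous.mk fun s _ hs => ?_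
    have : (ν₁ + ν₂) s = 0 := by rw [hsum]; simp [hs]
    exact (add_eq_zero.1 (by simpa using this)).1
  have hgi : Integrable (fun x => (ν₁.rnDeriv μ x).toReal) μ := Measure.integrable_toReal_rnDeriv
  refine ⟨fun x => (ν₁.rnDeriv μ x).toReal - ‖b‖,
    ((Measure.measurable_rnDeriv _ _).ennreal_toReal).sub_const _,
    hgi.sub (integrable_const _), fun f => ?_⟩
  obtain ⟨C, hC⟩ := exists_bound_of_compactlySupported f
  have hfi : Integrable (fun x => (ν₁.rnDeriv μ x).toReal * (f x : ℝ)) μ :=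
    hgi.mul_bdd (c := C) (hint μ f).1 (Eventually.of_forall fun x => by
      simpa using hC x)
  have e1 : ∫ x, (ν₁.rnDeriv μ x).toReal * (f x : ℝ) ∂μ = ∫ x, (f x : ℝ) ∂ν₁ := by
    simpa using integral_rnDeriv_smul (f := fun x => (f x : ℝ)) hac
  calc F (smulBCF f b) = ∫ x, (f x : ℝ) ∂ν₁ - ‖b‖ * ∫ x, (f x : ℝ) ∂μ := by rw [h₁, hμ]; ring
    _ = ∫ x, ((ν₁.rnDeriv μ x).toReal * (f x : ℝ) - ‖b‖ * (f x : ℝ)) ∂μ := by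
      rw [integral_sub hfi ((hint μ f).const_mul _), e1, integral_const_mul]
    _ = _ := by
      congr 1
      ext x
      ring

/-- A bounded functional on vector fields is represented by its total variation measure and a
measurable field of functionals. -/
theorem exists_dual_representation [FiniteDimensional ℝ V] :
    ∃ (μ : Measure E) (ξ : E → StrongDual ℝ V), IsFiniteMeasure μ ∧ μ univ ≤ ENNReal.ofReal ‖F‖ ∧
      StronglyMeasurable ξ ∧ Integrable ξ μ ∧
      (∀ v : E → V, ∀ (hv : Continuous v) (hc : HasCompactSupport v),
        F (mkBCF v hv hc) = ∫ x, ξ x (v x) ∂μ ∧ F (mkBCF v hv hc) ≤ ∫ x, ‖v x‖ ∂μ) := by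
  obtain ⟨μ, hfin, huniv, hμ⟩ := exists_finite_rieszMeasure (dualVariation F)
    (dualVariation_nonneg F) (dualVariation_add F) (dualVariation_smul F)
    (fun f hf => dualVariation_le_norm F hf)
  obtain ⟨n, b, φ, hφ⟩ : ∃ (n : ℕ) (b : Fin n → V) (φ : Fin n → StrongDual ℝ V),
      ∀ w, ∑ i, φ i w • b i = w :=
    ⟨_, Module.finBasis ℝ V,
      fun i => LinearMap.toContinuousLinearMap ((Module.finBasis ℝ V).coord i),
      (Module.finBasis ℝ V).sum_repr⟩
  choose g hgm hgi hg using fun i => exists_density F hμ (b i)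
  refine ⟨μ, fun x => ∑ i, g i x • φ i, hfin, huniv, ?_, ?_, fun v hv hc => ⟨?_, ?_⟩⟩
  · exact Finset.stronglyMeasurable_fun_sum (f := fun i x => g i x • φ i) Finset.univ fun i _ =>
      (hgm i).stronglyMeasurable.smul_const (φ i)
  · exact integrable_finsetSum (f := fun i x => g i x • φ i) Finset.univ fun i _ =>
      (hgi i).smul_const (φ i)
  · have hcoord : ∀ i, Continuous fun x => φ i (v x) := fun i => (φ i).continuous.comp hv
    have hcoordc : ∀ i, HasCompactSupport fun x => φ i (v x) := fun i =>
      hc.comp_left (g := φ i) (map_zero _)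
    let p : Fin n → C_c(E, ℝ) := fun i => ⟨⟨_, hcoord i⟩, hcoordc i⟩
    have hp : ∀ i x, ((p i).nnrealPart x : ℝ) - ((-p i).nnrealPart x : ℝ) = φ i (v x) :=
      fun i x => by
        simp only [CompactlySupportedContinuousMap.nnrealPart_apply]
        exact max_zero_sub_max_neg_zero_eq_self (φ i (v x))
    have hsplit : mkBCF v hv hc =
        ∑ i, (smulBCF (p i).nnrealPart (b i) - smulBCF (-p i).nnrealPart (b i)) := by
      ext x
      rw [BoundedContinuousFunction.sum_apply]
      change v x = ∑ i, (((p i).nnrealPart x : ℝ) • b i - ((-p i).nnrealPart x : ℝ) • b i)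
      simp_rw [← sub_smul, hp]
      exact (hφ (v x)).symm
    have hmul : ∀ i (f : C_c(E, ℝ≥0)), Integrable (fun x => (f x : ℝ) * g i x) μ := fun i f => by
      obtain ⟨C, hC⟩ := exists_bound_of_compactlySupported f
      exact (hgi i).bdd_mul (c := C)
        (NNReal.continuous_coe.comp f.toContinuousMap.continuous).aestronglyMeasurable
        (Eventually.of_forall fun x => by simpa using hC x)
    rw [hsplit, map_sum]
    simp_rw [map_sub, hg, ← integral_sub (hmul _ _) (hmul _ _)]
    rw [← integral_finsetSum (f := fun i x => ((p i).nnrealPart x : ℝ) * g i x -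
      ((-p i).nnrealPart x : ℝ) * g i x) Finset.univ fun i _ => (hmul i _).sub (hmul i _)]
    congr 1
    ext x
    simp only [sum_apply, smul_apply, smul_eq_mul]
    refine Finset.sum_congr rfl fun i _ => ?_
    rw [← sub_mul, hp, mul_comm]
  · let f : C_c(E, ℝ≥0) := ⟨⟨fun x => ‖v x‖₊, by fun_prop⟩,
      hc.comp_left (g := fun w : V => ‖w‖₊) (by simp)⟩
    have := le_dualVariation F (f := f) (v := mkBCF v hv hc) fun x => le_rfl
    rwa [← hμ] at this

end Riesz

section Polar

variable {E : Type*} [NormedAddCommGroup E] [NormedSpace ℝ E] {k : ℕ}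

theorem ofReal_apply_le_mass (T : Current k E) {ω : TestForm k E} (hω : ∀ x, ‖ω x‖ ≤ 1) :
    ENNReal.ofReal (T ω) ≤ mass T :=
  le_iSup₂ (f := fun (ω : TestForm k E) (_ : ∀ x, ‖ω x‖ ≤ 1) => ENNReal.ofReal (T ω)) ω hω

theorem abs_apply_le_mass {T : Current k E} (hT : mass T < ∞) {ω : TestForm k E} {C : ℝ}
    (hC : 0 ≤ C) (hω : ∀ x, ‖ω x‖ ≤ C) : |T ω| ≤ (mass T).toReal * C := by
  have h1 : ∀ ω : TestForm k E, (∀ x, ‖ω x‖ ≤ 1) → T ω ≤ (mass T).toReal := fun ω hω =>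
    (ENNReal.ofReal_le_iff_le_toReal hT.ne).1 (ofReal_apply_le_mass T hω)
  have h2 : ∀ δ : ℝ, 0 < δ → ∀ ω : TestForm k E, (∀ x, ‖ω x‖ ≤ C) →
      T ω ≤ (mass T).toReal * (C + δ) := fun δ hδ ω hω => by
    have hpos : 0 < C + δ := by positivity
    have := h1 ((C + δ)⁻¹ • ω) fun x => by
      change ‖(C + δ)⁻¹ • ω x‖ ≤ 1
      rw [norm_smul, norm_inv, Real.norm_of_nonneg hpos.le,
        inv_mul_le_iff₀ hpos, mul_one]
      exact (hω x).trans (by linarith)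
    rw [map_smul, smul_eq_mul, inv_mul_le_iff₀ hpos] at this
    linarith
  have h3 : ∀ ω : TestForm k E, (∀ x, ‖ω x‖ ≤ C) → T ω ≤ (mass T).toReal * C := fun ω hω => by
    have hlim : Tendsto (fun δ : ℝ => (mass T).toReal * (C + δ)) (𝓝[>] 0)
        (𝓝 ((mass T).toReal * (C + 0))) :=
      ((continuous_const.mul (continuous_const.add continuous_id)).tendsto 0).mono_left
        nhdsWithin_le_nhds
    rw [add_zero] at hlim
    exact ge_of_tendsto hlim (eventually_nhdsWithin_of_forall fun δ hδ => h2 δ hδ ω hω)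
  refine abs_le'.2 ⟨h3 ω hω, ?_⟩
  rw [← map_neg]
  exact h3 (-ω) fun x => by simpa using hω x

variable [FiniteDimensional ℝ E] [MeasurableSpace E] [BorelSpace E]

/-- A current of finite mass has a polar decomposition. -/
theorem exists_isPolarDecomposition {T : Current k E} (hT : mass T < ∞) :
    ∃ p : Measure E × (E → MultiVector k E), IsPolarDecomposition T p.1 p.2 := by
  obtain ⟨F, hF, hFT⟩ := exists_dual_factor
    (TestFunction.toBoundedContinuousFunctionCLM ℝ :
      TestForm k E →L[ℝ] BoundedContinuousFunction E (Covector k E)).toLinearMap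
    (T : TestForm k E →ₗ[ℝ] ℝ) (m := (mass T).toReal) ENNReal.toReal_nonneg fun ω =>
      abs_apply_le_mass hT (norm_nonneg _) fun x =>
        BoundedContinuousFunction.norm_coe_le_norm
          (TestFunction.toBoundedContinuousFunctionCLM ℝ ω) x
  obtain ⟨μ, ξ, hμ, huniv, hξm, hξi, h⟩ := exists_dual_representation F
  have hrep : ∀ ω : TestForm k E, T ω = F (mkBCF ω ω.continuous ω.hasCompactSupport) := fun ω => by
    refine (hFT ω).symm.trans (congrArg F ?_)
    ext x
    rfl
  -- `‖ξ‖ ≤ 1` a.e. and `∫ ‖ξ‖ dμ ≥ 𝐌(T) ≥ μ(E)` force `‖ξ‖ = 1` a.e.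
  have hle : ∀ᵐ x ∂μ, ‖ξ x‖ ≤ 1 := by
    refine ae_norm_le_one_of_testFunction hξm hξi fun α _ => ?_
    have := h α α.continuous α.hasCompactSupport
    rw [← this.1]
    exact this.2
  have hmass : mass T ≤ ENNReal.ofReal (∫ x, ‖ξ x‖ ∂μ) := by
    refine iSup₂_le fun ω hω => ENNReal.ofReal_le_ofReal ?_
    rw [hrep, (h ω ω.continuous ω.hasCompactSupport).1]
    refine integral_mono (integrable_dual_apply hξi ω.continuous.aestronglyMeasurable hω) hξi.norm
      fun x => (le_abs_self _).trans (((ξ x).le_opNorm _).trans ?_)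
    exact mul_le_of_le_one_right (norm_nonneg _) (hω x)
  have hint : ∫ x, (1 - ‖ξ x‖) ∂μ ≤ 0 := by
    rw [integral_sub (integrable_const _) hξi.norm, integral_const, smul_eq_mul, mul_one]
    have h1 : μ.real univ ≤ (mass T).toReal :=
      (ENNReal.toReal_mono ENNReal.ofReal_ne_top huniv).trans
        ((ENNReal.toReal_ofReal (norm_nonneg F)).trans_le hF)
    have h2 : (mass T).toReal ≤ ∫ x, ‖ξ x‖ ∂μ :=
      (ENNReal.toReal_mono ENNReal.ofReal_ne_top hmass).trans_eq
        (ENNReal.toReal_ofReal (integral_nonneg fun _ => norm_nonneg _))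
    linarith
  have hnn : 0 ≤ᵐ[μ] fun x => 1 - ‖ξ x‖ := by
    filter_upwards [hle] with x hx using sub_nonneg.2 hx
  have hz := (integral_eq_zero_iff_of_nonneg_ae hnn ((integrable_const _).sub hξi.norm)).1
    (le_antisymm hint (integral_nonneg_of_ae hnn))
  refine ⟨(μ, ξ), hμ, hξm, ?_, fun ω => (hrep ω).trans
    (h ω ω.continuous ω.hasCompactSupport).1⟩
  filter_upwards [hz] with x hx
  have : 1 - ‖ξ x‖ = 0 := hx
  linarith

end Polar

/-! ### Currents of finite mass -/

section Cutoff

variable {E : Type*} [NormedAddCommGroup E] [NormedSpace ℝ E] [FiniteDimensional ℝ E]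

open scoped Manifold in
theorem exists_cutoff {K U : Set E} (hK : IsCompact K) (hU : IsOpen U) (hKU : K ⊆ U) :
    ∃ χ : E → ℝ, ContDiff ℝ (⊤ : ℕ∞) χ ∧ HasCompactSupport χ ∧ tsupport χ ⊆ U ∧
      (∀ x, χ x ∈ Icc (0 : ℝ) 1) ∧ ∀ᶠ x in 𝓝ˢ K, χ x = 1 := by
  obtain ⟨L, hL, hKL, hLU⟩ := exists_compact_between hK hU hKU
  obtain ⟨f, h1, h0, hf⟩ := exists_contMDiffMap_one_nhds_of_subset_interior 𝓘(ℝ, E)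
    (n := (⊤ : ℕ∞)) hK.isClosed hKL
  have hsupp : tsupport f ⊆ L := by
    refine closure_minimal (fun x hx => ?_) hL.isClosed
    by_contra hxL
    exact hx (h0 x hxL)
  exact ⟨f, f.contMDiff.contDiff, hL.of_isClosed_subset (isClosed_tsupport _) hsupp,
    hsupp.trans hLU, hf, h1⟩

/-- An open set is exhausted by the sets where suitable smooth functions are positive. -/
theorem exists_cutoff_seq {U : Set E} (hU : IsOpen U) :
    ∃ χ : ℕ → E → ℝ, (∀ m, ContDiff ℝ (⊤ : ℕ∞) (χ m)) ∧ (∀ m, tsupport (χ m) ⊆ U) ∧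
      (∀ m x, χ m x ∈ Icc (0 : ℝ) 1) ∧ ∀ x ∈ U, ∀ᶠ m in atTop, χ m x = 1 := by
  obtain ⟨f, hfU, hf, hf01⟩ := hU.exists_contDiff_support_eq (n := (⊤ : ℕ∞))
  refine ⟨fun m x => Real.smoothTransition (m * f x - 1), fun m => ?_, fun m => ?_, fun m x => ?_,
    fun x hx => ?_⟩
  · exact Real.smoothTransition.contDiff.comp ((contDiff_const.mul hf).sub contDiff_const)
  · have hcl : IsClosed {x | 1 ≤ m * f x} :=
      isClosed_le continuous_const (continuous_const.mul hf.continuous)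
    refine (closure_minimal (fun x hx => ?_) hcl).trans fun x hx => ?_
    · by_contra h
      exact hx (Real.smoothTransition.zero_of_nonpos (by
        linarith [not_le.1 (show ¬ 1 ≤ (m : ℝ) * f x from h)]))
    · rw [← hfU]
      intro h0
      have hx' : 1 ≤ (m : ℝ) * f x := hx
      rw [h0, mul_zero] at hx'
      linarith
  · exact ⟨Real.smoothTransition.nonneg _, Real.smoothTransition.le_one _⟩
  · have hpos : 0 < f x :=
      lt_of_le_of_ne (hf01 (mem_range_self x)).1 (Ne.symm (by rwa [← hfU] at hx))
    filter_upwards [(tendsto_natCast_atTop_atTop (R := ℝ)).eventually_ge_atTop (2 / f x)] with m hm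
    rw [div_le_iff₀ hpos] at hm
    exact Real.smoothTransition.one_of_one_le (by linarith)

end Cutoff

section Smul

variable {E V : Type*} [NormedAddCommGroup E] [NormedSpace ℝ E] [NormedAddCommGroup V]
  [NormedSpace ℝ V]

/-- The product of a smooth function and a test function. -/
def smulTest (χ : E → ℝ) (hχ : ContDiff ℝ (⊤ : ℕ∞) χ) (α : 𝓓((⊤ : TopologicalSpace.Opens E), V)) :
    𝓓((⊤ : TopologicalSpace.Opens E), V) :=
  mkTest (fun x => χ x • α x) (hχ.smul α.contDiff) α.hasCompactSupport.smul_left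

@[simp] theorem smulTest_apply (χ : E → ℝ) (hχ : ContDiff ℝ (⊤ : ℕ∞) χ)
    (α : 𝓓((⊤ : TopologicalSpace.Opens E), V)) (x : E) : smulTest χ hχ α x = χ x • α x := rfl

theorem tsupport_smulTest_subset (χ : E → ℝ) (hχ : ContDiff ℝ (⊤ : ℕ∞) χ)
    (α : 𝓓((⊤ : TopologicalSpace.Opens E), V)) :
    tsupport (smulTest χ hχ α) ⊆ tsupport χ ∩ tsupport α :=
  subset_inter (tsupport_smul_subset_left χ α) (tsupport_smul_subset_right χ α)

end Smul

section Vanishing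

variable {E : Type*} [NormedAddCommGroup E] [NormedSpace ℝ E] {k : ℕ}

theorem support_subset_of_vanishing {T : Current k E} {Z : Set E} (hZ : IsClosed Z)
    (h : ∀ ω : TestForm k E, tsupport ω ⊆ Zᶜ → T ω = 0) : support T ⊆ Z :=
  sInter_subset_of_mem (show Z ∈ _ from ⟨h, hZ⟩)

variable [FiniteDimensional ℝ E]

theorem isVanishingOn_union {T : Current k E} {U₁ U₂ : Set E} (hU₁ : IsOpen U₁) (hU₂ : IsOpen U₂)
    (h₁ : Distribution.IsVanishingOn (T : TestForm k E → ℝ) U₁)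
    (h₂ : Distribution.IsVanishingOn (T : TestForm k E → ℝ) U₂) :
    Distribution.IsVanishingOn (T : TestForm k E → ℝ) (U₁ ∪ U₂) := by
  intro ω hω
  have hK : IsCompact (tsupport ω \ U₂) := ω.hasCompactSupport.isCompact.diff hU₂
  obtain ⟨χ, hχ, -, hχU, -, hχ1⟩ := exists_cutoff hK hU₁ fun x hx =>
    (hω hx.1).resolve_right hx.2
  have hsub : ContDiff ℝ (⊤ : ℕ∞) fun x => 1 - χ x := contDiff_const.sub hχ
  have hsplit : ω = smulTest χ hχ ω + smulTest (fun x => 1 - χ x) hsub ω := by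
    ext1 x
    change ω x = χ x • ω x + (1 - χ x) • ω x
    rw [← add_smul, add_sub_cancel, one_smul]
  rw [hsplit, map_add, h₁ _ ((tsupport_smulTest_subset _ _ _).trans (inter_subset_left.trans hχU)),
    h₂ _ fun x hx => ?_, add_zero]
  by_contra hx2
  have hx' := tsupport_smulTest_subset _ _ _ hx
  have hev : ∀ᶠ y in 𝓝 x, χ y = 1 := hχ1.filter_mono (nhds_le_nhdsSet
    (show x ∈ tsupport ω \ U₂ from ⟨hx'.2, hx2⟩))
  refine (notMem_tsupport_iff_eventuallyEq.2 ?_) hx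
  filter_upwards [hev] with y hy
  simp [hy]

/-- A current vanishes on the complement of its support. -/
theorem apply_eq_zero_of_tsupport_subset (T : Current k E) {ω : TestForm k E}
    (hω : tsupport ω ⊆ (support T)ᶜ) : T ω = 0 := by
  obtain ⟨U, -, hωU, hU⟩ : ∃ U, IsOpen U ∧ tsupport ω ⊆ U ∧
      Distribution.IsVanishingOn (T : TestForm k E → ℝ) U := by
    refine ω.hasCompactSupport.isCompact.induction_on
      (p := fun s => ∃ U, IsOpen U ∧ s ⊆ U ∧ Distribution.IsVanishingOn (T : TestForm k E → ℝ) U)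
      ⟨∅, isOpen_empty, Subset.rfl, fun α hα => ?_⟩ ?_ ?_ ?_
    · have : α = 0 := by
        ext1 x
        exact image_eq_zero_of_notMem_tsupport fun hx => hα hx
      rw [this, map_zero]
    · rintro s t hst ⟨U, hU, htU, h⟩
      exact ⟨U, hU, hst.trans htU, h⟩
    · rintro s t ⟨U, hU, hsU, h⟩ ⟨U', hU', htU', h'⟩
      exact ⟨U ∪ U', hU.union hU', union_subset_union hsU htU', isVanishingOn_union hU hU' h h'⟩
    · intro x hx
      obtain ⟨U, h, hU, hxU⟩ := (Distribution.notMem_dsupport_iff x).1 (hω hx)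
      exact ⟨U, mem_nhdsWithin_of_mem_nhds (hU.mem_nhds hxU), U, hU, Subset.rfl, h⟩
  exact hU ω hωU

theorem apply_eq_zero_of_eventually (T : Current k E) {ω : TestForm k E}
    (hω : ∀ᶠ x in 𝓝ˢ (support T), ω x = 0) : T ω = 0 :=
  apply_eq_zero_of_tsupport_subset T fun _ hx hxT =>
    (notMem_tsupport_iff_eventuallyEq.2 (hω.filter_mono (nhds_le_nhdsSet hxT))) hx

end Vanishing

section DualField

variable {E V : Type*} [NormedAddCommGroup E] [NormedSpace ℝ E] [NormedAddCommGroup V]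
  [NormedSpace ℝ V] [MeasurableSpace E]

/-- The functional `T` on `V`-valued test functions is integration against the field `ξ` of dual
unit vectors with respect to the finite measure `μ`. This is `IsPolarDecomposition` with an
arbitrary normed space in place of the space of covectors. -/
structure IsDualField (T : 𝓓((⊤ : TopologicalSpace.Opens E), V) → ℝ) (μ : Measure E)
    (ξ : E → StrongDual ℝ V) : Prop where
  finite : IsFiniteMeasure μ
  measurable : StronglyMeasurable ξ
  unit : ∀ᵐ x ∂μ, ‖ξ x‖ = 1
  repr : ∀ ω, T ω = ∫ x, ξ x (ω x) ∂μ

namespace IsDualField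

variable {T : 𝓓((⊤ : TopologicalSpace.Opens E), V) → ℝ} {μ : Measure E}
  {ξ : E → StrongDual ℝ V}

theorem integrable (h : IsDualField T μ ξ) : Integrable ξ μ := by
  have := h.finite
  refine Integrable.of_bound h.measurable.aestronglyMeasurable 1 ?_
  filter_upwards [h.unit] with x hx using hx.le

theorem lintegral_enorm (h : IsDualField T μ ξ) (s : Set E) : ∫⁻ x in s, ‖ξ x‖ₑ ∂μ = μ s := by
  rw [← setLIntegral_one]
  refine lintegral_congr_ae (ae_restrict_of_ae ?_)
  filter_upwards [h.unit] with x hx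
  rw [← ofReal_norm, hx, ENNReal.ofReal_one]

variable {W : Type*} [NormedAddCommGroup W] [NormedSpace ℝ W]

theorem ofReal_apply_le_lintegral (h : IsDualField T μ ξ) (A : W →L[ℝ] V)
    {ω : 𝓓((⊤ : TopologicalSpace.Opens E), V)}
    {U : Set E} {w : E → W} (hw : ∀ x, ‖w x‖ ≤ 1) (hω : ∀ x, ω x = A (w x))
    (hωU : ∀ x ∉ U, ω x = 0) : ENNReal.ofReal (T ω) ≤ ∫⁻ x in U, ‖(ξ x).comp A‖ₑ ∂μ := by
  rw [h.repr ω, ← setIntegral_eq_integral_of_forall_compl_eq_zero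
    (s := U) fun x hx => by rw [hωU x hx, map_zero]]
  refine (ENNReal.ofReal_le_ofReal (le_abs_self _)).trans ?_
  rw [← Real.norm_eq_abs, ofReal_norm]
  refine (enorm_integral_le_lintegral_enorm _).trans (lintegral_mono fun x => ?_)
  rw [hω]
  refine enorm_le_iff_norm_le.2 ((((ξ x).comp A).le_opNorm (w x)).trans ?_)
  exact mul_le_of_le_one_right (norm_nonneg _) (hw x)

theorem integral_smul_comp_eq (h : IsDualField T μ ξ) (A : W →L[ℝ] V)
    {χ : E → ℝ} (hχ : ContDiff ℝ (⊤ : ℕ∞) χ)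
    (α : 𝓓((⊤ : TopologicalSpace.Opens E), W)) :
    ∫ x, (χ x • (ξ x).comp A) (α x) ∂μ = T (smulTest χ hχ (TestFunction.postcompCLM A α)) := by
  rw [h.repr]
  refine integral_congr_ae (Eventually.of_forall fun x => ?_)
  change χ x • ξ x (A (α x)) = ξ x (χ x • A (α x))
  rw [map_smul]

theorem stronglyMeasurable_comp (h : IsDualField T μ ξ) (A : W →L[ℝ] V) :
    StronglyMeasurable fun x => (ξ x).comp A := by
  have hc : Continuous fun ξ : StrongDual ℝ V => ξ.comp A :=
    (ContinuousLinearMap.precomp ℝ A).continuous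
  exact hc.comp_stronglyMeasurable h.measurable

theorem integrable_comp (h : IsDualField T μ ξ) (A : W →L[ℝ] V) :
    Integrable (fun x => (ξ x).comp A) μ :=
  (ContinuousLinearMap.precomp ℝ A).integrable_comp h.integrable

theorem integrable_smul_comp (h : IsDualField T μ ξ) (A : W →L[ℝ] V) {χ : E → ℝ} (hχ : Measurable χ)
    (hχ1 : ∀ x, χ x ∈ Icc (0 : ℝ) 1) : Integrable (fun x => χ x • (ξ x).comp A) μ := by
  refine (h.integrable_comp A).bdd_smul 1 hχ.aestronglyMeasurable
    (Eventually.of_forall fun x => ?_)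
  rw [Real.norm_of_nonneg (hχ1 x).1]
  exact (hχ1 x).2

theorem integrable_comp_apply (h : IsDualField T μ ξ) (A : W →L[ℝ] V)
    {w : E → W} (hw : AEStronglyMeasurable w μ) {C : ℝ}
    (hC : ∀ x, ‖w x‖ ≤ C) : Integrable (fun x => (ξ x).comp A (w x)) μ :=
  integrable_dual_apply (h.integrable_comp A) hw hC

variable [FiniteDimensional ℝ E] [BorelSpace E]

theorem measure_univ_le [SecondCountableTopology V] (h : IsDualField T μ ξ)
    {C : ℝ≥0∞}
    (hC : ∀ ω : 𝓓((⊤ : TopologicalSpace.Opens E), V), (∀ x, ‖ω x‖ ≤ 1) →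
      ENNReal.ofReal (T ω) ≤ C) : μ univ ≤ C := by
  have := h.finite
  rw [← h.lintegral_enorm, Measure.restrict_univ]
  refine lintegral_enorm_le_of_testFunction h.measurable h.integrable fun α hα => ?_
  rw [← h.repr α]
  exact hC α hα

/-- On an open set `U`, the integral of `‖ξ ∘ A‖` is bounded by any bound for the values of `T` on
test functions `χ • A α` with `‖α‖ ≤ 1` and with `χ` supported in `U`. -/
theorem setLIntegral_comp_le [SecondCountableTopology W] (h : IsDualField T μ ξ)
    (A : W →L[ℝ] V) {U : Set E}
    (hU : IsOpen U) {C : ℝ≥0∞}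
    (hC : ∀ (χ : E → ℝ) (hχ : ContDiff ℝ (⊤ : ℕ∞) χ), tsupport χ ⊆ U →
      (∀ x, χ x ∈ Icc (0 : ℝ) 1) →
      ∀ α : 𝓓((⊤ : TopologicalSpace.Opens E), W), (∀ x, ‖α x‖ ≤ 1) →
      ENNReal.ofReal (T (smulTest χ hχ (TestFunction.postcompCLM A α))) ≤ C) :
    ∫⁻ x in U, ‖(ξ x).comp A‖ₑ ∂μ ≤ C := by
  have := h.finite
  obtain ⟨χ, hχ, hχU, hχ1, hχlim⟩ := exists_cutoff_seq hU
  have hm : ∀ m, StronglyMeasurable fun x => χ m x • (ξ x).comp A := fun m =>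
    (hχ m).continuous.measurable.stronglyMeasurable.smul (h.stronglyMeasurable_comp A)
  have hle : ∀ m, ∫⁻ x, ‖χ m x • (ξ x).comp A‖ₑ ∂μ ≤ C := fun m => by
    refine lintegral_enorm_le_of_testFunction (hm m)
      (h.integrable_smul_comp A (hχ m).continuous.measurable (hχ1 m)) fun α hα => ?_
    rw [h.integral_smul_comp_eq A (hχ m)]
    exact hC (χ m) (hχ m) (hχU m) (hχ1 m) α hα
  calc ∫⁻ x in U, ‖(ξ x).comp A‖ₑ ∂μ
      ≤ ∫⁻ x in U, liminf (fun m => ‖χ m x • (ξ x).comp A‖ₑ) atTop ∂μ := by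
        refine setLIntegral_mono' hU.measurableSet fun x hx => ?_
        refine (Tendsto.liminf_eq ?_).ge
        refine tendsto_const_nhds.congr' ?_
        filter_upwards [hχlim x hx] with m hm
        rw [hm, one_smul]
    _ ≤ ∫⁻ x, liminf (fun m => ‖χ m x • (ξ x).comp A‖ₑ) atTop ∂μ :=
        setLIntegral_le_lintegral _ _
    _ ≤ liminf (fun m => ∫⁻ x, ‖χ m x • (ξ x).comp A‖ₑ ∂μ) atTop :=
        lintegral_liminf_le fun m => (hm m).enorm
    _ ≤ C := liminf_le_of_le (by isBoundedDefault) fun b hb => by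
        obtain ⟨m, hm⟩ := hb.exists
        exact hm.trans (hle m)

end IsDualField

end DualField

section FiniteMass

variable {E : Type*} [NormedAddCommGroup E] [NormedSpace ℝ E] [FiniteDimensional ℝ E]
  [MeasurableSpace E] [BorelSpace E] {k : ℕ} {T : Current k E}

theorem isPolarDecomposition (hT : mass T < ∞) :
    IsPolarDecomposition T (massMeasure T) (orientation T) := by
  have h := exists_isPolarDecomposition hT
  have hp : polarDecomposition T = h.choose := dif_pos h
  rw [massMeasure, orientation, hp]
  exact h.choose_spec

theorem isDualField (hT : mass T < ∞) :
    IsDualField (T : TestForm k E → ℝ) (massMeasure T) (orientation T) where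
  finite := (isPolarDecomposition hT).finite
  measurable := (isPolarDecomposition hT).measurable
  unit := (isPolarDecomposition hT).unit
  repr := (isPolarDecomposition hT).repr

theorem isFiniteMeasure_massMeasure (hT : mass T < ∞) : IsFiniteMeasure (massMeasure T) :=
  (isPolarDecomposition hT).finite

theorem mass_le_massMeasure_univ (hT : mass T < ∞) : mass T ≤ massMeasure T univ := by
  refine iSup₂_le fun ω hω => ?_
  have := (isDualField hT).ofReal_apply_le_lintegral (ContinuousLinearMap.id ℝ _) hω
    (fun x => rfl) (fun x hx => absurd (mem_univ x) hx)
  simpa only [ContinuousLinearMap.comp_id, (isDualField hT).lintegral_enorm] using this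

theorem massMeasure_univ_le_mass (hT : mass T < ∞) : massMeasure T univ ≤ mass T :=
  (isDualField hT).measure_univ_le fun _ hω => ofReal_apply_le_mass T hω

theorem massMeasure_compl_support (hT : mass T < ∞) : massMeasure T (support T)ᶜ = 0 := by
  have hopen : IsOpen (support T)ᶜ := Distribution.isClosed_dsupport.isOpen_compl
  rw [← (isDualField hT).lintegral_enorm, ← nonpos_iff_eq_zero]
  have := (isDualField hT).setLIntegral_comp_le (ContinuousLinearMap.id ℝ _) hopen (C := 0)
    fun χ hχ hχU _ α _ => by
      rw [apply_eq_zero_of_tsupport_subset T ((tsupport_smulTest_subset _ _ _).trans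
        (inter_subset_left.trans hχU)), ENNReal.ofReal_zero]
  simpa only [ContinuousLinearMap.comp_id] using this

theorem ae_mem_of_support_subset (hT : mass T < ∞) {Z : Set E} (hZ : support T ⊆ Z) :
    ∀ᵐ x ∂massMeasure T, x ∈ Z := by
  have : massMeasure T Zᶜ = 0 :=
    measure_mono_null (compl_subset_compl.2 hZ) (massMeasure_compl_support hT)
  exact this

/-- Lower semicontinuity of `∫_U ‖T⃗ ∘ A‖ d‖T‖` for open `U` under weak* convergence. -/
theorem setLIntegral_comp_le_liminf {S : ℕ → Current k E} (hT : mass T < ∞)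
    (hS : ∀ j, mass (S j) < ∞) (hconv : WeakStarTendsto S T) {W : Type*} [NormedAddCommGroup W]
    [NormedSpace ℝ W] [SecondCountableTopology W] (A : W →L[ℝ] Covector k E) {U : Set E}
    (hU : IsOpen U) :
    ∫⁻ x in U, ‖(orientation T x).comp A‖ₑ ∂massMeasure T ≤
      liminf (fun j => ∫⁻ x in U, ‖(orientation (S j) x).comp A‖ₑ ∂massMeasure (S j)) atTop := by
  refine (isDualField hT).setLIntegral_comp_le A hU fun χ hχ hχU hχ1 α hα => ?_
  have hlim := ENNReal.tendsto_ofReal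
    (hconv (smulTest χ hχ (TestFunction.postcompCLM A α)))
  rw [← hlim.liminf_eq]
  refine liminf_le_liminf (Eventually.of_forall fun j => ?_)
  refine (isDualField (hS j)).ofReal_apply_le_lintegral A (w := fun x => χ x • α x)
    (fun x => ?_) (fun x => ?_) fun x hx => ?_
  · rw [norm_smul, Real.norm_of_nonneg (hχ1 x).1]
    exact mul_le_one₀ (hχ1 x).2 (norm_nonneg _) (hα x)
  · rw [map_smul]
    rfl
  · have : χ x = 0 := image_eq_zero_of_notMem_tsupport fun h => hx (hχU h)
    rw [smulTest_apply, this, zero_smul]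

theorem massMeasure_le_liminf {S : ℕ → Current k E} (hT : mass T < ∞)
    (hS : ∀ j, mass (S j) < ∞) (hconv : WeakStarTendsto S T) {U : Set E} (hU : IsOpen U) :
    massMeasure T U ≤ liminf (fun j => massMeasure (S j) U) atTop := by
  have := setLIntegral_comp_le_liminf hT hS hconv (ContinuousLinearMap.id ℝ _) hU
  simpa only [ContinuousLinearMap.comp_id, (isDualField hT).lintegral_enorm,
    (isDualField (hS _)).lintegral_enorm] using this

end FiniteMass

theorem mass_le_liminf {E : Type*} [NormedAddCommGroup E] [NormedSpace ℝ E] {k : ℕ}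
    {S : ℕ → Current k E} {T : Current k E} (hconv : WeakStarTendsto S T) :
    mass T ≤ liminf (fun j => mass (S j)) atTop := by
  refine iSup₂_le fun ω hω => ?_
  rw [← (ENNReal.tendsto_ofReal (hconv ω)).liminf_eq]
  exact liminf_le_liminf (Eventually.of_forall fun j => ofReal_apply_le_mass (S j) hω)

theorem variation_le_liminf {d k : ℕ} {S : ℕ → Current k (SpaceTime d)}
    {T : Current k (SpaceTime d)} (hT : mass T < ∞) (hS : ∀ j, mass (S j) < ∞)
    (hconv : WeakStarTendsto S T) {I : Set ℝ} (hI : IsOpen I) :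
    variation T I ≤ liminf (fun j => variation (S j) I) atTop :=
  setLIntegral_comp_le_liminf hT hS hconv (pStar k d) (hI.preimage (tproj d).continuous)

/-! ### Integrals of forms with a weight depending on time -/

section TimeIntegral

variable {d k : ℕ}

/-- The integral `∫ h(𝐭(z)) ⟨T⃗(z), v(z)⟩ d‖T‖(z)` of a form `v` with a weight `h` depending on
time. -/
def timeIntegral (T : Current k (SpaceTime d)) (h : ℝ → ℝ)
    (v : SpaceTime d → Covector k (SpaceTime d)) : ℝ :=
  ∫ z, orientation T z (h (tproj d z) • v z) ∂massMeasure T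

variable {T : Current k (SpaceTime d)} {h : ℝ → ℝ} {v : SpaceTime d → Covector k (SpaceTime d)}

theorem stronglyMeasurable_weight_smul {V : Type*} [NormedAddCommGroup V] [NormedSpace ℝ V]
    (hh : Measurable h) {v : SpaceTime d → V} (hv : Continuous v) :
    StronglyMeasurable fun z : SpaceTime d => h (tproj d z) • v z :=
  (hh.comp (tproj d).continuous.measurable).stronglyMeasurable.smul hv.stronglyMeasurable

theorem integrable_orientation_apply (hT : mass T < ∞)
    (hv : StronglyMeasurable v) {C : ℝ} (hC : ∀ z, ‖v z‖ ≤ C) :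
    Integrable (fun z => orientation T z (v z)) (massMeasure T) :=
  (isDualField hT).integrable_comp_apply (ContinuousLinearMap.id ℝ _) hv.aestronglyMeasurable hC

theorem integrable_timeIntegrand (hT : mass T < ∞) (hh : Measurable h) (hv : Continuous v) {C : ℝ}
    (hC : ∀ z, ‖h (tproj d z) • v z‖ ≤ C) :
    Integrable (fun z => orientation T z (h (tproj d z) • v z)) (massMeasure T) :=
  integrable_orientation_apply hT (stronglyMeasurable_weight_smul hh hv) hC

theorem tendsto_timeIntegral (hT : mass T < ∞) {h : ℕ → ℝ → ℝ} {g : ℝ → ℝ}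
    (hh : ∀ n, Measurable (h n)) (hv : Continuous v) {C : ℝ}
    (hC : ∀ n z, ‖h n (tproj d z) • v z‖ ≤ C)
    (hlim : ∀ s, Tendsto (fun n => h n s) atTop (𝓝 (g s))) :
    Tendsto (fun n => timeIntegral T (h n) v) atTop (𝓝 (timeIntegral T g v)) :=
  tendsto_integral_dual_apply (isDualField hT).integrable
    (fun n => (stronglyMeasurable_weight_smul (hh n) hv).aestronglyMeasurable) hC
    (Eventually.of_forall fun z => (hlim (tproj d z)).smul_const (v z))

theorem timeIntegral_congr {w : SpaceTime d → Covector k (SpaceTime d)}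
    (hvw : ∀ᵐ z ∂massMeasure T, v z = w z) : timeIntegral T h v = timeIntegral T h w :=
  integral_congr_ae (hvw.mono fun z hz => by simp only [hz])

theorem timeIntegral_sub (hT : mass T < ∞) {g : ℝ → ℝ} (hh : Measurable h) (hg : Measurable g)
    (hv : Continuous v) {C : ℝ} (hhC : ∀ z, ‖h (tproj d z) • v z‖ ≤ C)
    (hgC : ∀ z, ‖g (tproj d z) • v z‖ ≤ C) :
    timeIntegral T h v - timeIntegral T g v = timeIntegral T (fun s => h s - g s) v := by
  rw [timeIntegral, timeIntegral, ← integral_sub (integrable_timeIntegrand hT hh hv hhC)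
    (integrable_timeIntegrand hT hg hv hgC)]
  refine integral_congr_ae (Eventually.of_forall fun z => ?_)
  change _ = orientation T z ((h (tproj d z) - g (tproj d z)) • v z)
  exact ((orientation T z).map_sub _ _).symm.trans
    (congrArg (orientation T z) (sub_smul _ _ _).symm)

theorem contDiff_weight (hh : ContDiff ℝ (⊤ : ℕ∞) h) :
    ContDiff ℝ (⊤ : ℕ∞) fun z : SpaceTime d => h (tproj d z) :=
  hh.comp (tproj d).contDiff

theorem timeIntegral_eq_apply (hT : mass T < ∞) (hh : ContDiff ℝ (⊤ : ℕ∞) h)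
    (ω : TestForm k (SpaceTime d)) :
    timeIntegral T h ω = T (smulTest (fun z => h (tproj d z)) (contDiff_weight hh) ω) :=
  ((isPolarDecomposition hT).repr
    (smulTest (fun z => h (tproj d z)) (contDiff_weight hh) ω)).symm

theorem bounded_testForm {E V : Type*} [NormedAddCommGroup E] [NormedSpace ℝ E]
    [NormedAddCommGroup V] [NormedSpace ℝ V] (ω : 𝓓((⊤ : TopologicalSpace.Opens E), V)) :
    ∃ C, 0 ≤ C ∧ ∀ x, ‖ω x‖ ≤ C := by
  obtain ⟨C, hC⟩ := ω.hasCompactSupport.exists_bound_of_continuous ω.contDiff.continuous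
  exact ⟨C, (norm_nonneg _).trans (hC 0), hC⟩

theorem bounded_smul_testForm {E V : Type*} [NormedAddCommGroup E] [NormedSpace ℝ E]
    [NormedAddCommGroup V] [NormedSpace ℝ V] {b : E → ℝ} (hb : Continuous b)
    (ω : 𝓓((⊤ : TopologicalSpace.Opens E), V)) : ∃ C, ∀ x, ‖b x • ω x‖ ≤ C :=
  have hc : HasCompactSupport fun x => b x • ω x := ω.hasCompactSupport.smul_left
  hc.exists_bound_of_continuous (hb.smul ω.contDiff.continuous)

/-- The product rule `d(h(t) ω) = h'(t) dt ∧ ω + h(t) dω`. -/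
theorem extDerivForm_smulTest (hh : ContDiff ℝ (⊤ : ℕ∞) h) (ω : TestForm k (SpaceTime d))
    (z : SpaceTime d) :
    extDerivForm k _ (smulTest (fun z => h (tproj d z)) (contDiff_weight hh) ω) z =
      deriv h (tproj d z) • dtWedge (ω z) + h (tproj d z) • extDerivForm k _ ω z := by
  rw [extDerivForm_apply, extDerivForm_apply]
  have hω : DifferentiableAt ℝ (ω : SpaceTime d → _) z :=
    (ω.contDiff.differentiable (by simp)).differentiableAt
  have hd : DifferentiableAt ℝ h (tproj d z) := (hh.differentiable (by simp)).differentiableAt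
  have hd' : HasFDerivAt (fun z : SpaceTime d => h (tproj d z))
      (deriv h (tproj d z) • tproj d) z :=
    hd.hasDerivAt.comp_hasFDerivAt z (tproj d).hasFDerivAt
  have h1 : fderiv ℝ (fun z => h (tproj d z) • ω z) z = h (tproj d z) • fderiv ℝ ω z +
      (deriv h (tproj d z) • tproj d).smulRight (ω z) :=
    (hd'.smul hω.hasFDerivAt).fderiv
  have h2 : (deriv h (tproj d z) • tproj d).smulRight (ω z) =
      deriv h (tproj d z) • (tproj d).smulRight (ω z) := by
    ext1 v
    simp [mul_smul]
  change ContinuousAlternatingMap.alternatizeUncurryFin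
    (fderiv ℝ (fun z => h (tproj d z) • ω z) z) = _
  rw [h1, h2, ← ContinuousAlternatingMap.alternatizeUncurryFinCLM_apply, map_add, map_smul,
    map_smul]
  exact add_comm _ _

end TimeIntegral

/-! ### The slicing formula -/

section Slicing

variable {d k : ℕ} {S : Current (k + 1) (SpaceTime d)}

/-- The difference `∂S(h(t) ω) - h(t) (S ⌞ dω)` for a weight `h` depending on time. -/
def sliceIntegral (S : Current (k + 1) (SpaceTime d)) (h : ℝ → ℝ)
    (ω : TestForm k (SpaceTime d)) : ℝ :=
  timeIntegral (boundary S) h ω - timeIntegral S h (extDerivForm k _ ω)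

theorem tendsto_sliceIntegral (hS : mass S < ∞) (hS' : mass (boundary S) < ∞) {h : ℕ → ℝ → ℝ}
    {g : ℝ → ℝ} (hh : ∀ n, Measurable (h n)) {b : ℝ → ℝ} (hb : Continuous b)
    (hhb : ∀ n s, |h n s| ≤ b s) (hlim : ∀ s, Tendsto (fun n => h n s) atTop (𝓝 (g s)))
    (ω : TestForm k (SpaceTime d)) :
    Tendsto (fun n => sliceIntegral S (h n) ω) atTop (𝓝 (sliceIntegral S g ω)) := by
  have key : ∀ {l : ℕ} (α : TestForm l (SpaceTime d)), ∃ C, ∀ n z,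
      ‖h n (tproj d z) • α z‖ ≤ C := fun α => by
    obtain ⟨C, hC⟩ := bounded_smul_testForm (hb.comp (tproj d).continuous) α
    refine ⟨C, fun n z => le_trans ?_ (hC z)⟩
    rw [norm_smul, norm_smul]
    exact mul_le_mul_of_nonneg_right ((hhb n _).trans (le_abs_self _)) (norm_nonneg _)
  obtain ⟨C, hC⟩ := key ω
  obtain ⟨C', hC'⟩ := key (extDerivForm k _ ω)
  have h1 := tendsto_timeIntegral hS' hh ω.contDiff.continuous hC hlim
  have h2 :=
    tendsto_timeIntegral hS hh (extDerivForm k (SpaceTime d) ω).contDiff.continuous hC' hlim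
  exact h1.sub h2

/-- Stokes' formula with a smooth weight depending on time. -/
theorem timeIntegral_deriv_dtWedge (hS : mass S < ∞) (hS' : mass (boundary S) < ∞) {h : ℝ → ℝ}
    (hh : ContDiff ℝ (⊤ : ℕ∞) h) (ω : TestForm k (SpaceTime d)) :
    timeIntegral S (deriv h) (fun z => dtWedge (ω z)) = sliceIntegral S h ω := by
  have hd : ContDiff ℝ (⊤ : ℕ∞) (deriv h) := (contDiff_infty_iff_deriv.1 hh).2
  have h1 := timeIntegral_eq_apply hS' hh ω
  have h2 := timeIntegral_eq_apply hS hh (extDerivForm k _ ω)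
  have h3 := timeIntegral_eq_apply hS hd (TestFunction.postcompCLM (dtWedgeCLM k d) ω)
  have hsum : extDerivForm k _ (smulTest (fun z => h (tproj d z)) (contDiff_weight hh) ω) =
      smulTest (fun z => deriv h (tproj d z)) (contDiff_weight hd)
        (TestFunction.postcompCLM (dtWedgeCLM k d) ω) +
      smulTest (fun z => h (tproj d z)) (contDiff_weight hh) (extDerivForm k _ ω) := by
    ext1 z
    exact extDerivForm_smulTest hh ω z
  rw [sliceIntegral, h1, h2]
  change _ = S (extDerivForm k _ _) - _
  rw [hsum, map_add, add_sub_cancel_right, ← h3]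
  rfl

/-- The primitive `s ↦ |[a,b] ∩ (-∞, s]|` of the indicator function of `[a, b]`. -/
def ramp (a b s : ℝ) : ℝ := max 0 (min s b - a)

theorem continuous_ramp (a b : ℝ) : Continuous (ramp a b) := by
  unfold ramp
  fun_prop

/-- Smooth functions decreasing to the indicator function of `[a, b]`. -/
def bumpSeq (a b : ℝ) (n : ℕ) (s : ℝ) : ℝ :=
  Real.smoothTransition (n * (s - a) + 1) * Real.smoothTransition (n * (b - s) + 1)

theorem contDiff_bumpSeq (a b : ℝ) (n : ℕ) : ContDiff ℝ (⊤ : ℕ∞) (bumpSeq a b n) := by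
  unfold bumpSeq
  exact (Real.smoothTransition.contDiff.comp (by fun_prop)).mul
    (Real.smoothTransition.contDiff.comp (by fun_prop))

theorem abs_bumpSeq_le (a b : ℝ) (n : ℕ) (s : ℝ) : |bumpSeq a b n s| ≤ 1 := by
  unfold bumpSeq
  rw [abs_of_nonneg (mul_nonneg (Real.smoothTransition.nonneg _) (Real.smoothTransition.nonneg _))]
  exact mul_le_one₀ (Real.smoothTransition.le_one _) (Real.smoothTransition.nonneg _)
    (Real.smoothTransition.le_one _)

theorem tendsto_smoothTransition_mul_add_one (u : ℝ) :
    Tendsto (fun n : ℕ => Real.smoothTransition (n * u + 1)) atTop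
      (𝓝 (if 0 ≤ u then 1 else 0)) := by
  refine tendsto_const_nhds.congr' ?_
  split_ifs with hu
  · exact Eventually.of_forall fun n =>
      (Real.smoothTransition.one_of_one_le (by nlinarith [Nat.cast_nonneg (α := ℝ) n])).symm
  · rw [not_le] at hu
    filter_upwards [(tendsto_natCast_atTop_atTop (R := ℝ)).eventually_ge_atTop (1 / (-u))]
      with n hn
    rw [div_le_iff₀ (by linarith)] at hn
    exact (Real.smoothTransition.zero_of_nonpos (by linarith)).symm

theorem tendsto_bumpSeq (a b s : ℝ) :
    Tendsto (fun n => bumpSeq a b n s) atTop (𝓝 ((Icc a b).indicator 1 s)) := by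
  convert (tendsto_smoothTransition_mul_add_one (s - a)).mul
    (tendsto_smoothTransition_mul_add_one (b - s)) using 1
  congr 1
  by_cases h1 : a ≤ s <;> by_cases h2 : s ≤ b <;> simp [h1, h2]

theorem integral_indicator_Icc_eq_ramp (a b s : ℝ) :
    ∫ u in a..s, (Icc a b).indicator (1 : ℝ → ℝ) u = ramp a b s := by
  rcases le_total a s with h | h
  · rw [intervalIntegral.integral_of_le h, integral_indicator_one measurableSet_Icc,
      measureReal_restrict_apply measurableSet_Icc]
    have : Icc a b ∩ Ioc a s = Ioc a (min s b) := by
      ext u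
      simp only [mem_inter_iff, mem_Icc, mem_Ioc, le_min_iff]
      constructor
      · rintro ⟨⟨_, h2⟩, h3, h4⟩
        exact ⟨h3, h4, h2⟩
      · rintro ⟨h1, h2, h3⟩
        exact ⟨⟨h1.le, h3⟩, h1, h2⟩
    rw [this, Real.volume_real_Ioc, ramp, max_comm]
  · rw [intervalIntegral.integral_of_ge h, integral_indicator_one measurableSet_Icc,
      measureReal_restrict_apply measurableSet_Icc]
    have : Icc a b ∩ Ioc s a ⊆ {a} := fun u hu => le_antisymm hu.2.2 hu.1.1
    have h0 : volume.real ({a} : Set ℝ) = 0 := by simp [measureReal_def]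
    rw [measureReal_mono_null this h0 (by simp), ramp, max_eq_left, neg_zero]
    linarith [min_le_left s b]

/-- The fundamental identity of slicing: the integral of `⟨S⃗, dt ∧ ω⟩` over a time interval in
terms of `∂S(ω)` and `S(dω)`. -/
theorem timeIntegral_indicator_dtWedge (hS : mass S < ∞) (hS' : mass (boundary S) < ∞) (a b : ℝ)
    (ω : TestForm k (SpaceTime d)) :
    timeIntegral S ((Icc a b).indicator 1) (fun z => dtWedge (ω z)) =
      sliceIntegral S (ramp a b) ω := by
  -- The primitives `Ψ n` of smooth approximations of the indicator converge to the ramp.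
  have hc : ∀ n, Continuous (bumpSeq a b n) := fun n => (contDiff_bumpSeq a b n).continuous
  let Ψ : ℕ → ℝ → ℝ := fun n s => ∫ u in a..s, bumpSeq a b n u
  have hder : ∀ n s, HasDerivAt (Ψ n) (bumpSeq a b n s) s := fun n s =>
    intervalIntegral.integral_hasDerivAt_right ((hc n).intervalIntegrable _ _)
      ((hc n).stronglyMeasurableAtFilter _ _) (hc n).continuousAt
  have hderiv : ∀ n, deriv (Ψ n) = bumpSeq a b n := fun n => funext fun s => (hder n s).deriv
  have hsm : ∀ n, ContDiff ℝ (⊤ : ℕ∞) (Ψ n) := fun n => by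
    rw [contDiff_infty_iff_deriv, hderiv]
    exact ⟨fun s => (hder n s).differentiableAt, contDiff_bumpSeq a b n⟩
  have hbd : ∀ n s, |Ψ n s| ≤ |s - a| := fun n s => by
    have := intervalIntegral.norm_integral_le_of_norm_le_const (a := a) (b := s)
      (f := bumpSeq a b n) (C := 1) fun u _ => abs_bumpSeq_le a b n u
    simpa using this
  have hlim : ∀ s, Tendsto (fun n => Ψ n s) atTop (𝓝 (ramp a b s)) := fun s => by
    rw [← integral_indicator_Icc_eq_ramp]
    refine intervalIntegral.tendsto_integral_filter_of_dominated_convergence (fun _ => 1)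
      (Eventually.of_forall fun n => (hc n).aestronglyMeasurable)
      (Eventually.of_forall fun n => Eventually.of_forall fun u _ => abs_bumpSeq_le a b n u)
      intervalIntegrable_const (Eventually.of_forall fun u _ => tendsto_bumpSeq a b u)
  obtain ⟨C, hC0, hC⟩ := bounded_testForm (TestFunction.postcompCLM (dtWedgeCLM k d) ω)
  have h1 : Tendsto (fun n => timeIntegral S (bumpSeq a b n) fun z => dtWedge (ω z)) atTop
      (𝓝 (timeIntegral S ((Icc a b).indicator 1) fun z => dtWedge (ω z))) := by
    refine tendsto_timeIntegral hS (fun n => (hc n).measurable)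
      ((dtWedgeCLM k d).continuous.comp ω.contDiff.continuous) (C := C) (fun n z => ?_)
      (tendsto_bumpSeq a b)
    rw [norm_smul]
    exact (mul_le_of_le_one_left (norm_nonneg _) (abs_bumpSeq_le a b n _)).trans (hC z)
  have h2 := tendsto_sliceIntegral hS hS' (fun n => (hsm n).continuous.measurable)
    (b := fun s => |s - a|) (by fun_prop) hbd hlim ω
  refine tendsto_nhds_unique h1 (h2.congr fun n => ?_)
  rw [← timeIntegral_deriv_dtWedge hS hS' (hsm n), hderiv]

end Slicing

/-! ### Slices -/

section Slices

variable {d k : ℕ}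

theorem timeIntegral_eq_mul (T : Current k (SpaceTime d)) (h : ℝ → ℝ)
    (v : SpaceTime d → Covector k (SpaceTime d)) :
    timeIntegral T h v = ∫ z, h (tproj d z) * orientation T z (v z) ∂massMeasure T :=
  integral_congr_ae (Eventually.of_forall fun z => (orientation T z).map_smul _ _)

theorem timeIntegral_const_mul (T : Current k (SpaceTime d)) (c : ℝ) (h : ℝ → ℝ)
    (v : SpaceTime d → Covector k (SpaceTime d)) :
    timeIntegral T (fun s => c * h s) v = c * timeIntegral T h v := by
  simp only [timeIntegral_eq_mul, mul_assoc, integral_const_mul]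

theorem setIntegral_eq_timeIntegral (T : Current k (SpaceTime d)) {I : Set ℝ}
    (hI : MeasurableSet I) (v : SpaceTime d → Covector k (SpaceTime d)) :
    ∫ z in tproj d ⁻¹' I, orientation T z (v z) ∂massMeasure T =
      timeIntegral T (I.indicator 1) v := by
  rw [timeIntegral_eq_mul, ← integral_indicator ((tproj d).continuous.measurable hI)]
  refine integral_congr_ae (Eventually.of_forall fun z => ?_)
  by_cases hz : tproj d z ∈ I <;> simp [indicator, hz]

theorem abs_timeIntegral_le {T : Current k (SpaceTime d)} (hT : mass T < ∞) {h : ℝ → ℝ}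
    (h1 : ∀ s, |h s| ≤ 1) {v : SpaceTime d → Covector k (SpaceTime d)} {C : ℝ}
    (hC : ∀ z, ‖v z‖ ≤ C) : |timeIntegral T h v| ≤ C * (massMeasure T).real univ := by
  have := isFiniteMeasure_massMeasure hT
  refine norm_integral_le_of_norm_le_const (μ := massMeasure T)
    (f := fun z => orientation T z (h (tproj d z) • v z)) ?_
  filter_upwards [(isPolarDecomposition hT).unit] with z hz
  have h2 := (orientation T z).le_opNorm (h (tproj d z) • v z)
  rw [hz, one_mul, norm_smul] at h2
  exact h2.trans ((mul_le_of_le_one_left (norm_nonneg _) (h1 _)).trans (hC z))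

theorem exists_clm_timeIntegral {T : Current k (SpaceTime d)} (hT : mass T < ∞) {h : ℝ → ℝ}
    (hh : Measurable h) (h1 : ∀ s, |h s| ≤ 1) {F W : Type*} [NormedAddCommGroup F]
    [NormedSpace ℝ F] [NormedAddCommGroup W] [NormedSpace ℝ W]
    (A : W →L[ℝ] Covector k (SpaceTime d)) {g : SpaceTime d → F} (hg : Continuous g) :
    ∃ Λ : 𝓓((⊤ : TopologicalSpace.Opens F), W) →L[ℝ] ℝ,
      ∀ η, Λ η = timeIntegral T h (fun z => A (η (g z))) := by
  have hbd : ∀ (f : BoundedContinuousFunction F W) z, ‖A (f (g z))‖ ≤ ‖A‖ * ‖f‖ := fun f z =>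
    (A.le_opNorm _).trans (by gcongr; exact f.norm_coe_le_norm _)
  have hint : ∀ f : BoundedContinuousFunction F W, Integrable
      (fun z => orientation T z (h (tproj d z) • A (f (g z)))) (massMeasure T) := fun f =>
    integrable_timeIntegrand hT hh (A.continuous.comp (f.continuous.comp hg))
      (C := ‖A‖ * ‖f‖) fun z => by
        rw [norm_smul]
        exact (mul_le_of_le_one_left (norm_nonneg _) (h1 _)).trans (hbd f z)
  let L : BoundedContinuousFunction F W →ₗ[ℝ] ℝ :=
    { toFun := fun f => timeIntegral T h (fun z => A (f (g z)))
      map_add' := fun f f' => by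
        rw [timeIntegral, timeIntegral, timeIntegral, ← integral_add (hint f) (hint f')]
        refine integral_congr_ae (Eventually.of_forall fun z => ?_)
        refine Eq.trans ?_ ((orientation T z).map_add _ _)
        refine congrArg (orientation T z) ?_
        refine Eq.trans ?_ (smul_add _ _ _)
        exact congrArg _ (A.map_add _ _)
      map_smul' := fun c f => by
        rw [RingHom.id_apply, smul_eq_mul, ← timeIntegral_const_mul]
        refine integral_congr_ae (Eventually.of_forall fun z => ?_)
        refine congrArg (orientation T z) ?_
        refine (congrArg (h (tproj d z) • ·) (A.map_smul c (f (g z)))).trans ?_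
        exact (smul_smul _ _ _).trans (by rw [mul_comm]) }
  let Λ : StrongDual ℝ (BoundedContinuousFunction F W) :=
    L.mkContinuous (‖A‖ * (massMeasure T).real univ) fun f => by
      refine (abs_timeIntegral_le hT h1 (hbd f)).trans (le_of_eq ?_)
      ring
  exact ⟨Λ.comp (TestFunction.toBoundedContinuousFunctionCLM ℝ), fun η => rfl⟩

/-- The step function which is `0` before `t`, `1` after `t` and `1/2` at `t`. -/
def halfStep (t s : ℝ) : ℝ := if s < t then 0 else if s = t then 1 / 2 else 1

theorem measurable_uncurry_halfStep : Measurable (Function.uncurry halfStep) :=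
  Measurable.ite (measurableSet_lt measurable_snd measurable_fst) measurable_const
    (Measurable.ite (measurableSet_eq_fun measurable_snd measurable_fst) measurable_const
      measurable_const)

theorem measurable_halfStep (t : ℝ) : Measurable (halfStep t) :=
  measurable_uncurry_halfStep.comp measurable_prodMk_left

theorem abs_halfStep_le (t s : ℝ) : |halfStep t s| ≤ 1 := by
  unfold halfStep
  split_ifs <;> norm_num [abs_of_pos]

theorem abs_inv_mul_ramp_le (t r s : ℝ) : |(2 * r)⁻¹ * ramp (t - r) (t + r) s| ≤ 1 := by
  have h0 : 0 ≤ ramp (t - r) (t + r) s := le_max_left _ _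
  have h1 : min s (t + r) - (t - r) ≤ 2 * r := by linarith [min_le_right s (t + r)]
  rcases le_or_gt r 0 with hr | hr
  -- For `r ≤ 0` the interval `[t - r, t + r]` is degenerate and the ramp vanishes.
  · have : ramp (t - r) (t + r) s = 0 := max_eq_left (by linarith)
    simp [this]
  · have h2 : ramp (t - r) (t + r) s ≤ 2 * r := max_le (by linarith) h1
    rw [abs_of_nonneg (by positivity), inv_mul_le_iff₀ (by linarith), mul_one]
    exact h2

theorem tendsto_inv_mul_ramp (t s : ℝ) :
    Tendsto (fun r => (2 * r)⁻¹ * ramp (t - r) (t + r) s) (𝓝[>] 0) (𝓝 (halfStep t s)) := by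
  refine tendsto_const_nhds.congr' ?_
  rcases lt_trichotomy s t with hs | hs | hs
  · filter_upwards [Ioo_mem_nhdsGT (sub_pos.2 hs)] with r hr
    have : ramp (t - r) (t + r) s = 0 :=
      max_eq_left (by linarith [hr.2, min_le_left s (t + r)])
    rw [this, halfStep, if_pos hs, mul_zero]
  · filter_upwards [self_mem_nhdsWithin] with r hr
    have hr' : 0 < r := hr
    have : ramp (t - r) (t + r) s = r := by
      rw [ramp, min_eq_left (by linarith), max_eq_right (by linarith)]
      linarith
    rw [this, halfStep, if_neg hs.not_lt, if_pos hs]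
    field_simp
  · filter_upwards [Ioo_mem_nhdsGT (sub_pos.2 hs)] with r hr
    have : ramp (t - r) (t + r) s = 2 * r := by
      rw [ramp, min_eq_right (by linarith [hr.2]), max_eq_right (by linarith [hr.1])]
      ring
    have hr' : 2 * r ≠ 0 := by linarith [hr.1]
    rw [this, halfStep, if_neg hs.not_gt, if_neg hs.ne', inv_mul_cancel₀ hr']

variable {S : Current (k + 1) (SpaceTime d)}

theorem sliceIntegral_const_mul (S : Current (k + 1) (SpaceTime d)) (c : ℝ) (h : ℝ → ℝ)
    (ω : TestForm k (SpaceTime d)) :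
    sliceIntegral S (fun s => c * h s) ω = c * sliceIntegral S h ω := by
  rw [sliceIntegral, timeIntegral_const_mul, timeIntegral_const_mul, sliceIntegral, mul_sub]

theorem tendsto_slice_average (hS : mass S < ∞) (hS' : mass (boundary S) < ∞) (t : ℝ)
    (ω : TestForm k (SpaceTime d)) :
    Tendsto (fun r : ℝ => (2 * r)⁻¹ *
      ∫ z in tproj d ⁻¹' Icc (t - r) (t + r), orientation S z (dtWedge (ω z)) ∂massMeasure S)
      (𝓝[>] 0) (𝓝 (sliceIntegral S (halfStep t) ω)) := by
  refine tendsto_of_seq_tendsto fun r hr => ?_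
  refine (tendsto_sliceIntegral hS hS'
    (h := fun n s => (2 * r n)⁻¹ * ramp (t - r n) (t + r n) s)
    (fun n => ((continuous_ramp _ _).measurable.const_mul _)) (b := fun _ => 1) continuous_const
    (fun n s => abs_inv_mul_ramp_le t (r n) s)
    (fun s => (tendsto_inv_mul_ramp t s).comp hr) ω).congr fun n => ?_
  rw [sliceIntegral_const_mul, ← timeIntegral_indicator_dtWedge hS hS',
    ← setIntegral_eq_timeIntegral S measurableSet_Icc, Function.comp_apply]

theorem isSlice_slice (hS : mass S < ∞) (hS' : mass (boundary S) < ∞) (t : ℝ) :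
    IsSlice S t (slice S t) := by
  obtain ⟨Λ₁, hΛ₁⟩ := exists_clm_timeIntegral hS' (measurable_halfStep t) (abs_halfStep_le t)
    (ContinuousLinearMap.id ℝ (Covector k (SpaceTime d))) continuous_id
  obtain ⟨Λ₂, hΛ₂⟩ := exists_clm_timeIntegral hS (measurable_halfStep t) (abs_halfStep_le t)
    (ContinuousLinearMap.id ℝ (Covector (k + 1) (SpaceTime d))) continuous_id
  have hex : ∃ R, IsSlice S t R := by
    refine ⟨Λ₁ - Λ₂.comp (extDerivForm k _), fun ω => ?_⟩
    have : (Λ₁ - Λ₂.comp (extDerivForm k _)) ω = sliceIntegral S (halfStep t) ω := by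
      change Λ₁ ω - Λ₂ (extDerivForm k _ ω) = _
      rw [hΛ₁, hΛ₂]
      rfl
    rw [this]
    exact tendsto_slice_average hS hS' t ω
  rw [slice, dif_pos hex]
  exact hex.choose_spec

theorem slice_apply (hS : mass S < ∞) (hS' : mass (boundary S) < ∞) (t : ℝ)
    (ω : TestForm k (SpaceTime d)) : slice S t ω = sliceIntegral S (halfStep t) ω :=
  tendsto_nhds_unique (isSlice_slice hS hS' t ω) (tendsto_slice_average hS hS' t ω)

theorem support_slice_subset (hS : mass S < ∞) (hS' : mass (boundary S) < ∞) (t : ℝ) :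
    support (slice S t) ⊆ support S := by
  refine support_subset_of_vanishing Distribution.isClosed_dsupport fun ω hω => ?_
  refine tendsto_nhds_unique (isSlice_slice hS hS' t ω) (tendsto_const_nhds.congr fun r => ?_)
  rw [integral_eq_zero_of_ae, mul_zero]
  refine ae_restrict_of_ae ?_
  filter_upwards [ae_mem_of_support_subset hS Subset.rfl] with z hz
  have : ω z = 0 := image_eq_zero_of_notMem_tsupport fun h => hω h hz
  rw [this, ← dtWedgeCLM_apply, map_zero, Pi.zero_apply]
  exact (orientation S z).map_zero

theorem support_boundary_subset {E : Type*} [NormedAddCommGroup E] [NormedSpace ℝ E]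
    [FiniteDimensional ℝ E] (T : Current (k + 1) E) : support (boundary T) ⊆ support T := by
  refine support_subset_of_vanishing Distribution.isClosed_dsupport fun ω hω => ?_
  refine apply_eq_zero_of_tsupport_subset T (Subset.trans (closure_minimal ?_ isClosed_closure) hω)
  intro x hx
  by_contra hx'
  refine hx ?_
  have : (ω : E → Covector k E) =ᶠ[𝓝 x] 0 := notMem_tsupport_iff_eventuallyEq.1 hx'
  change extDerivForm k E ω x = 0
  rw [extDerivForm_apply, this.extDeriv_eq]
  simpa using extDeriv_smul (x := x) (0 : ℝ) (0 : E → Covector k E)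

end Slices

/-! ### Spatial pushforward of slices -/

section Pushforward

variable {d k : ℕ} {S : Current (k + 1) (SpaceTime d)}

/-- The value of `sliceIntegral S h` at the pullback `𝐩^* η`, which need not be compactly
supported. -/
def spatialSliceIntegral (S : Current (k + 1) (SpaceTime d)) (h : ℝ → ℝ)
    (η : TestForm k (EuclideanSpace ℝ (Fin d))) : ℝ :=
  timeIntegral (boundary S) h (fun z => pStar k d (η (pproj d z))) -
    timeIntegral S h (fun z => pStar (k + 1) d (extDerivForm k _ η (pproj d z)))

theorem extDeriv_pStar (η : TestForm k (EuclideanSpace ℝ (Fin d))) (z : SpaceTime d) :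
    extDeriv (fun z : SpaceTime d => pStar k d (η (pproj d z))) z =
      pStar (k + 1) d (extDerivForm k _ η (pproj d z)) := by
  have hη : DifferentiableAt ℝ (η : EuclideanSpace ℝ (Fin d) → _) (pproj d z) :=
    (η.contDiff.differentiable (by simp)).differentiableAt
  have h := extDeriv_pullback (f := pproj d) (x := z) hη
    ((pproj d).contDiff (n := 2)).contDiffAt (by simp)
  rw [extDerivForm_apply]
  simp only [ContinuousLinearMap.fderiv] at h
  exact h

theorem sliceIntegral_eq_spatialSliceIntegral (hS : mass S < ∞) (hS' : mass (boundary S) < ∞)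
    (h : ℝ → ℝ) {η : TestForm k (EuclideanSpace ℝ (Fin d))} {ω : TestForm k (SpaceTime d)}
    (hω : ∀ᶠ z in 𝓝ˢ (support S), ω z = pStar k d (η (pproj d z))) :
    sliceIntegral S h ω = spatialSliceIntegral S h η := by
  rw [sliceIntegral, spatialSliceIntegral]
  congr 1
  · refine timeIntegral_congr ?_
    filter_upwards [ae_mem_of_support_subset hS' (support_boundary_subset S)] with z hz
    exact (hω.filter_mono (nhds_le_nhdsSet hz)).self_of_nhds
  · refine timeIntegral_congr ?_
    filter_upwards [ae_mem_of_support_subset hS Subset.rfl] with z hz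
    have hev : (ω : SpaceTime d → _) =ᶠ[𝓝 z] fun z => pStar k d (η (pproj d z)) :=
      hω.filter_mono (nhds_le_nhdsSet hz)
    rw [extDerivForm_apply, hev.extDeriv_eq, extDeriv_pStar]

/-- The test form `θ 𝐩^* η` for a cut-off function `θ`. -/
def pullbackTest (θ : SpaceTime d → ℝ) (hθ : ContDiff ℝ (⊤ : ℕ∞) θ) (hc : HasCompactSupport θ)
    (η : TestForm k (EuclideanSpace ℝ (Fin d))) : TestForm k (SpaceTime d) :=
  mkTest (fun z => θ z • pStar k d (η (pproj d z)))
    (hθ.smul ((pStar k d).contDiff.comp (η.contDiff.comp (pproj d).contDiff))) hc.smul_right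

theorem exists_pullbackTest {Z : Set (SpaceTime d)} (hZ : IsCompact Z)
    (η : TestForm k (EuclideanSpace ℝ (Fin d))) :
    ∃ ω : TestForm k (SpaceTime d), (∀ z, ‖ω z‖ ≤ ‖η (pproj d z)‖) ∧
      ∀ᶠ z in 𝓝ˢ Z, ω z = pStar k d (η (pproj d z)) := by
  obtain ⟨θ, hθ, hc, -, h01, h1⟩ := exists_cutoff hZ isOpen_univ (subset_univ _)
  refine ⟨pullbackTest θ hθ hc η, fun z => ?_, ?_⟩
  · change ‖θ z • pStar k d (η (pproj d z))‖ ≤ _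
    rw [norm_smul, Real.norm_of_nonneg (h01 z).1]
    exact (mul_le_of_le_one_left (norm_nonneg _) (h01 z).2).trans (norm_pStar_le _)
  · filter_upwards [h1] with z hz
    change θ z • pStar k d (η (pproj d z)) = _
    rw [hz, one_smul]

theorem IsNormal.mass_lt {E : Type*} [NormedAddCommGroup E] [NormedSpace ℝ E]
    {T : Current (k + 1) E} (h : IsNormal T) : mass T < ∞ :=
  lt_of_le_of_lt le_self_add h.1

theorem IsNormal.mass_boundary_lt {E : Type*} [NormedAddCommGroup E] [NormedSpace ℝ E]
    {T : Current (k + 1) E} (h : IsNormal T) : mass (boundary T) < ∞ :=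
  lt_of_le_of_lt le_add_self h.1

/-- The slices `S(t)` in terms of `S` and `∂S`. -/
theorem sliceAt_apply (hS : IsNormal S) (t : ℝ) (η : TestForm k (EuclideanSpace ℝ (Fin d))) :
    sliceAt S t η = spatialSliceIntegral S (halfStep t) η := by
  obtain ⟨Λ₁, hΛ₁⟩ := exists_clm_timeIntegral hS.mass_boundary_lt (measurable_halfStep t)
    (abs_halfStep_le t) (pStar k d) (pproj d).continuous
  obtain ⟨Λ₂, hΛ₂⟩ := exists_clm_timeIntegral hS.mass_lt (measurable_halfStep t)
    (abs_halfStep_le t) (pStar (k + 1) d) (pproj d).continuous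
  have hcl := hS.2
  have hslice : ∀ (η : TestForm k (EuclideanSpace ℝ (Fin d))) (ω : TestForm k (SpaceTime d)),
      (∀ᶠ z in 𝓝ˢ (support S), ω z = pStar k d (η (pproj d z))) →
      spatialSliceIntegral S (halfStep t) η = slice S t ω := fun η ω hω => by
    rw [slice_apply hS.mass_lt hS.mass_boundary_lt,
      sliceIntegral_eq_spatialSliceIntegral hS.mass_lt hS.mass_boundary_lt _ hω]
  have hsub := support_slice_subset hS.mass_lt hS.mass_boundary_lt t
  -- Two forms that agree with `𝐩^* η` near the support of the slice have the same value there, so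
  -- it is enough to evaluate at the one that agrees with `𝐩^* η` near the support of `S`.
  have hex : ∃ R, IsSpatialPushforward (slice S t) R := by
    refine ⟨Λ₁ - Λ₂.comp (extDerivForm k _), fun η ω hω => ?_⟩
    obtain ⟨ω', -, hω'⟩ := exists_pullbackTest hcl η
    have h0 : slice S t (ω - ω') = 0 := by
      refine apply_eq_zero_of_eventually _ ?_
      filter_upwards [hω, hω'.filter_mono (nhdsSet_mono hsub)] with z h1 h2
      change ω z - ω' z = 0
      rw [h1, h2, pStar_apply, sub_self]
    rw [map_sub, sub_eq_zero] at h0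
    rw [h0, ← hslice η ω' hω']
    change Λ₁ η - Λ₂ (extDerivForm k _ η) = _
    rw [hΛ₁, hΛ₂]
    rfl
  obtain ⟨ω', -, hω'⟩ := exists_pullbackTest hcl η
  rw [sliceAt, spatialPushforward, dif_pos hex,
    hex.choose_spec η ω' (hω'.filter_mono (nhdsSet_mono hsub)), hslice η ω' hω']

theorem sliceAt_eq_slice (hS : IsNormal S) (t : ℝ) {η : TestForm k (EuclideanSpace ℝ (Fin d))}
    {ω : TestForm k (SpaceTime d)}
    (hω : ∀ᶠ z in 𝓝ˢ (support S), ω z = pStar k d (η (pproj d z))) :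
    sliceAt S t η = slice S t ω := by
  rw [sliceAt_apply hS, slice_apply hS.mass_lt hS.mass_boundary_lt,
    sliceIntegral_eq_spatialSliceIntegral hS.mass_lt hS.mass_boundary_lt _ hω]

end Pushforward

/-! ### The mass of a space-time current in terms of its variation and of its slices -/

section Fubini

variable {d k : ℕ}

theorem setIntegral_halfStep (a b u : ℝ) : ∫ s in Icc a b, halfStep s u = ramp a b u := by
  have hae : ∀ᵐ s ∂volume.restrict (Icc a b), halfStep s u = (Iio u).indicator 1 s := by
    filter_upwards [ae_restrict_of_ae (Measure.ae_ne volume u)] with s hs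
    unfold halfStep
    rcases lt_trichotomy u s with h | h | h
    · simp [h, h.le]
    · exact absurd h.symm hs
    · simp [h, h.not_gt, h.ne']
  rw [integral_congr_ae hae, integral_indicator_one measurableSet_Iio,
    measureReal_restrict_apply measurableSet_Iio, ramp]
  rcases le_or_gt u b with h | h
  · have : Iio u ∩ Icc a b = Ico a u := by
      ext s
      simp only [mem_inter_iff, mem_Iio, mem_Icc, mem_Ico]
      exact ⟨fun h' => ⟨h'.2.1, h'.1⟩, fun h' => ⟨h'.2, h'.1, h'.2.le.trans h⟩⟩
    rw [this, Real.volume_real_Ico, min_eq_left h, max_comm]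
  · have : Iio u ∩ Icc a b = Icc a b := inter_eq_right.2 fun s hs => hs.2.trans_lt h
    rw [this, Real.volume_real_Icc, min_eq_right h.le, max_comm]

theorem integral_timeIntegral_halfStep {T : Current k (SpaceTime d)} (hT : mass T < ∞) (a b : ℝ)
    {v : SpaceTime d → Covector k (SpaceTime d)} (hv : Continuous v) {C : ℝ}
    (hC : ∀ z, ‖v z‖ ≤ C) :
    Integrable (fun s => timeIntegral T (halfStep s) v) (volume.restrict (Icc a b)) ∧
      ∫ s in Icc a b, timeIntegral T (halfStep s) v = timeIntegral T (ramp a b) v := by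
  have := isFiniteMeasure_massMeasure hT
  have hint : Integrable (fun p : ℝ × SpaceTime d =>
      halfStep p.1 (tproj d p.2) * orientation T p.2 (v p.2))
      ((volume.restrict (Icc a b)).prod (massMeasure T)) := by
    refine Integrable.bdd_mul (c := 1)
      ((integrable_orientation_apply hT hv.stronglyMeasurable hC).comp_snd _) ?_
      (Eventually.of_forall fun p => abs_halfStep_le _ _)
    exact (measurable_uncurry_halfStep.comp (measurable_fst.prodMk
      ((tproj d).continuous.measurable.comp measurable_snd))).aestronglyMeasurable
  simp only [timeIntegral_eq_mul]
  refine ⟨hint.integral_prod_left, ?_⟩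
  rw [integral_integral_swap hint]
  refine integral_congr_ae (Eventually.of_forall fun z => ?_)
  change ∫ s in Icc a b, halfStep s (tproj d z) * orientation T z (v z) = _
  rw [integral_mul_const, setIntegral_halfStep]

variable {S : Current (k + 1) (SpaceTime d)}

/-- Integrating the slices over a time interval. -/
theorem setIntegral_slice (hS : mass S < ∞) (hS' : mass (boundary S) < ∞) (a b : ℝ)
    (ω : TestForm k (SpaceTime d)) :
    ∫ s in Icc a b, slice S s ω =
      ∫ z in tproj d ⁻¹' Icc a b, orientation S z (dtWedge (ω z)) ∂massMeasure S := by
  obtain ⟨C, -, hC⟩ := bounded_testForm ω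
  obtain ⟨C', -, hC'⟩ := bounded_testForm (extDerivForm k _ ω)
  have h1 := integral_timeIntegral_halfStep hS' a b ω.contDiff.continuous hC
  have h2 := integral_timeIntegral_halfStep hS a b
    (extDerivForm k (SpaceTime d) ω).contDiff.continuous hC'
  rw [setIntegral_eq_timeIntegral S measurableSet_Icc, timeIntegral_indicator_dtWedge hS hS',
    sliceIntegral, ← h1.2, ← h2.2, ← integral_sub h1.1 h2.1]
  simp only [slice_apply hS hS', sliceIntegral]

end Fubini

section MassBound

variable {d k : ℕ} {S : Current (k + 1) (SpaceTime d)}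

/-- The restriction of a form to the time slice `{t} × ℝ^d`. -/
def restrictTest (t : ℝ) (ω : TestForm k (SpaceTime d)) :
    TestForm k (EuclideanSpace ℝ (Fin d)) :=
  mkTest (fun x => iStar k d (ω (t • timeVec d + spaceIncl d x)))
    ((iStar k d).contDiff.comp (ω.contDiff.comp (contDiff_const.add (spaceIncl d).contDiff)))
    (by
      refine HasCompactSupport.of_support_subset_isCompact
        (ω.hasCompactSupport.isCompact.image (pproj d).continuous) fun x hx => ?_
      refine ⟨t • timeVec d + spaceIncl d x, subset_tsupport _ fun h0 => hx ?_, ?_⟩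
      · change iStar k d (ω (t • timeVec d + spaceIncl d x)) = 0
        rw [h0, map_zero]
      · simp)

theorem norm_restrictTest_le (t : ℝ) {ω : TestForm k (SpaceTime d)} {C : ℝ}
    (hC : ∀ z, ‖ω z‖ ≤ C) (x : EuclideanSpace ℝ (Fin d)) : ‖restrictTest t ω x‖ ≤ C :=
  (norm_iStar_le _).trans (hC _)

theorem norm_sub_embed (t : ℝ) (z : SpaceTime d) :
    ‖z - (t • timeVec d + spaceIncl d (pproj d z))‖ = |tproj d z - t| := by
  have h := norm_sq_eq_tproj_pproj (z - (t • timeVec d + spaceIncl d (pproj d z)))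
  simp only [map_sub, map_add, map_smul, tproj_timeVec, pproj_timeVec, tproj_spaceIncl,
    pproj_spaceIncl, smul_zero, zero_add, add_zero, sub_self, norm_zero, smul_eq_mul, mul_one] at h
  rw [zero_pow two_ne_zero, add_zero] at h
  exact (pow_left_inj₀ (norm_nonneg _) (norm_nonneg _) two_ne_zero).1 h

theorem tendsto_massMeasure_Icc {T : Current k (SpaceTime d)} (hT : mass T < ∞) {t : ℝ}
    (ht : massMeasure T (tproj d ⁻¹' {t}) = 0) :
    Tendsto (fun r => (massMeasure T).real (tproj d ⁻¹' Icc (t - r) (t + r))) (𝓝[>] 0)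
      (𝓝 0) := by
  have := isFiniteMeasure_massMeasure hT
  have h := tendsto_measure_biInter_gt (μ := massMeasure T) (a := (0 : ℝ))
    (s := fun r => tproj d ⁻¹' Icc (t - r) (t + r))
    (fun r _ => ((tproj d).continuous.measurable measurableSet_Icc).nullMeasurableSet)
    (fun i j _ hij => preimage_mono (Icc_subset_Icc (by linarith) (by linarith)))
    ⟨1, one_pos, measure_ne_top _ _⟩
  have hI : ⋂ r > (0 : ℝ), tproj d ⁻¹' Icc (t - r) (t + r) = tproj d ⁻¹' {t} := by
    ext z
    simp only [mem_iInter, mem_preimage, mem_Icc, mem_singleton_iff]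
    refine ⟨fun hz => le_antisymm ?_ ?_, fun hz r hr => by rw [hz]; constructor <;> linarith⟩
    · exact le_of_forall_pos_le_add fun r hr => (hz r hr).2
    · exact le_of_forall_pos_le_add fun r hr => by linarith [(hz r hr).1]
  rw [hI, ht] at h
  exact (ENNReal.tendsto_toReal ENNReal.zero_ne_top).comp h

/-- At a time `t` which is not an atom of `‖S‖`, the slice depends only on the restriction of the
test form to the time slice at `t`. -/
theorem slice_eq_sliceAt_restrictTest (hS : IsNormal S) {t : ℝ}
    (ht : massMeasure S (tproj d ⁻¹' {t}) = 0) (ω : TestForm k (SpaceTime d)) :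
    slice S t ω = sliceAt S t (restrictTest t ω) := by
  obtain ⟨ω', -, hω'⟩ := exists_pullbackTest hS.2 (restrictTest t ω)
  have hfin := isFiniteMeasure_massMeasure hS.mass_lt
  rw [sliceAt_eq_slice hS t hω', ← sub_eq_zero, ← map_sub]
  -- On the slab `|s - t| ≤ r`, the forms `ω` and `ω'` differ by `O(r)` modulo `dt`.
  obtain ⟨L, hL⟩ := ω.contDiff.lipschitzWith_of_hasCompactSupport ω.hasCompactSupport (by simp)
  refine tendsto_nhds_unique (isSlice_slice hS.mass_lt hS.mass_boundary_lt t (ω - ω')) ?_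
  have hlim := (tendsto_massMeasure_Icc hS.mass_lt ht).const_mul (((k : ℝ) + 1) * L / 2)
  rw [mul_zero] at hlim
  refine squeeze_zero_norm' ?_ hlim
  filter_upwards [self_mem_nhdsWithin] with r hr
  have hr' : 0 < r := hr
  have hbd : ‖∫ z in tproj d ⁻¹' Icc (t - r) (t + r), orientation S z (dtWedge ((ω - ω') z))
      ∂massMeasure S‖ ≤ ((k + 1) * (L * r)) *
        (massMeasure S).real (tproj d ⁻¹' Icc (t - r) (t + r)) := by
    refine norm_setIntegral_le_of_norm_le_const_ae' (measure_lt_top _ _) ?_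
    filter_upwards [(isPolarDecomposition hS.mass_lt).unit,
      ae_mem_of_support_subset hS.mass_lt Subset.rfl] with z hz1 hz2 hzr
    have h1 : ω' z = pStar k d (restrictTest t ω (pproj d z)) :=
      (hω'.filter_mono (nhds_le_nhdsSet hz2)).self_of_nhds
    have h2 : dtWedge ((ω - ω') z) =
        dtWedgeCLM k d (ω z - ω (t • timeVec d + spaceIncl d (pproj d z))) := by
      change dtWedgeCLM k d (ω z - ω' z) = _
      rw [map_sub, map_sub, h1, dtWedgeCLM_apply (pStar k d _)]
      exact congrArg _ (dtWedge_pStar_iStar _)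
    have h3 := (orientation S z).le_opNorm (dtWedge ((ω - ω') z))
    rw [hz1, one_mul, h2] at h3
    rw [h2]
    refine h3.trans (((dtWedgeCLM k d).le_opNorm _).trans ?_)
    refine mul_le_mul norm_dtWedgeCLM_le ?_ (norm_nonneg _) (by positivity)
    have h4 := hL.norm_sub_le z (t • timeVec d + spaceIncl d (pproj d z))
    rw [norm_sub_embed] at h4
    refine h4.trans (mul_le_mul_of_nonneg_left ?_ L.coe_nonneg)
    exact abs_le.2 ⟨by linarith [hzr.1], by linarith [hzr.2]⟩
  rw [norm_mul, norm_inv, Real.norm_of_nonneg (by linarith : (0 : ℝ) ≤ 2 * r)]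
  refine (mul_le_mul_of_nonneg_left hbd (by positivity)).trans (le_of_eq ?_)
  field_simp

theorem ae_massMeasure_fiber_eq_zero {T : Current k (SpaceTime d)} (hT : mass T < ∞) :
    ∀ᵐ t : ℝ, massMeasure T (tproj d ⁻¹' {t}) = 0 := by
  have := isFiniteMeasure_massMeasure hT
  have hc := Measure.countable_meas_level_set_pos (μ := massMeasure T)
    (tproj d).continuous.measurable
  filter_upwards [hc.ae_notMem volume] with t ht
  exact nonpos_iff_eq_zero.1 (not_lt.1 ht)

theorem enorm_apply_le_mass {E : Type*} [NormedAddCommGroup E] [NormedSpace ℝ E]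
    (T : Current k E) {ω : TestForm k E} (hω : ∀ x, ‖ω x‖ ≤ 1) : ‖T ω‖ₑ ≤ mass T := by
  rw [Real.enorm_eq_ofReal_abs]
  rcases abs_choice (T ω) with h | h <;> rw [h]
  · exact ofReal_apply_le_mass T hω
  · rw [← map_neg]
    exact ofReal_apply_le_mass T fun x => by
      change ‖-ω x‖ ≤ 1
      rw [norm_neg]
      exact hω x

theorem setLIntegral_comp_dtWedge_le (hS : IsNormal S) {σ τ a b : ℝ}
    (hab : Icc a b ⊆ Icc σ τ) :
    ∫⁻ z in tproj d ⁻¹' Icc a b, ‖(orientation S z).comp (dtWedgeCLM k d)‖ₑ ∂massMeasure S ≤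
      ENNReal.ofReal (b - a) * linftyNorm S (Icc σ τ) := by
  have := isFiniteMeasure_massMeasure hS.mass_lt
  have hf := isDualField hS.mass_lt
  refine lintegral_enorm_le_of_testFunction (hf.stronglyMeasurable_comp (dtWedgeCLM k d))
    (hf.integrable_comp (dtWedgeCLM k d)).restrict fun α hα => ?_
  have h1 := setIntegral_slice hS.mass_lt hS.mass_boundary_lt a b α
  change ENNReal.ofReal (∫ z in tproj d ⁻¹' Icc a b, orientation S z (dtWedge (α z))
    ∂massMeasure S) ≤ _
  rw [← h1]
  have h2 : ∀ᵐ s ∂volume.restrict (Icc a b), ‖slice S s α‖ₑ ≤ linftyNorm S (Icc σ τ) := by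
    filter_upwards [ae_mono (Measure.restrict_mono hab le_rfl)
      (ENNReal.ae_le_essSup (μ := volume.restrict (Icc σ τ)) fun t => mass (sliceAt S t)),
      ae_restrict_of_ae (ae_massMeasure_fiber_eq_zero hS.mass_lt)] with s hs1 hs2
    rw [slice_eq_sliceAt_restrictTest hS hs2]
    exact (enorm_apply_le_mass _ (norm_restrictTest_le s hα)).trans hs1
  calc ENNReal.ofReal (∫ s in Icc a b, slice S s α)
      ≤ ‖∫ s in Icc a b, slice S s α‖ₑ := by
        rw [Real.enorm_eq_ofReal_abs]
        exact ENNReal.ofReal_le_ofReal (le_abs_self _)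
    _ ≤ ∫⁻ s in Icc a b, ‖slice S s α‖ₑ := enorm_integral_le_lintegral_enorm _
    _ ≤ ∫⁻ _ in Icc a b, linftyNorm S (Icc σ τ) := lintegral_mono_ae h2
    _ = ENNReal.ofReal (b - a) * linftyNorm S (Icc σ τ) := by
        rw [setLIntegral_const, Real.volume_Icc, mul_comm]

/-- The mass of `S` over a time interval is controlled by the variation and the masses of the
slices, since `dt ∧` and the spatial covectors span all covectors. -/
theorem massMeasure_le_variation_add (hS : IsNormal S) {σ τ a b : ℝ}
    (hab : Icc a b ⊆ Icc σ τ) :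
    massMeasure S (tproj d ⁻¹' Icc a b) ≤
      variation S (Icc a b) + ENNReal.ofReal (b - a) * linftyNorm S (Icc σ τ) := by
  have hf := isDualField hS.mass_lt
  refine le_trans ?_ (add_le_add_right (setLIntegral_comp_dtWedge_le hS hab) _)
  change _ ≤ ∫⁻ z in tproj d ⁻¹' Icc a b,
    ‖(orientation S z).comp (pStar (k + 1) d)‖ₑ ∂massMeasure S + _
  rw [← hf.lintegral_enorm,
    ← lintegral_add_left (hf.stronglyMeasurable_comp (pStar (k + 1) d)).enorm]
  refine lintegral_mono fun z => ?_
  have h := norm_le_spatialPart_add (orientation S z)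
  rw [← ofReal_norm, ← ofReal_norm, ← ofReal_norm, ← ENNReal.ofReal_add (norm_nonneg _)
    (norm_nonneg _)]
  exact ENNReal.ofReal_le_ofReal h

theorem boundary_boundary {E : Type*} [NormedAddCommGroup E] [NormedSpace ℝ E]
    (T : Current (k + 2) E) : boundary (boundary T) = 0 := by
  ext ω
  change T (extDerivForm (k + 1) E (extDerivForm k E ω)) = 0
  have hle : (2 : WithTop ℕ∞) ≤ ((⊤ : ℕ∞) : WithTop ℕ∞) :=
    WithTop.coe_le_coe.2 (le_top : (2 : ℕ∞) ≤ ⊤)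
  have : extDerivForm (k + 1) E (extDerivForm k E ω) = 0 := by
    ext1 x
    have h : (extDerivForm k E ω : E → Covector (k + 1) E) = extDeriv (ω : E → Covector k E) :=
      funext (extDerivForm_apply k ω)
    rw [extDerivForm_apply, h, extDeriv_extDeriv ω.contDiff (by simpa using hle)]
    rfl
  rw [this, map_zero]

theorem mass_zero {E : Type*} [NormedAddCommGroup E] [NormedSpace ℝ E] :
    mass (0 : Current k E) = 0 := by
  simp [mass]

theorem IsNormal.boundary {E : Type*} [NormedAddCommGroup E] [NormedSpace ℝ E]
    [FiniteDimensional ℝ E] {T : Current (k + 2) E} (hT : IsNormal T) : IsNormal (boundary T) := by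
  refine ⟨?_, hT.2.of_isClosed_subset Distribution.isClosed_dsupport (support_boundary_subset T)⟩
  rw [boundary_boundary, mass_zero, add_zero]
  exact hT.mass_boundary_lt

theorem massMeasure_boundary_le_variation_add (hS : IsNormal S) {σ τ a b : ℝ}
    (hab : Icc a b ⊆ Icc σ τ) :
    massMeasure (boundary S) (tproj d ⁻¹' Icc a b) ≤ variation (boundary S) (Icc a b) +
      ENNReal.ofReal (b - a) * linftyNormBoundary S (Icc σ τ) := by
  cases k with
  | zero =>
    refine le_trans ?_ le_self_add
    rw [variation, ← (isDualField hS.mass_boundary_lt).lintegral_enorm]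
    exact lintegral_mono fun z => enorm_le_iff_norm_le.2 (norm_le_spatialPart_zero _)
  | succ k => exact massMeasure_le_variation_add hS.boundary hab

end MassBound

/-! ### Compactness -/

section WeakStarCompactness

/-- Sequential weak* compactness for functionals on test functions which are bounded by the
supremum norm on a fixed compact set. -/
theorem exists_subseq_tendsto_of_bounded_on_compact {E V : Type*} [NormedAddCommGroup E]
    [NormedSpace ℝ E] [FiniteDimensional ℝ E] [NormedAddCommGroup V] [NormedSpace ℝ V]
    [SecondCountableTopology V] {T : ℕ → 𝓓((⊤ : TopologicalSpace.Opens E), V) →L[ℝ] ℝ} {Z : Set E}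
    (hZ : IsCompact Z) {m : ℝ} (hm : 0 ≤ m)
    (h : ∀ j ω C, 0 ≤ C → (∀ x ∈ Z, ‖ω x‖ ≤ C) → |T j ω| ≤ m * C) :
    ∃ (T' : 𝓓((⊤ : TopologicalSpace.Opens E), V) →L[ℝ] ℝ) (φ : ℕ → ℕ), StrictMono φ ∧
      ∀ ω, Tendsto (fun j => T (φ j) ω) atTop (𝓝 (T' ω)) := by
  have : CompactSpace Z := isCompact_iff_compactSpace.1 hZ
  have : SecondCountableTopology E := by
    have := FiniteDimensional.proper ℝ E
    exact secondCountable_of_proper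
  let R : BoundedContinuousFunction E V →L[ℝ] C(Z, V) :=
    LinearMap.mkContinuous
      { toFun := fun f => f.toContinuousMap.restrict Z
        map_add' := fun _ _ => rfl
        map_smul' := fun _ _ => rfl } 1 fun f => by
      rw [one_mul]
      exact (ContinuousMap.norm_le _ (norm_nonneg f)).2 fun x => f.norm_coe_le_norm x
  let L : 𝓓((⊤ : TopologicalSpace.Opens E), V) →L[ℝ] C(Z, V) :=
    R.comp (TestFunction.toBoundedContinuousFunctionCLM ℝ)
  have hL : ∀ ω (x : Z), L ω x = ω x := fun _ _ => rfl
  choose F hF hFT using fun j => exists_dual_factor L.toLinearMap (T j).toLinearMap hm fun ω => by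
    refine h j ω _ (norm_nonneg _) fun x hx => ?_
    exact (L ω).norm_coe_le_norm ⟨x, hx⟩
  obtain ⟨G, -, φ, hφ, hlim⟩ := WeakDual.isSeqCompact_closedBall ℝ C(Z, V) 0 m
    (x := fun j => StrongDual.toWeakDual (F j)) fun j => by
      simpa using hF j
  refine ⟨(WeakDual.toStrongDual G).comp L, φ, hφ, fun ω => ?_⟩
  have := ((WeakDual.eval_continuous (L ω)).tendsto G).comp hlim
  refine this.congr fun j => ?_
  exact hFT (φ j) ω

/-- Currents of uniformly bounded mass with supports in a fixed compact set are weak*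
sequentially compact. -/
theorem exists_subseq_weakStarTendsto {E : Type*} [NormedAddCommGroup E] [NormedSpace ℝ E]
    [FiniteDimensional ℝ E] [MeasurableSpace E] [BorelSpace E] {k : ℕ} {T : ℕ → Current k E}
    {Z : Set E} (hZ : IsCompact Z) (hsupp : ∀ j, support (T j) ⊆ Z) {m : ℝ≥0}
    (hm : ∀ j, mass (T j) ≤ m) :
    ∃ (T' : Current k E) (φ : ℕ → ℕ), StrictMono φ ∧ WeakStarTendsto (fun j => T (φ j)) T' := by
  have hfin : ∀ j, mass (T j) < ∞ := fun j => (hm j).trans_lt ENNReal.coe_lt_top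
  refine exists_subseq_tendsto_of_bounded_on_compact hZ m.coe_nonneg fun j ω C hC0 hC => ?_
  have hμ := isFiniteMeasure_massMeasure (hfin j)
  rw [(isPolarDecomposition (hfin j)).repr ω]
  have h1 : ‖∫ x, orientation (T j) x (ω x) ∂massMeasure (T j)‖ ≤
      C * (massMeasure (T j)).real univ := by
    refine norm_integral_le_of_norm_le_const ?_
    filter_upwards [(isPolarDecomposition (hfin j)).unit,
      ae_mem_of_support_subset (hfin j) (hsupp j)] with x hx hxZ
    have h2 := (orientation (T j) x).le_opNorm (ω x)
    rw [hx, one_mul] at h2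
    exact h2.trans (hC x hxZ)
  refine h1.trans ?_
  rw [mul_comm]
  gcongr
  exact ENNReal.toReal_le_coe_of_le_coe ((massMeasure_univ_le_mass (hfin j)).trans (hm j))

theorem support_subset_of_weakStarTendsto {E : Type*} [NormedAddCommGroup E] [NormedSpace ℝ E]
    [FiniteDimensional ℝ E] {k : ℕ} {T : ℕ → Current k E} {T' : Current k E} {Z : Set E}
    (hZ : IsClosed Z) (hsupp : ∀ j, support (T j) ⊆ Z) (h : WeakStarTendsto T T') :
    support T' ⊆ Z :=
  support_subset_of_vanishing hZ fun ω hω =>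
    tendsto_nhds_unique (h ω) (tendsto_const_nhds.congr fun j =>
      (apply_eq_zero_of_tsupport_subset (T j) (hω.trans (compl_subset_compl.2 (hsupp j)))).symm)

theorem weakStarTendsto_boundary {E : Type*} [NormedAddCommGroup E] [NormedSpace ℝ E] {k : ℕ}
    {T : ℕ → Current (k + 1) E} {T' : Current (k + 1) E} (h : WeakStarTendsto T T') :
    WeakStarTendsto (fun j => boundary (T j)) (boundary T') :=
  fun ω => h (extDerivForm k E ω)

end WeakStarCompactness

section Helly

/-- A form of Helly's selection theorem: after passing to a subsequence, bounded measures on the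
line do not concentrate outside a countable set. -/
theorem exists_subseq_no_concentration {m : ℕ → Measure ℝ} {C : ℝ≥0}
    (hm : ∀ j, m j univ ≤ C) :
    ∃ (φ : ℕ → ℕ) (D : Set ℝ), StrictMono φ ∧ D.Countable ∧ ∀ t ∉ D, ∀ ε : ℝ, 0 < ε →
      ∃ r > 0, ∀ᶠ j in atTop, m (φ j) (Ioo (t - r) (t + r)) ≤ ENNReal.ofReal ε := by
  have hfin : ∀ j, IsFiniteMeasure (m j) := fun j => ⟨(hm j).trans_lt ENNReal.coe_lt_top⟩
  have hcpt : IsCompact (univ.pi fun _ : ℚ => Icc (0 : ℝ) C) :=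
    isCompact_univ_pi fun _ => isCompact_Icc
  obtain ⟨g, hg, φ, hφ, hlim⟩ := hcpt.isSeqCompact
    (x := fun j (q : ℚ) => (m j).real (Iic (q : ℝ))) fun j q _ =>
      ⟨measureReal_nonneg, ENNReal.toReal_le_coe_of_le_coe
        ((measure_mono (subset_univ _)).trans (hm j))⟩
  rw [tendsto_pi_nhds] at hlim
  have hgm : ∀ p q : ℚ, p ≤ q → g p ≤ g q := fun p q hpq =>
    le_of_tendsto_of_tendsto' (hlim p) (hlim q) fun j =>
      measureReal_mono (Iic_subset_Iic.2 (by exact_mod_cast hpq))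
  -- The monotone function `G` extends the limit distribution function from `ℚ` to `ℝ`.
  let G : ℝ → ℝ := fun x => sSup (g '' {q : ℚ | (q : ℝ) < x})
  have hbdd : ∀ x, BddAbove (g '' {q : ℚ | (q : ℝ) < x}) := fun x => by
    refine ⟨C, ?_⟩
    rintro _ ⟨q, -, rfl⟩
    exact (hg q (mem_univ q)).2
  have hne : ∀ x, (g '' {q : ℚ | (q : ℝ) < x}).Nonempty := fun x =>
    let ⟨q, hq⟩ := exists_rat_lt x
    ⟨g q, q, hq, rfl⟩
  have hGm : Monotone G := fun x y hxy =>
    csSup_le_csSup (hbdd y) (hne x) (image_mono fun q (hq : (q : ℝ) < x) => hq.trans_le hxy)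
  have hgG : ∀ (q : ℚ) (x : ℝ), (q : ℝ) < x → g q ≤ G x := fun q x hq =>
    le_csSup (hbdd x) ⟨q, hq, rfl⟩
  have hGg : ∀ (q : ℚ) (x : ℝ), x ≤ q → G x ≤ g q := fun q x hq => by
    refine csSup_le (hne x) ?_
    rintro _ ⟨p, hp, rfl⟩
    exact hgm p q (by exact_mod_cast (show (p : ℝ) ≤ q from (le_of_lt hp).trans hq))
  refine ⟨φ, {x | ¬ContinuousAt G x}, hφ, hGm.countable_not_continuousAt, fun t ht ε hε => ?_⟩
  have hcont : ContinuousAt G t := not_not.1 ht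
  obtain ⟨δ, hδ, hGδ⟩ := Metric.continuousAt_iff.1 hcont (ε / 2) (by linarith)
  obtain ⟨p, hp1, hp2⟩ := exists_rat_btwn (show t - δ / 2 < t by linarith)
  obtain ⟨q, hq1, hq2⟩ := exists_rat_btwn (show t < t + δ / 2 by linarith)
  have h1 := hGδ (x := t - δ / 2) (by
    rw [Real.dist_eq, abs_lt]
    constructor <;> linarith)
  have h2 := hGδ (x := t + δ / 2) (by
    rw [Real.dist_eq, abs_lt]
    constructor <;> linarith)
  rw [Real.dist_eq, abs_lt] at h1 h2
  have hpq : g q - g p < ε := by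
    linarith [hgG q _ hq2, hGg p _ hp1.le]
  refine ⟨min (t - p) (q - t), lt_min (by linarith) (by linarith), ?_⟩
  have hev : ∀ᶠ j in atTop, (m (φ j)).real (Iic (q : ℝ)) - (m (φ j)).real (Iic (p : ℝ)) < ε :=
    ((hlim q).sub (hlim p)).eventually_lt_const hpq
  filter_upwards [hev] with j hj
  have hsub : Ioo (t - min (t - p) (q - t)) (t + min (t - p) (q - t)) ⊆
      Iic (q : ℝ) \ Iic (p : ℝ) := fun s hs => by
    refine ⟨?_, fun hsp => absurd (show s ≤ (p : ℝ) from hsp) (not_le.2 ?_)⟩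
    · exact le_of_lt (hs.2.trans_le (by linarith [min_le_right (t - p) (q - t)]))
    · exact lt_of_le_of_lt (by linarith [min_le_left (t - p) (q - t)]) hs.1
  refine (measure_mono hsub).trans ?_
  rw [← ofReal_measureReal, measureReal_sdiff
    (Iic_subset_Iic.2 (by linarith)) measurableSet_Iic]
  exact ENNReal.ofReal_le_ofReal hj.le

end Helly

/-! ### Convergence of slices -/

section SliceConvergence

variable {d k : ℕ}

theorem abs_timeIntegral_pStar_le {T : Current k (SpaceTime d)} (hT : mass T < ∞) {h : ℝ → ℝ}
    {U : Set ℝ} (hU : MeasurableSet U) (hh : ∀ s, |h s| ≤ U.indicator 1 s)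
    {v : SpaceTime d → Covector k (EuclideanSpace ℝ (Fin d))} {C : ℝ} (hC : ∀ z, ‖v z‖ ≤ C) :
    |timeIntegral T h (fun z => pStar k d (v z))| ≤ C * (variation T U).toReal := by
  have hf := isDualField hT
  have hC0 : 0 ≤ C := (norm_nonneg _).trans (hC 0)
  have hi : Integrable (fun z => ‖(orientation T z).comp (pStar k d)‖) (massMeasure T) :=
    (hf.integrable_comp (pStar k d)).norm
  have hUm : MeasurableSet (tproj d ⁻¹' U) := (tproj d).continuous.measurable hU
  have hvar : (variation T U).toReal =
      ∫ z in tproj d ⁻¹' U, ‖(orientation T z).comp (pStar k d)‖ ∂massMeasure T :=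
    (integral_norm_eq_lintegral_enorm
      (hf.stronglyMeasurable_comp (pStar k d)).aestronglyMeasurable.restrict).symm
  rw [hvar, ← integral_indicator hUm, ← integral_const_mul]
  refine norm_integral_le_of_norm_le (μ := massMeasure T)
    (f := fun z => orientation T z (h (tproj d z) • pStar k d (v z)))
    ((hi.indicator hUm).const_mul C) (Eventually.of_forall fun z => ?_)
  have h1 : orientation T z (h (tproj d z) • pStar k d (v z)) =
      h (tproj d z) * (orientation T z).comp (pStar k d) (v z) := (orientation T z).map_smul _ _
  rw [h1, norm_mul]
  have h2 : ‖(orientation T z).comp (pStar k d) (v z)‖ ≤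
      ‖(orientation T z).comp (pStar k d)‖ * C :=
    (((orientation T z).comp (pStar k d)).le_opNorm _).trans (by gcongr; exact hC z)
  by_cases hz : tproj d z ∈ U
  · have h3 := hh (tproj d z)
    rw [indicator_of_mem hz] at h3
    rw [indicator_of_mem (show z ∈ tproj d ⁻¹' U from hz), mul_comm C]
    exact (mul_le_of_le_one_left (norm_nonneg _) h3).trans h2
  · have h3 := hh (tproj d z)
    rw [indicator_of_notMem hz] at h3
    rw [indicator_of_notMem (show z ∉ tproj d ⁻¹' U from hz), mul_zero, Real.norm_eq_abs,
      le_antisymm h3 (abs_nonneg _), zero_mul]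

/-- A smooth step which agrees with `halfStep t` at `t` and outside `(t - r, t + r)`. -/
def smoothStep (t r s : ℝ) : ℝ := Real.smoothTransition ((s - t + r) / (2 * r))

theorem contDiff_smoothStep (t r : ℝ) : ContDiff ℝ (⊤ : ℕ∞) (smoothStep t r) :=
  Real.smoothTransition.contDiff.comp (by fun_prop)

theorem abs_smoothStep_le (t r s : ℝ) : |smoothStep t r s| ≤ 1 := by
  rw [smoothStep, abs_of_nonneg (Real.smoothTransition.nonneg _)]
  exact Real.smoothTransition.le_one _

theorem smoothTransition_half : Real.smoothTransition (1 / 2) = 1 / 2 := by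
  have h : expNegInvGlue (1 / 2) ≠ 0 := (expNegInvGlue.pos_of_pos (by norm_num)).ne'
  rw [Real.smoothTransition, show (1 : ℝ) - 1 / 2 = 1 / 2 by norm_num]
  field_simp
  norm_num

theorem abs_halfStep_sub_smoothStep_le (t : ℝ) {r : ℝ} (hr : 0 < r) (s : ℝ) :
    |halfStep t s - smoothStep t r s| ≤ (Ioo (t - r) (t + r) \ {t}).indicator 1 s := by
  have h2r : 0 < 2 * r := by linarith
  rcases lt_trichotomy s t with hs | hs | hs
  · rw [halfStep, if_pos hs, zero_sub, abs_neg]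
    by_cases hs' : t - r < s
    · rw [indicator_of_mem (show s ∈ Ioo (t - r) (t + r) \ {t} from ⟨⟨hs', by linarith⟩, hs.ne⟩)]
      exact abs_smoothStep_le t r s
    · rw [smoothStep, Real.smoothTransition.zero_of_nonpos
        (div_nonpos_of_nonpos_of_nonneg (by linarith) h2r.le), abs_zero]
      exact indicator_nonneg (fun _ _ => zero_le_one) _
  · have : (s - t + r) / (2 * r) = 1 / 2 := by
      rw [hs]
      field_simp
      ring
    rw [halfStep, if_neg hs.not_lt, if_pos hs, smoothStep, this, smoothTransition_half, sub_self,
      abs_zero]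
    exact indicator_nonneg (fun _ _ => zero_le_one) _
  · rw [halfStep, if_neg hs.not_gt, if_neg hs.ne']
    by_cases hs' : s < t + r
    · rw [indicator_of_mem
        (show s ∈ Ioo (t - r) (t + r) \ {t} from ⟨⟨by linarith, hs'⟩, hs.ne'⟩),
        Pi.one_apply, abs_le, smoothStep]
      constructor <;> linarith [Real.smoothTransition.nonneg ((s - t + r) / (2 * r)),
        Real.smoothTransition.le_one ((s - t + r) / (2 * r))]
    · rw [smoothStep, Real.smoothTransition.one_of_one_le ((one_le_div₀ h2r).2 (by linarith)),
        sub_self, abs_zero]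
      exact indicator_nonneg (fun _ _ => zero_le_one) _

theorem abs_spatialSliceIntegral_sub_le {S : Current (k + 1) (SpaceTime d)} (hS : IsNormal S)
    (t : ℝ) {r : ℝ} (hr : 0 < r) {η : TestForm k (EuclideanSpace ℝ (Fin d))} {C : ℝ}
    (hC : ∀ x, ‖η x‖ ≤ C) (hC' : ∀ x, ‖extDerivForm k _ η x‖ ≤ C) :
    |spatialSliceIntegral S (halfStep t) η - spatialSliceIntegral S (smoothStep t r) η| ≤
      C * ((variation (boundary S) (Ioo (t - r) (t + r) \ {t})).toReal +
        (variation S (Ioo (t - r) (t + r) \ {t})).toReal) := by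
  have hU : MeasurableSet (Ioo (t - r) (t + r) \ {t}) :=
    measurableSet_Ioo.diff (measurableSet_singleton t)
  have key : ∀ {l : ℕ} {T : Current l (SpaceTime d)} (_ : mass T < ∞)
      (α : TestForm l (EuclideanSpace ℝ (Fin d))) (_ : ∀ x, ‖α x‖ ≤ C),
      |timeIntegral T (halfStep t) (fun z => pStar l d (α (pproj d z))) -
        timeIntegral T (smoothStep t r) (fun z => pStar l d (α (pproj d z)))| ≤
        C * (variation T (Ioo (t - r) (t + r) \ {t})).toReal := by
    intro l T hT α hα
    have hbd : ∀ {h : ℝ → ℝ}, (∀ s, |h s| ≤ 1) → ∀ z : SpaceTime d,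
        ‖h (tproj d z) • pStar l d (α (pproj d z))‖ ≤ C := fun hh z => by
      rw [norm_smul]
      exact (mul_le_of_le_one_left (norm_nonneg _) (hh _)).trans
        ((norm_pStar_le _).trans (hα _))
    have hcont : Continuous fun z : SpaceTime d => pStar l d (α (pproj d z)) :=
      (pStar l d).continuous.comp (α.contDiff.continuous.comp (pproj d).continuous)
    rw [timeIntegral_sub hT (measurable_halfStep t) (contDiff_smoothStep t r).continuous.measurable
      hcont (hbd (abs_halfStep_le t)) (hbd (abs_smoothStep_le t r))]
    exact abs_timeIntegral_pStar_le hT hU (abs_halfStep_sub_smoothStep_le t hr)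
      fun z => hα (pproj d z)
  have h1 := key hS.mass_boundary_lt η hC
  have h2 := key hS.mass_lt (extDerivForm k _ η) hC'
  rw [mul_add]
  refine le_trans ?_ (add_le_add h1 h2)
  rw [spatialSliceIntegral, spatialSliceIntegral, sub_sub_sub_comm]
  exact abs_sub _ _

theorem tendsto_spatialSliceIntegral_smooth {S : ℕ → Current (k + 1) (SpaceTime d)}
    {S' : Current (k + 1) (SpaceTime d)} (hS : ∀ j, IsNormal (S j)) (hS' : IsNormal S')
    {Z : Set (SpaceTime d)} (hZ : IsCompact Z) (hSZ : ∀ j, support (S j) ⊆ Z)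
    (hSZ' : support S' ⊆ Z) (hconv : WeakStarTendsto S S') {h : ℝ → ℝ}
    (hh : ContDiff ℝ (⊤ : ℕ∞) h) (η : TestForm k (EuclideanSpace ℝ (Fin d))) :
    Tendsto (fun j => spatialSliceIntegral (S j) h η) atTop (𝓝 (spatialSliceIntegral S' h η)) := by
  obtain ⟨ω, -, hω⟩ := exists_pullbackTest hZ η
  have key : ∀ {T : Current (k + 1) (SpaceTime d)}, IsNormal T → support T ⊆ Z →
      spatialSliceIntegral T h η =
        boundary T (smulTest (fun z => h (tproj d z)) (contDiff_weight hh) ω) -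
        T (smulTest (fun z => h (tproj d z)) (contDiff_weight hh) (extDerivForm k _ ω)) := by
    intro T hT hTZ
    rw [← sliceIntegral_eq_spatialSliceIntegral hT.mass_lt hT.mass_boundary_lt h
      (hω.filter_mono (nhdsSet_mono hTZ)), sliceIntegral,
      timeIntegral_eq_apply hT.mass_boundary_lt hh, timeIntegral_eq_apply hT.mass_lt hh]
  rw [key hS' hSZ']
  simp only [key (hS _) (hSZ _)]
  exact (weakStarTendsto_boundary hconv _).sub (hconv _)

/-- The slices at `t` converge if the variations do not concentrate near `t`. An atom at `t` itself
is harmless, since the slicing weights agree at `t`. -/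
theorem weakStarTendsto_sliceAt {S : ℕ → Current (k + 1) (SpaceTime d)}
    {S' : Current (k + 1) (SpaceTime d)} (hS : ∀ j, IsNormal (S j)) (hS' : IsNormal S')
    {Z : Set (SpaceTime d)} (hZ : IsCompact Z) (hSZ : ∀ j, support (S j) ⊆ Z)
    (hSZ' : support S' ⊆ Z) (hconv : WeakStarTendsto S S') {t : ℝ}
    (hconc : ∀ ε : ℝ, 0 < ε → ∃ r > 0, ∀ᶠ j in atTop,
      variation (S j) (Ioo (t - r) (t + r) \ {t}) +
        variation (boundary (S j)) (Ioo (t - r) (t + r) \ {t}) ≤ ENNReal.ofReal ε) :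
    WeakStarTendsto (fun j => sliceAt (S j) t) (sliceAt S' t) := by
  intro η
  simp only [sliceAt_apply (hS _), sliceAt_apply hS']
  obtain ⟨C₁, hC₁, hC₁'⟩ := bounded_testForm η
  obtain ⟨C₂, hC₂, hC₂'⟩ := bounded_testForm (extDerivForm k _ η)
  set C := max C₁ C₂
  have hC : ∀ x, ‖η x‖ ≤ C := fun x => (hC₁' x).trans (le_max_left _ _)
  have hC' : ∀ x, ‖extDerivForm k _ η x‖ ≤ C := fun x => (hC₂' x).trans (le_max_right _ _)
  have hC0 : 0 ≤ C := hC₁.trans (le_max_left _ _)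
  rw [Metric.tendsto_atTop']
  intro ε hε
  set δ := ε / (4 * C + 1) with hδ
  have hpos : 0 < 4 * C + 1 := by positivity
  have hδ0 : 0 < δ := by positivity
  obtain ⟨r, hr, hev⟩ := hconc δ hδ0
  have hopen : IsOpen (Ioo (t - r) (t + r) \ {t}) := isOpen_Ioo.sdiff isClosed_singleton
  have hvar : ∀ {T : Current (k + 1) (SpaceTime d)}, IsNormal T →
      variation T (Ioo (t - r) (t + r) \ {t}) ≤ ENNReal.ofReal δ →
      variation (boundary T) (Ioo (t - r) (t + r) \ {t}) ≤ ENNReal.ofReal δ →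
      |spatialSliceIntegral T (halfStep t) η - spatialSliceIntegral T (smoothStep t r) η| ≤
        2 * C * δ := by
    intro T hT h1 h2
    refine (abs_spatialSliceIntegral_sub_le hT t hr hC hC').trans ?_
    have h1' := ENNReal.toReal_le_of_le_ofReal hδ0.le h1
    have h2' := ENNReal.toReal_le_of_le_ofReal hδ0.le h2
    nlinarith
  have hlimit := hvar hS'
    ((variation_le_liminf hS'.mass_lt (fun j => (hS j).mass_lt) hconv hopen).trans
      (liminf_le_of_frequently_le' (hev.mono fun j hj => le_self_add.trans hj).frequently))
    ((variation_le_liminf hS'.mass_boundary_lt (fun j => (hS j).mass_boundary_lt)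
      (weakStarTendsto_boundary hconv) hopen).trans
      (liminf_le_of_frequently_le' (hev.mono fun j hj => le_add_self.trans hj).frequently))
  have hsm := Metric.tendsto_atTop'.1 (tendsto_spatialSliceIntegral_smooth hS hS' hZ hSZ hSZ'
    hconv (contDiff_smoothStep t r) η) δ hδ0
  have hε' : (4 * C + 1) * δ = ε := by
    rw [hδ]
    field_simp
  obtain ⟨N, hN⟩ := hsm
  obtain ⟨N', hN'⟩ := eventually_atTop.1 hev
  refine ⟨max N N', fun j hj => ?_⟩
  have h1 := hN j (lt_of_le_of_lt (le_max_left _ _) hj)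
  have h2 := hN' j ((le_max_right N N').trans hj.le)
  have h3 := hvar (hS j) (le_self_add.trans h2) (le_add_self.trans h2)
  rw [Real.dist_eq, abs_lt] at h1 ⊢
  rw [abs_le] at h3 hlimit
  constructor <;> nlinarith

end SliceConvergence

/-! ### Variation measures and Lipschitz bounds -/

section LipschitzMeasure

variable {ν : Measure ℝ} {σ τ : ℝ} {c : ℝ≥0}

/-- The measure of an interval inside `(σ, τ)` is at most `c` times its length. -/
def MeasureLipschitz (ν : Measure ℝ) (σ τ : ℝ) (c : ℝ≥0) : Prop :=
  ∀ s t, σ < s → s < t → t < τ → ν (Ico s t) ≤ c * ENNReal.ofReal (t - s)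

theorem lipschitzOnWith_measure_Ioo [IsFiniteMeasure ν] :
    LipschitzOnWith c (fun t => (ν (Ioo σ t)).toReal) (Ioo σ τ) ↔ MeasureLipschitz ν σ τ c := by
  have hdiff : ∀ s t, σ < s → s < t →
      (ν (Ioo σ t)).toReal - (ν (Ioo σ s)).toReal = (ν (Ico s t)).toReal := fun s t hs hst => by
    have h := measureReal_union (μ := ν) (s₁ := Ioo σ s) (s₂ := Ico s t)
      (disjoint_left.2 fun x hx hx' => absurd hx.2 (not_lt.2 hx'.1)) measurableSet_Ico
    rw [Ioo_union_Ico_eq_Ioo hs hst.le] at h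
    change ν.real (Ioo σ t) - ν.real (Ioo σ s) = ν.real (Ico s t)
    linarith
  have hreal : ∀ s t, s < t → (ν (Ico s t) ≤ c * ENNReal.ofReal (t - s) ↔
      (ν (Ico s t)).toReal ≤ c * (t - s)) := fun s t hst => by
    rw [← ENNReal.ofReal_coe_nnreal, ← ENNReal.ofReal_mul c.coe_nonneg,
      ENNReal.le_ofReal_iff_toReal_le (measure_ne_top _ _)
        (mul_nonneg c.coe_nonneg (sub_nonneg.2 hst.le))]
  constructor
  · intro h s t hs hst ht
    rw [hreal s t hst, ← hdiff s t hs hst]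
    have := h.dist_le_mul t ⟨hs.trans hst, ht⟩ s ⟨hs, hst.trans ht⟩
    rw [Real.dist_eq, Real.dist_eq, abs_of_pos (sub_pos.2 hst)] at this
    exact (le_abs_self _).trans this
  · intro h
    have key : ∀ s t, σ < s → s < t → t < τ →
        dist (ν (Ioo σ t)).toReal (ν (Ioo σ s)).toReal ≤ c * dist t s := fun s t hs hst ht => by
      rw [Real.dist_eq, Real.dist_eq, abs_of_pos (sub_pos.2 hst), hdiff s t hs hst,
        abs_of_nonneg ENNReal.toReal_nonneg, ← hreal s t hst]
      exact h s t hs hst ht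
    refine LipschitzOnWith.of_dist_le_mul fun x hx y hy => ?_
    rcases lt_trichotomy x y with hxy | rfl | hxy
    · rw [dist_comm, dist_comm x]
      exact key x y hx.1 hxy hy.2
    · simp
    · exact key y x hy.1 hxy hx.2

theorem MeasureLipschitz.measure_Ioo_le (h : MeasureLipschitz ν σ τ c) {a b : ℝ} (ha : σ ≤ a)
    (hb : b ≤ τ) : ν (Ioo a b) ≤ c * ENNReal.ofReal (b - a) := by
  let δ : ℕ → ℝ := fun n => 1 / ((n : ℝ) + 1)
  have hδ : ∀ n, 0 < δ n := fun n => Nat.one_div_pos_of_nat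
  have hanti : Antitone δ := fun m n hmn => Nat.one_div_le_one_div hmn
  have hU : Ioo a b ⊆ ⋃ n, Ico (a + δ n) (b - δ n) := fun s hs => by
    obtain ⟨n, hn⟩ := exists_nat_one_div_lt (lt_min (sub_pos.2 hs.1) (sub_pos.2 hs.2))
    have h1 : δ n < s - a := hn.trans_le (min_le_left _ _)
    have h2 : δ n < b - s := hn.trans_le (min_le_right _ _)
    exact mem_iUnion.2 ⟨n, by linarith, by linarith⟩
  have hmono : Monotone fun n => Ico (a + δ n) (b - δ n) := fun m n hmn =>
    Ico_subset_Ico (by linarith [hanti hmn]) (by linarith [hanti hmn])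
  refine (measure_mono hU).trans ?_
  rw [hmono.measure_iUnion]
  refine iSup_le fun n => ?_
  rcases lt_or_ge (a + δ n) (b - δ n) with hn | hn
  · refine (h _ _ (by linarith [hδ n]) hn (by linarith [hδ n])).trans ?_
    gcongr <;> linarith [hδ n]
  · simp [Ico_eq_empty (not_lt.2 hn)]

/-- A Lipschitz bound on `(σ, τ)` controls the measure of small punctured neighbourhoods, also at
the endpoints. -/
theorem exists_measure_punctured_le {t : ℝ} (ht : t ∈ Icc σ τ) :
    ∃ r₀ > 0, ∀ (ν : Measure ℝ) (c : ℝ≥0), MeasureLipschitz ν σ τ c → ν (Icc σ τ)ᶜ = 0 →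
      ∀ r, 0 < r → r ≤ r₀ → ν (Ioo (t - r) (t + r) \ {t}) ≤ c * ENNReal.ofReal (2 * r) := by
  obtain ⟨r₁, hr₁, h₁⟩ : ∃ r₁ > 0, σ = t ∨ r₁ ≤ t - σ := by
    rcases ht.1.eq_or_lt with h | h
    · exact ⟨1, one_pos, Or.inl h⟩
    · exact ⟨t - σ, sub_pos.2 h, Or.inr le_rfl⟩
  obtain ⟨r₂, hr₂, h₂⟩ : ∃ r₂ > 0, t = τ ∨ r₂ ≤ τ - t := by
    rcases ht.2.eq_or_lt with h | h
    · exact ⟨1, one_pos, Or.inl h⟩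
    · exact ⟨τ - t, sub_pos.2 h, Or.inr le_rfl⟩
  refine ⟨min r₁ r₂, lt_min hr₁ hr₂, fun ν c hν hsupp r hr hr0 => ?_⟩
  have hsub : Ioo (t - r) (t + r) \ {t} ⊆
      (Icc σ τ)ᶜ ∪ (Ioo (max σ (t - r)) t ∪ Ioo t (min τ (t + r))) := by
    rintro s ⟨⟨hs1, hs2⟩, hst⟩
    by_cases hs : s ∈ Icc σ τ
    · right
      rcases lt_or_gt_of_ne hst with h | h
      · refine Or.inl ⟨max_lt ?_ hs1, h⟩
        rcases h₁ with h₁ | h₁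
        · linarith [hs.1]
        · linarith [hr0.trans (min_le_left r₁ r₂)]
      · refine Or.inr ⟨h, lt_min ?_ hs2⟩
        rcases h₂ with h₂ | h₂
        · linarith [hs.2]
        · linarith [hr0.trans (min_le_right r₁ r₂)]
    · exact Or.inl hs
  calc ν (Ioo (t - r) (t + r) \ {t})
      ≤ ν (Icc σ τ)ᶜ + (ν (Ioo (max σ (t - r)) t) + ν (Ioo t (min τ (t + r)))) :=
        (measure_mono hsub).trans ((measure_union_le _ _).trans
          (add_le_add_right (measure_union_le _ _) _))
    _ ≤ 0 + (c * ENNReal.ofReal r + c * ENNReal.ofReal r) := by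
        refine add_le_add hsupp.le (add_le_add ?_ ?_)
        · refine (hν.measure_Ioo_le (le_max_left _ _) ht.2).trans ?_
          gcongr
          linarith [le_max_right σ (t - r)]
        · refine (hν.measure_Ioo_le ht.1 (min_le_left _ _)).trans ?_
          gcongr
          linarith [min_le_right τ (t + r)]
    _ = c * ENNReal.ofReal (2 * r) := by
        rw [zero_add, ← mul_add, ← ENNReal.ofReal_add hr.le hr.le, two_mul]

end LipschitzMeasure

section VariationMeasure

variable {d k : ℕ}

/-- The measure `I ↦ Var(T; I)` on the time axis. -/
def variationMeasure (T : Current k (SpaceTime d)) : Measure ℝ :=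
  ((massMeasure T).withDensity fun z => ‖spatialPart (orientation T z)‖ₑ).map (tproj d)

theorem variationMeasure_apply (T : Current k (SpaceTime d)) {I : Set ℝ} (hI : MeasurableSet I) :
    variationMeasure T I = variation T I := by
  have hm := (tproj d).continuous.measurable
  rw [variationMeasure, Measure.map_apply hm hI, withDensity_apply _ (hm hI)]
  rfl

theorem variation_le_massMeasure {T : Current k (SpaceTime d)} (hT : mass T < ∞) (I : Set ℝ) :
    variation T I ≤ massMeasure T (tproj d ⁻¹' I) := by
  rw [← (isDualField hT).lintegral_enorm]
  exact lintegral_mono fun z => enorm_le_iff_norm_le.2 (norm_spatialPart_le _)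

theorem isFiniteMeasure_variationMeasure {T : Current k (SpaceTime d)} (hT : mass T < ∞) :
    IsFiniteMeasure (variationMeasure T) := by
  have := isFiniteMeasure_massMeasure hT
  refine ⟨?_⟩
  rw [variationMeasure_apply T MeasurableSet.univ]
  exact (variation_le_massMeasure hT _).trans_lt (measure_lt_top _ _)

theorem massMeasure_compl_Icc {T : Current k (SpaceTime d)} (hT : mass T < ∞) {σ τ : ℝ}
    {K : Set (EuclideanSpace ℝ (Fin d))} (hsupp : support T ⊆ cylinder σ τ K) :
    massMeasure T (tproj d ⁻¹' (Icc σ τ)ᶜ) = 0 := by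
  have := ae_mem_of_support_subset hT hsupp
  refine measure_mono_null (fun z hz => ?_) this
  exact fun hz' => hz hz'.1

theorem variationMeasure_compl_Icc {T : Current k (SpaceTime d)} (hT : mass T < ∞) {σ τ : ℝ}
    {K : Set (EuclideanSpace ℝ (Fin d))} (hsupp : support T ⊆ cylinder σ τ K) :
    variationMeasure T (Icc σ τ)ᶜ = 0 := by
  rw [variationMeasure_apply T measurableSet_Icc.compl, ← nonpos_iff_eq_zero,
    ← massMeasure_compl_Icc hT hsupp]
  exact variation_le_massMeasure hT _

theorem measure_univ_of_compl_eq_zero {X : Type*} [MeasurableSpace X] {ν : Measure X} {A : Set X}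
    (h : ν Aᶜ = 0) : ν univ = ν A := by
  refine le_antisymm ?_ (measure_mono (subset_univ _))
  rw [← union_compl_self A]
  exact (measure_union_le _ _).trans (by rw [h, add_zero])

theorem variation_univ_eq {T : Current k (SpaceTime d)} (hT : mass T < ∞) {σ τ : ℝ}
    {K : Set (EuclideanSpace ℝ (Fin d))} (hsupp : support T ⊆ cylinder σ τ K) :
    variation T univ = variation T (Icc σ τ) := by
  rw [← variationMeasure_apply T MeasurableSet.univ, ← variationMeasure_apply T measurableSet_Icc]
  exact measure_univ_of_compl_eq_zero (variationMeasure_compl_Icc hT hsupp)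

/-- Lower semicontinuity of the variation over the whole time interval; the closed interval causes
no loss of mass at the endpoints, since all supports lie in the cylinder. -/
theorem variation_Icc_le_liminf {S : ℕ → Current k (SpaceTime d)} {T : Current k (SpaceTime d)}
    (hT : mass T < ∞) (hS : ∀ j, mass (S j) < ∞) (hconv : WeakStarTendsto S T) {σ τ : ℝ}
    {K : Set (EuclideanSpace ℝ (Fin d))} (hTsupp : support T ⊆ cylinder σ τ K)
    (hSsupp : ∀ j, support (S j) ⊆ cylinder σ τ K) :
    variation T (Icc σ τ) ≤ liminf (fun j => variation (S j) (Icc σ τ)) atTop := by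
  rw [← variation_univ_eq hT hTsupp]
  simp only [← variation_univ_eq (hS _) (hSsupp _)]
  exact variation_le_liminf hT hS hconv isOpen_univ

/-- The measure `I ↦ Var(S; I) + Var(∂S; I)` on the time axis. -/
def totalVariationMeasure (S : Current (k + 1) (SpaceTime d)) : Measure ℝ :=
  variationMeasure S + variationMeasure (boundary S)

theorem totalVariationMeasure_apply (S : Current (k + 1) (SpaceTime d)) {I : Set ℝ}
    (hI : MeasurableSet I) :
    totalVariationMeasure S I = variation S I + variation (boundary S) I := by
  rw [totalVariationMeasure, Measure.add_apply, variationMeasure_apply S hI,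
    variationMeasure_apply _ hI]

variable {S : Current (k + 1) (SpaceTime d)}

theorem isFiniteMeasure_totalVariationMeasure (hS : IsNormal S) :
    IsFiniteMeasure (totalVariationMeasure S) := by
  have := isFiniteMeasure_variationMeasure hS.mass_lt
  have := isFiniteMeasure_variationMeasure hS.mass_boundary_lt
  unfold totalVariationMeasure
  infer_instance

theorem totalVariationMeasure_compl_Icc (hS : IsNormal S) {σ τ : ℝ}
    {K : Set (EuclideanSpace ℝ (Fin d))} (hsupp : support S ⊆ cylinder σ τ K) :
    totalVariationMeasure S (Icc σ τ)ᶜ = 0 := by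
  rw [totalVariationMeasure, Measure.add_apply, variationMeasure_compl_Icc hS.mass_lt hsupp,
    variationMeasure_compl_Icc hS.mass_boundary_lt ((support_boundary_subset S).trans hsupp),
    add_zero]

theorem lipConst_eq (S : Current (k + 1) (SpaceTime d)) (σ τ : ℝ) :
    lipConst S σ τ = ⨅ (L : ℝ≥0) (_ : LipschitzOnWith L
      (fun t => (totalVariationMeasure S (Ioo σ t)).toReal) (Ioo σ τ)), (L : ℝ≥0∞) := by
  simp only [lipConst, totalVariationMeasure_apply S measurableSet_Ioo]

theorem measureLipschitz_of_lipConst_lt (hS : IsNormal S) {σ τ : ℝ} {c : ℝ≥0}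
    (hc : lipConst S σ τ < c) : MeasureLipschitz (totalVariationMeasure S) σ τ c := by
  have := isFiniteMeasure_totalVariationMeasure hS
  rw [lipConst_eq] at hc
  simp only [iInf_lt_iff] at hc
  obtain ⟨L, hL, hLc⟩ := hc
  exact lipschitzOnWith_measure_Ioo.1 (hL.weaken (by exact_mod_cast hLc.le))

theorem lipConst_le_of_measureLipschitz (hS : IsNormal S) {σ τ : ℝ} {c : ℝ≥0}
    (hc : MeasureLipschitz (totalVariationMeasure S) σ τ c) : lipConst S σ τ ≤ c := by
  have := isFiniteMeasure_totalVariationMeasure hS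
  rw [lipConst_eq]
  exact iInf₂_le c (lipschitzOnWith_measure_Ioo.2 hc)

theorem lipschitzOnWith_variation_of_measureLipschitz {T : Current k (SpaceTime d)}
    (hT : mass T < ∞) {ν : Measure ℝ} (hν : variationMeasure T ≤ ν) {σ τ : ℝ} {c : ℝ≥0}
    (hc : MeasureLipschitz ν σ τ c) :
    LipschitzOnWith c (fun t => (variation T (Ioo σ t)).toReal) (Ioo σ τ) := by
  have := isFiniteMeasure_variationMeasure hT
  simp only [← variationMeasure_apply T measurableSet_Ioo]
  exact lipschitzOnWith_measure_Ioo.2 fun s t hs hst ht => (hν _).trans (hc s t hs hst ht)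

theorem ennreal_liminf_add_le (u v : ℕ → ℝ≥0∞) :
    liminf u atTop + liminf v atTop ≤ liminf (fun n => u n + v n) atTop := by
  simp only [liminf_eq_iSup_iInf_of_nat]
  rw [ENNReal.iSup_add_iSup_of_monotone]
  · exact iSup_mono fun n => le_iInf₂ fun i hi => add_le_add (iInf₂_le i hi) (iInf₂_le i hi)
  · exact fun m n hmn => biInf_mono fun i hi => le_trans hmn hi
  · exact fun m n hmn => biInf_mono fun i hi => le_trans hmn hi

theorem totalVariationMeasure_le_liminf {S : ℕ → Current (k + 1) (SpaceTime d)}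
    {S' : Current (k + 1) (SpaceTime d)} (hS : ∀ j, IsNormal (S j)) (hS' : IsNormal S')
    (hconv : WeakStarTendsto S S') {I : Set ℝ} (hI : IsOpen I) :
    totalVariationMeasure S' I ≤ liminf (fun j => totalVariationMeasure (S j) I) atTop := by
  simp only [totalVariationMeasure_apply _ hI.measurableSet]
  refine (add_le_add
    (variation_le_liminf hS'.mass_lt (fun j => (hS j).mass_lt) hconv hI)
    (variation_le_liminf hS'.mass_boundary_lt (fun j => (hS j).mass_boundary_lt)
      (weakStarTendsto_boundary hconv) hI)).trans ?_
  exact ennreal_liminf_add_le _ _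

/-- Lower semicontinuity of Lipschitz bounds. -/
theorem measureLipschitz_of_frequently {S : ℕ → Current (k + 1) (SpaceTime d)}
    {S' : Current (k + 1) (SpaceTime d)} (hS : ∀ j, IsNormal (S j)) (hS' : IsNormal S')
    (hconv : WeakStarTendsto S S') {σ τ : ℝ} {c : ℝ≥0}
    (hc : ∃ᶠ j in atTop, MeasureLipschitz (totalVariationMeasure (S j)) σ τ c) :
    MeasureLipschitz (totalVariationMeasure S') σ τ c := by
  intro s t hs hst ht
  have key : ∀ ε ∈ Ioo 0 (s - σ),
      totalVariationMeasure S' (Ico s t) ≤ c * ENNReal.ofReal (t - s + ε) := fun ε hε => by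
    calc totalVariationMeasure S' (Ico s t)
        ≤ totalVariationMeasure S' (Ioo (s - ε) t) :=
          measure_mono fun x hx => ⟨by linarith [hx.1, hε.1], hx.2⟩
      _ ≤ liminf (fun j => totalVariationMeasure (S j) (Ioo (s - ε) t)) atTop :=
          totalVariationMeasure_le_liminf hS hS' hconv isOpen_Ioo
      _ ≤ c * ENNReal.ofReal (t - s + ε) := by
          refine liminf_le_of_frequently_le' (hc.mono fun j hj => ?_)
          refine (hj.measure_Ioo_le (by linarith [hε.2]) ht.le).trans (le_of_eq ?_)
          congr 2
          ring
  have hlim : Tendsto (fun ε => (c : ℝ≥0∞) * ENNReal.ofReal (t - s + ε)) (𝓝[>] 0)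
      (𝓝 (c * ENNReal.ofReal (t - s + 0))) :=
    ENNReal.Tendsto.const_mul (ENNReal.tendsto_ofReal
      (((continuous_const.add continuous_id).tendsto 0).mono_left nhdsWithin_le_nhds))
      (Or.inr ENNReal.coe_ne_top)
  rw [add_zero] at hlim
  refine ge_of_tendsto hlim ?_
  filter_upwards [Ioo_mem_nhdsGT (sub_pos.2 hs)] with ε hε using key ε hε

end VariationMeasure

/-! ### Limits of sequences of normal currents -/

section Limits

variable {d k : ℕ}

theorem isCompact_cylinder (σ τ : ℝ) {K : Set (EuclideanSpace ℝ (Fin d))} (hK : IsCompact K) :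
    IsCompact (cylinder σ τ K) := by
  have h : IsCompact ((WithLp.prodContinuousLinearEquiv 2 ℝ ℝ (EuclideanSpace ℝ (Fin d))).symm ''
      (Icc σ τ ×ˢ K)) :=
    (isCompact_Icc.prod hK).image (ContinuousLinearEquiv.continuous _)
  convert h using 1
  ext z
  constructor
  · intro hz
    exact ⟨(tproj d z, pproj d z), hz, rfl⟩
  · rintro ⟨p, hp, rfl⟩
    exact hp

theorem mass_le_of_cylinder {T : Current k (SpaceTime d)} (hT : mass T < ∞) {σ τ : ℝ}
    {K : Set (EuclideanSpace ℝ (Fin d))} (hsupp : support T ⊆ cylinder σ τ K) :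
    mass T ≤ massMeasure T (tproj d ⁻¹' Icc σ τ) :=
  (mass_le_massMeasure_univ hT).trans_eq
    (measure_univ_of_compl_eq_zero (massMeasure_compl_Icc hT hsupp))

theorem linftyNorm_le_liminf {S : ℕ → Current (k + 1) (SpaceTime d)}
    {S' : Current (k + 1) (SpaceTime d)} {I : Set ℝ}
    (h : ∀ᵐ t ∂volume.restrict I, WeakStarTendsto (fun j => sliceAt (S j) t) (sliceAt S' t)) :
    linftyNorm S' I ≤ liminf (fun j => linftyNorm (S j) I) atTop := by
  refine essSup_le_of_ae_le _ ?_
  have hall : ∀ᵐ t ∂volume.restrict I, ∀ j, mass (sliceAt (S j) t) ≤ linftyNorm (S j) I :=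
    ae_all_iff.2 fun j => ENNReal.ae_le_essSup _
  filter_upwards [h, hall] with t ht hle
  exact (mass_le_liminf ht).trans (liminf_le_liminf (Eventually.of_forall hle))

theorem variation_boundary_boundary (S : Current (k + 2) (SpaceTime d)) (I : Set ℝ) :
    variation (boundary (boundary S)) I = 0 := by
  have h0 : mass (boundary (boundary S)) = 0 := by rw [boundary_boundary, mass_zero]
  have hlt : mass (boundary (boundary S)) < ∞ := by simp [h0]
  rw [← nonpos_iff_eq_zero]
  calc variation (boundary (boundary S)) I
      ≤ massMeasure (boundary (boundary S)) (tproj d ⁻¹' I) := variation_le_massMeasure hlt I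
    _ ≤ massMeasure (boundary (boundary S)) univ := measure_mono (subset_univ _)
    _ ≤ mass (boundary (boundary S)) := massMeasure_univ_le_mass hlt
    _ = 0 := h0

/-- Off a countable set of times, the variations do not concentrate along a subsequence. -/
theorem exists_subseq_variation_no_concentration {S : ℕ → Current (k + 1) (SpaceTime d)}
    {C : ℝ≥0} (hC : ∀ j, totalVariationMeasure (S j) univ ≤ C) :
    ∃ (φ : ℕ → ℕ) (D : Set ℝ), StrictMono φ ∧ D.Countable ∧ ∀ t ∉ D, ∀ ε : ℝ, 0 < ε →
      ∃ r > 0, ∀ᶠ j in atTop, variation (S (φ j)) (Ioo (t - r) (t + r) \ {t}) +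
        variation (boundary (S (φ j))) (Ioo (t - r) (t + r) \ {t}) ≤ ENNReal.ofReal ε := by
  obtain ⟨φ, D, hφ, hD, h⟩ := exists_subseq_no_concentration hC
  refine ⟨φ, D, hφ, hD, fun t ht ε hε => ?_⟩
  obtain ⟨r, hr, hev⟩ := h t ht ε hε
  refine ⟨r, hr, hev.mono fun j hj => ?_⟩
  rw [← totalVariationMeasure_apply _ (measurableSet_Ioo.diff (measurableSet_singleton t))]
  exact (measure_mono sdiff_subset).trans hj

theorem linftyNormBoundary_le_liminf {S : ℕ → Current (k + 1) (SpaceTime d)}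
    {S' : Current (k + 1) (SpaceTime d)} (hS : ∀ j, IsNormal (S j)) (hS' : IsNormal S')
    {Z : Set (SpaceTime d)} (hZ : IsCompact Z) (hSZ : ∀ j, support (S j) ⊆ Z)
    (hSZ' : support S' ⊆ Z) (hconv : WeakStarTendsto S S') {D : Set ℝ} (hD : D.Countable)
    (hconc : ∀ t ∉ D, ∀ ε : ℝ, 0 < ε → ∃ r > 0, ∀ᶠ j in atTop,
      variation (S j) (Ioo (t - r) (t + r) \ {t}) +
        variation (boundary (S j)) (Ioo (t - r) (t + r) \ {t}) ≤ ENNReal.ofReal ε) (I : Set ℝ) :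
    linftyNormBoundary S' I ≤ liminf (fun j => linftyNormBoundary (S j) I) atTop := by
  cases k with
  | zero => exact zero_le
  | succ k =>
    refine linftyNorm_le_liminf ?_
    filter_upwards [ae_restrict_of_ae (hD.ae_notMem volume)] with t ht
    refine weakStarTendsto_sliceAt (fun j => (hS j).boundary) hS'.boundary hZ
      (fun j => (support_boundary_subset _).trans (hSZ j))
      ((support_boundary_subset _).trans hSZ') (weakStarTendsto_boundary hconv) fun ε hε => ?_
    obtain ⟨r, hr, hev⟩ := hconc t ht ε hε
    refine ⟨r, hr, hev.mono fun j hj => ?_⟩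
    rw [variation_boundary_boundary, add_zero]
    exact le_add_self.trans hj

theorem variation_Icc_le_add {T : Current k (SpaceTime d)} {a b t r : ℝ} (ha : t - r < a)
    (hb : b < t + r) :
    variation T (Icc a b) ≤ variation T {t} + variation T (Ioo (t - r) (t + r) \ {t}) := by
  have hm : MeasurableSet (Ioo (t - r) (t + r) \ {t}) :=
    measurableSet_Ioo.diff (measurableSet_singleton t)
  rw [← variationMeasure_apply T measurableSet_Icc,
    ← variationMeasure_apply T (measurableSet_singleton t), ← variationMeasure_apply T hm]
  refine (measure_mono fun s hs => ?_).trans (measure_union_le _ _)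
  by_cases hst : s = t
  · exact Or.inl hst
  · exact Or.inr ⟨⟨ha.trans_le hs.1, hs.2.trans_lt hb⟩, hst⟩

/-- Uniform Lipschitz bounds on the variations prevent the mass of the limit from concentrating at
a time which is not charged by the approximating currents. -/
theorem massMeasure_fiber_eq_zero_of_measureLipschitz {S : ℕ → Current (k + 1) (SpaceTime d)}
    {S' : Current (k + 1) (SpaceTime d)} (hS : ∀ j, IsNormal (S j)) (hS' : IsNormal S')
    {σ τ : ℝ} {K : Set (EuclideanSpace ℝ (Fin d))} (hsupp : ∀ j, support (S j) ⊆ cylinder σ τ K)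
    (hconv : WeakStarTendsto S S') {c : ℝ≥0}
    (hc : ∀ j, MeasureLipschitz (totalVariationMeasure (S j)) σ τ c) {M : ℝ} (hM : 0 ≤ M)
    (hLM : ∀ j, linftyNorm (S j) (Icc σ τ) ≤ ENNReal.ofReal M) {t : ℝ} (ht : t ∈ Icc σ τ)
    (h0 : ∀ j, massMeasure (S j) (tproj d ⁻¹' {t}) = 0) :
    massMeasure S' (tproj d ⁻¹' {t}) = 0 := by
  obtain ⟨r₀, hr₀, hpunct⟩ := exists_measure_punctured_le ht
  have key : ∀ r ∈ Ioo 0 (r₀ / 2), massMeasure S' (tproj d ⁻¹' {t}) ≤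
      ENNReal.ofReal ((4 * c + 2 * M) * r) := fun r hr => by
    have hj : ∀ j, massMeasure (S j) (tproj d ⁻¹' Ioo (t - r) (t + r)) ≤
        ENNReal.ofReal ((4 * c + 2 * M) * r) := fun j => by
      have hsub : tproj d ⁻¹' Ioo (t - r) (t + r) ⊆ tproj d ⁻¹' (Icc σ τ)ᶜ ∪
          tproj d ⁻¹' Icc (max σ (t - r)) (min τ (t + r)) := fun z hz => by
        by_cases hz' : tproj d z ∈ Icc σ τ
        · exact Or.inr ⟨max_le hz'.1 (le_of_lt hz.1), le_min hz'.2 (le_of_lt hz.2)⟩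
        · exact Or.inl hz'
      have hvar0 : variation (S j) {t} = 0 := by
        rw [← nonpos_iff_eq_zero, ← h0 j]
        exact variation_le_massMeasure (hS j).mass_lt _
      have hm : MeasurableSet (Ioo (t - 2 * r) (t + 2 * r) \ {t}) :=
        measurableSet_Ioo.diff (measurableSet_singleton t)
      have hvar : variation (S j) (Icc (max σ (t - r)) (min τ (t + r))) ≤
          c * ENNReal.ofReal (2 * (2 * r)) := by
        refine (variation_Icc_le_add (t := t) (r := 2 * r)
          (by linarith [le_max_right σ (t - r), hr.1])
          (by linarith [min_le_right τ (t + r), hr.1])).trans ?_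
        rw [hvar0, zero_add]
        refine le_trans ?_ (hpunct _ c (hc j) (totalVariationMeasure_compl_Icc (hS j) (hsupp j))
          (2 * r) (by linarith [hr.1]) (by linarith [hr.2]))
        rw [totalVariationMeasure_apply _ hm]
        exact le_self_add
      calc massMeasure (S j) (tproj d ⁻¹' Ioo (t - r) (t + r))
          ≤ massMeasure (S j) (tproj d ⁻¹' (Icc σ τ)ᶜ) +
              massMeasure (S j) (tproj d ⁻¹' Icc (max σ (t - r)) (min τ (t + r))) :=
            (measure_mono hsub).trans (measure_union_le _ _)
        _ ≤ 0 + (c * ENNReal.ofReal (2 * (2 * r)) + ENNReal.ofReal (2 * r) * ENNReal.ofReal M) := by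
            refine add_le_add (massMeasure_compl_Icc (hS j).mass_lt (hsupp j)).le ?_
            refine (massMeasure_le_variation_add (hS j) (σ := σ) (τ := τ)
              (Icc_subset_Icc (le_max_left _ _) (min_le_left _ _))).trans (add_le_add hvar ?_)
            refine mul_le_mul' (ENNReal.ofReal_le_ofReal ?_) (hLM j)
            linarith [le_max_right σ (t - r), min_le_right τ (t + r)]
        _ = ENNReal.ofReal ((4 * c + 2 * M) * r) := by
            have hr0 : 0 ≤ r := hr.1.le
            rw [zero_add, ← ENNReal.ofReal_coe_nnreal, ← ENNReal.ofReal_mul c.coe_nonneg,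
              ← ENNReal.ofReal_mul (by positivity), ← ENNReal.ofReal_add (by positivity)
              (by positivity)]
            congr 1
            ring
    calc massMeasure S' (tproj d ⁻¹' {t})
        ≤ massMeasure S' (tproj d ⁻¹' Ioo (t - r) (t + r)) := by
          refine measure_mono fun z hz => ?_
          have hz' : tproj d z = t := hz
          change tproj d z ∈ Ioo (t - r) (t + r)
          rw [hz']
          exact ⟨by linarith [hr.1], by linarith [hr.1]⟩
      _ ≤ liminf (fun j => massMeasure (S j) (tproj d ⁻¹' Ioo (t - r) (t + r))) atTop :=
          massMeasure_le_liminf hS'.mass_lt (fun j => (hS j).mass_lt) hconv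
            (isOpen_Ioo.preimage (tproj d).continuous)
      _ ≤ ENNReal.ofReal ((4 * c + 2 * M) * r) :=
          liminf_le_of_frequently_le' (Eventually.of_forall hj).frequently
  have hlim : Tendsto (fun r : ℝ => ENNReal.ofReal ((4 * c + 2 * M) * r)) (𝓝[>] 0)
      (𝓝 (ENNReal.ofReal ((4 * c + 2 * M) * 0))) :=
    ENNReal.tendsto_ofReal
      (((continuous_const.mul continuous_id).tendsto 0).mono_left nhdsWithin_le_nhds)
  rw [mul_zero, ENNReal.ofReal_zero] at hlim
  refine nonpos_iff_eq_zero.1 (ge_of_tendsto hlim ?_)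
  filter_upwards [Ioo_mem_nhdsGT (show 0 < r₀ / 2 by linarith)] with r hr using key r hr

/-- Under uniform Lipschitz bounds on the variations, the slices converge at every time. -/
theorem weakStarTendsto_sliceAt_of_measureLipschitz {S : ℕ → Current (k + 1) (SpaceTime d)}
    {S' : Current (k + 1) (SpaceTime d)} (hS : ∀ j, IsNormal (S j)) (hS' : IsNormal S')
    {σ τ : ℝ} {K : Set (EuclideanSpace ℝ (Fin d))} (hK : IsCompact K)
    (hsupp : ∀ j, support (S j) ⊆ cylinder σ τ K) (hsupp' : support S' ⊆ cylinder σ τ K)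
    (hconv : WeakStarTendsto S S') {c : ℝ≥0}
    (hc : ∀ j, MeasureLipschitz (totalVariationMeasure (S j)) σ τ c) {t : ℝ}
    (ht : t ∈ Icc σ τ) : WeakStarTendsto (fun j => sliceAt (S j) t) (sliceAt S' t) := by
  obtain ⟨r₀, hr₀, hpunct⟩ := exists_measure_punctured_le ht
  refine weakStarTendsto_sliceAt hS hS' (isCompact_cylinder σ τ hK) hsupp hsupp' hconv
    fun ε hε => ?_
  have hpos : 0 < 2 * (c : ℝ) + 1 := by positivity
  refine ⟨min r₀ (ε / (2 * c + 1)), lt_min hr₀ (by positivity), Eventually.of_forall fun j => ?_⟩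
  set r := min r₀ (ε / (2 * c + 1)) with hr
  have hr0 : 0 < r := lt_min hr₀ (by positivity)
  rw [← totalVariationMeasure_apply _ (measurableSet_Ioo.diff (measurableSet_singleton t))]
  refine (hpunct _ c (hc j) (totalVariationMeasure_compl_Icc (hS j) (hsupp j)) r hr0
    (min_le_left _ _)).trans ?_
  rw [← ENNReal.ofReal_coe_nnreal, ← ENNReal.ofReal_mul c.coe_nonneg]
  refine ENNReal.ofReal_le_ofReal ?_
  have h1 : r * (2 * c + 1) ≤ ε := (le_div_iff₀ hpos).1 (min_le_right _ _)
  nlinarith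

end Limits

end NormalCurrents

end

theorem proposition3p5 {d k : ℕ} {K : Set (EuclideanSpace ℝ (Fin d))} (hK : IsCompact K)
    {σ τ : ℝ} (hστ : σ < τ) (S : ℕ → Current (k + 1) (SpaceTime d))
    (hS : ∀ j, IsNormalIn (S j) σ τ K) {M : ℝ} (hM : 0 < M)
    (hbound : ∀ j, linftyNorm (S j) (Icc σ τ) + linftyNormBoundary (S j) (Icc σ τ)
      + variation (S j) (Icc σ τ) + variation (boundary (S j)) (Icc σ τ) ≤ ENNReal.ofReal M) :
    ∃ (S' : Current (k + 1) (SpaceTime d)) (φ : ℕ → ℕ), StrictMono φ ∧ IsNormalIn S' σ τ K ∧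
      WeakStarTendsto (fun j => S (φ j)) S' ∧
      (∀ᵐ t ∂volume.restrict (Icc σ τ),
        WeakStarTendsto (fun j => sliceAt (S (φ j)) t) (sliceAt S' t)) ∧
      variation S' (Icc σ τ) ≤ liminf (fun j => variation (S (φ j)) (Icc σ τ)) atTop ∧
      linftyNorm S' (Icc σ τ) ≤ liminf (fun j => linftyNorm (S (φ j)) (Icc σ τ)) atTop ∧
      variation (boundary S') (Icc σ τ)
        ≤ liminf (fun j => variation (boundary (S (φ j))) (Icc σ τ)) atTop ∧
      linftyNormBoundary S' (Icc σ τ)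
        ≤ liminf (fun j => linftyNormBoundary (S (φ j)) (Icc σ τ)) atTop ∧
      ((∀ j, IsLipNormalIn (S j) σ τ K) → (∃ L : ℝ≥0, ∀ j, lipConst (S j) σ τ ≤ L) →
        IsLipNormalIn S' σ τ K ∧
        (∀ t ∈ Icc σ τ, WeakStarTendsto (fun j => sliceAt (S (φ j)) t) (sliceAt S' t)) ∧
        lipConst S' σ τ ≤ liminf (fun j => lipConst (S (φ j)) σ τ) atTop) := by
  have hN : ∀ j, IsNormal (S j) := fun j => (hS j).1
  have hsupp : ∀ j, support (S j) ⊆ cylinder σ τ K := fun j => (hS j).2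
  have hsupp_b : ∀ j, support (boundary (S j)) ⊆ cylinder σ τ K := fun j =>
    (support_boundary_subset _).trans (hsupp j)
  have hZ := isCompact_cylinder (d := d) σ τ hK
  have hb1 : ∀ j, linftyNorm (S j) (Icc σ τ) ≤ ENNReal.ofReal M := fun j =>
    (le_self_add.trans (le_self_add.trans le_self_add)).trans (hbound j)
  have hb2 : ∀ j, linftyNormBoundary (S j) (Icc σ τ) ≤ ENNReal.ofReal M := fun j =>
    (le_add_self.trans (le_self_add.trans le_self_add)).trans (hbound j)
  have hb3 : ∀ j, variation (S j) (Icc σ τ) ≤ ENNReal.ofReal M := fun j =>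
    (le_add_self.trans le_self_add).trans (hbound j)
  have hb4 : ∀ j, variation (boundary (S j)) (Icc σ τ) ≤ ENNReal.ofReal M := fun j =>
    le_add_self.trans (hbound j)
  -- The masses are bounded by the variations and the masses of the slices.
  set m : ℝ≥0 := M.toNNReal + (τ - σ).toNNReal * M.toNNReal with hm
  have hmE : (m : ℝ≥0∞) = ENNReal.ofReal M + ENNReal.ofReal (τ - σ) * ENNReal.ofReal M := by
    rw [hm, ENNReal.coe_add, ENNReal.coe_mul]
    rfl
  have hmass : ∀ j, mass (S j) ≤ m := fun j => by
    refine (mass_le_of_cylinder (hN j).mass_lt (hsupp j)).trans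
      ((massMeasure_le_variation_add (hN j) Subset.rfl).trans ?_)
    rw [hmE]
    gcongr
    exacts [hb3 j, hb1 j]
  have hmass_b : ∀ j, mass (boundary (S j)) ≤ m := fun j => by
    refine (mass_le_of_cylinder (hN j).mass_boundary_lt (hsupp_b j)).trans
      ((massMeasure_boundary_le_variation_add (hN j) Subset.rfl).trans ?_)
    rw [hmE]
    gcongr
    exacts [hb4 j, hb2 j]
  obtain ⟨S', φ₁, hφ₁, hconv₁⟩ := exists_subseq_weakStarTendsto hZ hsupp hmass
  obtain ⟨φ₂, D, hφ₂, hD, hconc⟩ := exists_subseq_variation_no_concentration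
    (S := fun j => S (φ₁ j)) (C := M.toNNReal + M.toNNReal) fun j => by
      rw [measure_univ_of_compl_eq_zero (totalVariationMeasure_compl_Icc (hN _) (hsupp _)),
        totalVariationMeasure_apply _ measurableSet_Icc, ENNReal.coe_add]
      exact add_le_add (hb3 _) (hb4 _)
  set φ := φ₁ ∘ φ₂ with hφ
  have hconv : WeakStarTendsto (fun j => S (φ j)) S' := fun ω =>
    (hconv₁ ω).comp hφ₂.tendsto_atTop
  have hmass' : mass S' ≤ m := (mass_le_liminf hconv).trans
    (liminf_le_of_frequently_le' (Eventually.of_forall fun j => hmass (φ j)).frequently)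
  have hmass_b' : mass (boundary S') ≤ m :=
    (mass_le_liminf (weakStarTendsto_boundary hconv)).trans
      (liminf_le_of_frequently_le' (Eventually.of_forall fun j => hmass_b (φ j)).frequently)
  have hsupp' : support S' ⊆ cylinder σ τ K :=
    support_subset_of_weakStarTendsto hZ.isClosed (fun j => hsupp (φ j)) hconv
  have hN' : IsNormal S' :=
    ⟨(add_le_add hmass' hmass_b').trans_lt (ENNReal.add_lt_top.2
      ⟨ENNReal.coe_lt_top, ENNReal.coe_lt_top⟩),
      hZ.of_isClosed_subset Distribution.isClosed_dsupport hsupp'⟩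
  have hslice : ∀ᵐ t ∂volume.restrict (Icc σ τ),
      WeakStarTendsto (fun j => sliceAt (S (φ j)) t) (sliceAt S' t) := by
    filter_upwards [ae_restrict_of_ae (hD.ae_notMem volume)] with t ht
    exact weakStarTendsto_sliceAt (fun j => hN (φ j)) hN' hZ (fun j => hsupp (φ j)) hsupp' hconv
      (hconc t ht)
  have hlinf := linftyNorm_le_liminf hslice
  have hlinf_b := linftyNormBoundary_le_liminf (fun j => hN (φ j)) hN' hZ (fun j => hsupp (φ j))
    hsupp' hconv hD hconc (Icc σ τ)
  refine ⟨S', φ, hφ₁.comp hφ₂, ⟨hN', hsupp'⟩, hconv, hslice,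
    variation_Icc_le_liminf hN'.mass_lt (fun j => (hN (φ j)).mass_lt) hconv hsupp'
      (fun j => hsupp (φ j)), hlinf,
    variation_Icc_le_liminf hN'.mass_boundary_lt (fun j => (hN (φ j)).mass_boundary_lt)
      (weakStarTendsto_boundary hconv) ((support_boundary_subset _).trans hsupp')
      (fun j => hsupp_b (φ j)), hlinf_b, ?_⟩
  rintro hLip ⟨L, hL⟩
  have hlip : ∀ j, MeasureLipschitz (totalVariationMeasure (S (φ j))) σ τ (L + 1) := fun j =>
    measureLipschitz_of_lipConst_lt (hN (φ j)) ((hL (φ j)).trans_lt (by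
      exact_mod_cast lt_add_one L))
  have hlip' : MeasureLipschitz (totalVariationMeasure S') σ τ (L + 1) :=
    measureLipschitz_of_frequently (fun j => hN (φ j)) hN' hconv
      (Eventually.of_forall hlip).frequently
  have hfiber : ∀ t ∈ Icc σ τ, t ∈ ({σ, τ} : Set ℝ) →
      massMeasure S' (tproj d ⁻¹' {t}) = 0 := fun t ht htm =>
    massMeasure_fiber_eq_zero_of_measureLipschitz (fun j => hN (φ j)) hN'
      (fun j => hsupp (φ j)) hconv hlip hM.le (fun j => hb1 (φ j)) ht fun j =>
        measure_mono_null (preimage_mono (singleton_subset_iff.2 htm)) (hLip (φ j)).endpoints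
  refine ⟨⟨⟨hN', hsupp'⟩, ?_, ?_, ⟨L + 1, ?_⟩, ⟨L + 1, ?_⟩⟩, fun t ht =>
    weakStarTendsto_sliceAt_of_measureLipschitz (fun j => hN (φ j)) hN' hK
      (fun j => hsupp (φ j)) hsupp' hconv hlip ht, ?_⟩
  · refine ENNReal.add_lt_top.2 ⟨lt_of_le_of_lt (hlinf.trans (liminf_le_of_frequently_le'
      (Eventually.of_forall fun j => hb1 (φ j)).frequently)) ENNReal.ofReal_lt_top,
      lt_of_le_of_lt (hlinf_b.trans (liminf_le_of_frequently_le'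
      (Eventually.of_forall fun j => hb2 (φ j)).frequently)) ENNReal.ofReal_lt_top⟩
  · rw [insert_eq, preimage_union]
    exact measure_union_null (hfiber σ (left_mem_Icc.2 hστ.le) (by simp))
      (hfiber τ (right_mem_Icc.2 hστ.le) (by simp))
  · exact lipschitzOnWith_variation_of_measureLipschitz hN'.mass_lt
      (Measure.le_add_right le_rfl) hlip'
  · exact lipschitzOnWith_variation_of_measureLipschitz hN'.mass_boundary_lt
      (Measure.le_add_left le_rfl) hlip'
  · refine le_of_forall_gt fun c hc => ?_
    obtain ⟨c', hc1, hc2⟩ := ENNReal.lt_iff_exists_nnreal_btwn.1 hc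
    refine lt_of_le_of_lt ?_ hc2
    refine lipConst_le_of_measureLipschitz hN' (measureLipschitz_of_frequently
      (fun j => hN (φ j)) hN' hconv ?_)
    exact (frequently_lt_of_liminf_lt (by isBoundedDefault) hc1).mono fun j hj =>
      measureLipschitz_of_lipConst_lt (hN (φ j)) hj
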